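/- Let $\nu\in\mathbb{C}\smallsetminus\mathbb{Z}$ with $|\mathrm{Re}\,\nu|<1$ and let $p\in\mathbb{Z}$. Let $\mathscr{S}(\mathbb{C})$ be the Schwartz space of $\mathbb{C}$ and let $$\mathscr{S}_{\mathrm{sis}}^{\nu,p}(\mathbb{C}^\times)=\big\{|z|^{\nu}(z/|z|)^{p}\phi_+(z)+|z|^{-\nu}(z/|z|)^{-p}\phi_-(z):\ \phi_+,\phi_-\in\mathscr{S}(\mathbb{C})\big\},$$ a space of functions on $\mathbb{C}^\times$, with the quotient topology of $\mathscr{S}(\mathbb{C})\times\mathscr{S}(\mathbb{C})$. Let $\mathscr{T}_{\mathrm{sis}}^{\nu,p}(\mathbb{C}^\times)$ be its dual space of continuous linear functionals. Put $$J_{\nu,p}(z)=J_{\nu+p}(z)\,J_{\nu-p}(\bar z),\qquad \boldsymbol{B}_{\nu,p}(z)=\frac{1}{\sin(\pi\nu)}\big(J_{-\nu,-p}(4\pi z)-J_{\nu,p}(4\pi z)\big)\qquad(z\in\mathbb{C}\smallsetminus\{0\}),$$ where $J_\mu$ is the classical Bessel function and the branches are such that $(z/2)^{\nu+p}(\bar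 z/2)^{\nu-p}=|z/2|^{2\nu}(z/|z|)^{2p}$. The function $\boldsymbol{B}_{\nu,p}$ is even, so $\boldsymbol{B}_{\nu,p}(\sqrt{w})$ is well defined for $w\neq 0$. For $\phi\in\mathscr{S}_{\mathrm{sis}}^{\nu,p}(\mathbb{C}^\times)$ let $$\mathrm{H}_{\nu,p}\phi(u)=2\pi^2\iint_{\mathbb{C}^\times}\phi(z)\,\boldsymbol{B}_{\nu,p}(\sqrt{uz})\ i\,dz\wedge d\bar z\qquad(u\in\mathbb{C}^\times),$$ where $i\,dz\wedge d\bar z$ is twice the Lebesgue measure. Then this integral converges absolutely for all $\phi\in\mathscr{S}_{\mathrm{sis}}^{\nu,p}(\mathbb{C}^\times)$ and $u\in\mathbb{C}^\times$, the function $\mathrm{H}_{\nu,p}\phi$ lies in $\mathscr{S}_{\mathrm{sis}}^{\nu,p}(\mathbb{C}^\times)$, and the distributional Hankel transform, defined for $f\in\mathscr{T}_{\mathrm{sis}}^{\nu,p}(\mathbb{C}^\times)$ by $$\langle \mathrm{H}_{\nu,p}f,\mathrm{H}_{\nu,p}\phi\rangle=\langle f,\phi\rangle,\quad\text{or equivalently}\quad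 \langle \mathrm{H}_{\nu,p}f,\phi\rangle=\langle f,\mathrm{H}_{\nu,p}\phi\rangle\qquad(\phi\in\mathscr{S}_{\mathrm{sis}}^{\nu,p}(\mathbb{C}^\times)),$$ is a well-defined automorphism of the space $\mathscr{T}_{\mathrm{sis}}^{\nu,p}(\mathbb{C}^\times)$: it is a linear bijection of $\mathscr{T}_{\mathrm{sis}}^{\nu,p}(\mathbb{C}^\times)$ onto itself, and a homeomorphism both for the strong dual topology and for the weak-$*$ topology. -/

import Mathlib

open MeasureTheory
open scoped SchwartzMap ComplexConjugate

noncomputable section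

namespace SisHankel

/-! ### Bessel functions over the complex numbers -/

/-- The classical Bessel function `J_ν(z)` (`z ≠ 0`), with the principal branch of the power. -/
def besselJ (ν z : ℂ) : ℂ :=
  ∑' n : ℕ, (-1 : ℂ) ^ n * (z / 2) ^ (ν + 2 * n) / (n.factorial * Complex.Gamma (ν + n + 1))

/-- The entire function `(z/2)^{-ν} J_ν(z)`. -/
def besselE (ν z : ℂ) : ℂ :=
  ∑' n : ℕ, (-1 : ℂ) ^ n * (z / 2) ^ (2 * n) / (n.factorial * Complex.Gamma (ν + n + 1))

/-- The function `J_{ν,p}(z) = J_{ν+p}(z) J_{ν-p}(z̄)` on `ℂ ∖ {0}`, where the branches of the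
two powers are conjugate to each other, so that `(z/2)^{ν+p} (z̄/2)^{ν-p}` stands for the
single-valued function `|z/2|^{2ν} (z/|z|)^{2p}`; compare `besselJJ_eq`. -/
def besselJJ (ν : ℂ) (p : ℤ) (z : ℂ) : ℂ :=
  ((‖z / 2‖ : ℝ) : ℂ) ^ (2 * ν) * (z / (‖z‖ : ℝ)) ^ (2 * p) *
    besselE (ν + p) z * besselE (ν - p) (conj z)

/-- The Bessel function `B_{ν,p}(z) = (J_{-ν,-p}(4πz) - J_{ν,p}(4πz)) / sin(πν)`, for `z ≠ 0`
and `ν` not an integer. -/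
def besselB (ν : ℂ) (p : ℤ) (z : ℂ) : ℂ :=
  (besselJJ (-ν) (-p) (4 * Real.pi * z) - besselJJ ν p (4 * Real.pi * z)) /
    Complex.sin (Real.pi * ν)

theorem besselJ_eq (ν : ℂ) {z : ℂ} (hz : z ≠ 0) :
    besselJ ν z = (z / 2) ^ ν * besselE ν z := by
  unfold besselJ besselE
  rw [← tsum_mul_left]
  refine tsum_congr fun n => ?_
  have h2 : z / 2 ≠ 0 := div_ne_zero hz two_ne_zero
  have : (z / 2) ^ (ν + 2 * n) = (z / 2) ^ ν * (z / 2) ^ (2 * n) := by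
    rw [Complex.cpow_add _ _ h2]
    congr 1
    have := Complex.cpow_natCast (z / 2) (2 * n)
    push_cast at this
    exact this
  rw [this]
  ring

/-- Away from the branch cut, `besselJJ` is literally `J_{ν+p}(z) J_{ν-p}(z̄)`. -/
theorem besselJJ_eq (ν : ℂ) (p : ℤ) {z : ℂ} (hz : z ∈ Complex.slitPlane) :
    besselJJ ν p z = besselJ (ν + p) z * besselJ (ν - p) (conj z) := by
  have h0 : z ≠ 0 := Complex.slitPlane_ne_zero hz
  have hc : conj z ≠ 0 := (map_ne_zero _).2 h0
  rw [besselJ_eq _ h0, besselJ_eq _ hc]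
  set w : ℂ := z / 2 with hw
  have hw0 : w ≠ 0 := div_ne_zero h0 two_ne_zero
  have hcw0 : conj w ≠ 0 := (map_ne_zero _).2 hw0
  have hzw : conj z / 2 = conj w := by rw [hw, map_div₀, Complex.conj_ofNat]
  have harg : w.arg ≠ Real.pi := by
    have : w.arg = z.arg := by
      have h : w = ((1 / 2 : ℝ) : ℂ) * z := by rw [hw]; push_cast; ring
      rw [h, Complex.arg_real_mul _ (by norm_num)]
    rw [this]
    exact (Complex.mem_slitPlane_iff_arg.1 hz).1
  have hn : ((‖w‖ : ℝ) : ℂ) ≠ 0 := by simpa using hw0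
  have hnn : conj w * w = ((‖w‖ : ℝ) : ℂ) ^ 2 := by
    rw [Complex.conj_mul']
  have hdir : z / (‖z‖ : ℝ) = w / (‖w‖ : ℝ) := by
    have : (‖z‖ : ℂ) ≠ 0 := by simpa using h0
    have h2 : ‖(2 : ℂ)‖ = 2 := by simp
    rw [hw, norm_div, h2]
    push_cast
    field_simp
  have hpow : w ^ (ν + p) * (conj w) ^ (ν - p) =
      ((‖w‖ : ℝ) : ℂ) ^ (2 * ν) * (w / (‖w‖ : ℝ)) ^ (2 * p) := by
    have h1 : w ^ ν * (conj w) ^ ν = ((‖w‖ : ℝ) : ℂ) ^ (2 * ν) := by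
      rw [Complex.cpow_def_of_ne_zero hw0, Complex.cpow_def_of_ne_zero hcw0,
        Complex.cpow_def_of_ne_zero hn, ← Complex.exp_add, Complex.log_conj _ harg]
      congr 1
      rw [← add_mul, Complex.add_conj, Complex.log_re, ← Complex.ofReal_log (norm_nonneg _)]
      push_cast
      ring
    have h2 : w ^ p / (conj w) ^ p = (w / (‖w‖ : ℝ)) ^ (2 * p) := by
      rw [← div_zpow, zpow_mul]
      congr 1
      rw [div_eq_iff hcw0, zpow_ofNat, div_pow, ← hnn]
      field_simp
    rw [Complex.cpow_add _ _ hw0, Complex.cpow_sub _ _ hcw0, Complex.cpow_intCast,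
      Complex.cpow_intCast, ← h1, ← h2]
    ring
  rw [besselJJ, hdir, hzw, ← hpow]
  ring

theorem besselJJ_neg (ν : ℂ) (p : ℤ) (z : ℂ) : besselJJ ν p (-z) = besselJJ ν p z := by
  have hE : ∀ a w : ℂ, besselE a (-w) = besselE a w := fun a w => by
    simp only [besselE, neg_div, (even_two_mul _).neg_pow]
  simp only [besselJJ, map_neg, hE, neg_div, norm_neg, (even_two_mul p).neg_zpow]

/-- `B_{ν,p}` is even, so that `B_{ν,p}(√w)` does not depend on the choice of the root. -/
theorem besselB_neg (ν : ℂ) (p : ℤ) (z : ℂ) : besselB ν p (-z) = besselB ν p z := by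
  simp only [besselB, mul_neg, besselJJ_neg]

/-- `B_{ν,p}(√w)`. -/
def besselBSqrt (ν : ℂ) (p : ℤ) (w : ℂ) : ℂ := besselB ν p (w ^ (1 / 2 : ℂ))

/-! ### The Hankel transform -/

/-- The measure `i dz ∧ dz̄ = 2 dx dy` on `ℂˣ`. -/
def dzdzbar : Measure ℂˣ := (2 : ENNReal) • Measure.comap ((↑) : ℂˣ → ℂ) volume

/-- The integrand `φ(z) B_{ν,p}(√(uz))`. -/
def hankelIntegrand (ν : ℂ) (p : ℤ) (φ : ℂˣ → ℂ) (u z : ℂˣ) : ℂ :=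
  φ z * besselBSqrt ν p ((u : ℂ) * (z : ℂ))

/-- `(H_{ν,p} φ)(u) = 2π² ∬ φ(z) B_{ν,p}(√(uz)) i dz ∧ dz̄`. -/
def hankel (ν : ℂ) (p : ℤ) (φ : ℂˣ → ℂ) (u : ℂˣ) : ℂ :=
  2 * (Real.pi : ℂ) ^ 2 * ∫ z, hankelIntegrand ν p φ u z ∂dzdzbar

theorem measurableEmbedding_val : MeasurableEmbedding ((↑) : ℂˣ → ℂ) := by
  have h : Topology.IsOpenEmbedding ((↑) : ℂˣ → ℂ) := Units.isOpenEmbedding_val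
  refine ⟨h.injective, comap_measurable _, ?_⟩
  rintro s ⟨t, ht, rfl⟩
  rw [Set.image_preimage_eq_inter_range]
  exact ht.inter h.isOpen_range.measurableSet

/-- Integration against `dzdzbar` is twice Lebesgue integration over the plane. -/
theorem integral_dzdzbar (g : ℂ → ℂ) :
    ∫ z : ℂˣ, g z ∂dzdzbar = 2 * ∫ z : ℂ, g z := by
  have hr : Set.range ((↑) : ℂˣ → ℂ) = {0}ᶜ := by
    ext z
    exact ⟨by rintro ⟨u, rfl⟩; exact u.ne_zero, fun hz => ⟨Units.mk0 z hz, rfl⟩⟩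
  rw [dzdzbar, integral_smul_measure, ← measurableEmbedding_val.integral_map,
    measurableEmbedding_val.map_comap, hr, restrict_compl_singleton]
  simp

/-! ### The spaces of test functions and distributions -/

/-- The function `|z|^ν (z/|z|)^p` on `ℂˣ`. -/
def sisChar (ν : ℂ) (p : ℤ) (z : ℂˣ) : ℂ :=
  ((‖(z : ℂ)‖ : ℝ) : ℂ) ^ ν * ((z : ℂ) / (‖(z : ℂ)‖ : ℝ)) ^ p

/-- The map `(φ₊, φ₋) ↦ |z|^ν (z/|z|)^p φ₊(z) + |z|^{-ν} (z/|z|)^{-p} φ₋(z)`. -/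
def sisMap (ν : ℂ) (p : ℤ) : (𝓢(ℂ, ℂ) × 𝓢(ℂ, ℂ)) →ₗ[ℂ] (ℂˣ → ℂ) where
  toFun φ z := sisChar ν p z * φ.1 z + sisChar (-ν) (-p) z * φ.2 z
  map_add' φ ψ := by
    funext z
    change sisChar ν p z * (φ.1 z + ψ.1 z) + sisChar (-ν) (-p) z * (φ.2 z + ψ.2 z) =
      (sisChar ν p z * φ.1 z + sisChar (-ν) (-p) z * φ.2 z) +
        (sisChar ν p z * ψ.1 z + sisChar (-ν) (-p) z * ψ.2 z)
    ring
  map_smul' c φ := by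
    funext z
    change sisChar ν p z * (c * φ.1 z) + sisChar (-ν) (-p) z * (c * φ.2 z) =
      c * (sisChar ν p z * φ.1 z + sisChar (-ν) (-p) z * φ.2 z)
    ring

/-- `|z|^ν (z/|z|)^p 𝓢(ℂ) + |z|^{-ν} (z/|z|)^{-p} 𝓢(ℂ)`, as a space of functions on `ℂˣ`. -/
def sisSubmodule (ν : ℂ) (p : ℤ) : Submodule ℂ (ℂˣ → ℂ) := LinearMap.range (sisMap ν p)

/-- The space of test functions, as a type that does not carry the topology of pointwise
convergence of the ambient function space. -/
def Ssis (ν : ℂ) (p : ℤ) : Type := sisSubmodule ν p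

instance (ν : ℂ) (p : ℤ) : AddCommGroup (Ssis ν p) :=
  inferInstanceAs (AddCommGroup (sisSubmodule ν p))

instance (ν : ℂ) (p : ℤ) : Module ℂ (Ssis ν p) :=
  inferInstanceAs (Module ℂ (sisSubmodule ν p))

instance (ν : ℂ) (p : ℤ) : CoeFun (Ssis ν p) (fun _ => ℂˣ → ℂ) := ⟨Subtype.val⟩

/-- A function in `sisSubmodule`, as an element of the space of test functions. -/
def Ssis.mk {ν : ℂ} {p : ℤ} (φ : ℂˣ → ℂ) (hφ : φ ∈ sisSubmodule ν p) : Ssis ν p :=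
  Subtype.mk φ hφ

/-- The surjection of `𝓢(ℂ) × 𝓢(ℂ)` onto the space of test functions. -/
def Ssis.ofSchwartz (ν : ℂ) (p : ℤ) : (𝓢(ℂ, ℂ) × 𝓢(ℂ, ℂ)) →ₗ[ℂ] Ssis ν p :=
  (sisMap ν p).rangeRestrict

/-- The topology induced from that of `𝓢(ℂ)`: the quotient topology of `𝓢(ℂ) × 𝓢(ℂ)`, which is
the usual topology on a sum of two Fréchet spaces. -/
instance (ν : ℂ) (p : ℤ) : TopologicalSpace (Ssis ν p) :=
  TopologicalSpace.coinduced (Ssis.ofSchwartz ν p) inferInstance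

/-- The dual space of continuous linear functionals, with the strong dual topology. -/
abbrev Tsis (ν : ℂ) (p : ℤ) : Type := StrongDual ℂ (Ssis ν p)

/-- The same space of continuous linear functionals, with the weak-* topology. -/
abbrev TsisWeak (ν : ℂ) (p : ℤ) : Type := WeakDual ℂ (Ssis ν p)

end SisHankel

end

namespace SisHankel

/-! ### The entire functions `∑ (-x)^n / (n! Γ(μ + n + 1))` -/

/-- The entire function `x^{-μ/2} J_μ(2√x)`. -/
noncomputable def besselEnt (μ x : ℂ) : ℂ :=
  ∑' n : ℕ, (-x) ^ n / (n.factorial * Complex.Gamma (μ + n + 1))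

theorem exists_inv_Gamma_add_nat_mul_pow_le (μ : ℂ) {K : ℝ} (hK : 0 ≤ K) :
    ∃ C, 0 ≤ C ∧ ∀ n : ℕ, ‖(Complex.Gamma (μ + n + 1))⁻¹‖ * K ^ n ≤ C := by
  obtain ⟨N, hN⟩ := exists_nat_gt (K - μ.re)
  have hstep : ∀ n : ℕ, N ≤ n → ‖(Complex.Gamma (μ + n + 1))⁻¹‖ * K ^ n ≤
      ‖(Complex.Gamma (μ + N + 1))⁻¹‖ * K ^ N := by
    intro n hn
    induction n, hn using Nat.le_induction with
    | base => exact le_rfl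
    | succ n hn ih =>
      refine le_trans ?_ ih
      rw [Complex.one_div_Gamma_eq_self_mul_one_div_Gamma_add_one (μ + n + 1), norm_mul]
      have h1 : K ≤ ‖μ + n + 1‖ := by
        refine le_trans ?_ (Complex.re_le_norm _)
        have : (N : ℝ) ≤ n := by exact_mod_cast hn
        simp only [Complex.add_re, Complex.natCast_re, Complex.one_re]
        linarith
      push_cast
      rw [show μ + (n + 1 : ℂ) + 1 = μ + n + 1 + 1 by ring, pow_succ]
      have h2 : 0 ≤ ‖(Complex.Gamma (μ + n + 1 + 1))⁻¹‖ * K ^ n := by positivity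
      nlinarith
  refine ⟨∑ n ∈ Finset.range (N + 1), ‖(Complex.Gamma (μ + n + 1))⁻¹‖ * K ^ n,
    Finset.sum_nonneg fun _ _ => by positivity, fun n => ?_⟩
  have hs : ∀ n ∈ Finset.range (N + 1), ‖(Complex.Gamma (μ + n + 1))⁻¹‖ * K ^ n ≤
      ∑ n ∈ Finset.range (N + 1), ‖(Complex.Gamma (μ + n + 1))⁻¹‖ * K ^ n := fun n hn =>
    Finset.single_le_sum (f := fun n : ℕ => ‖(Complex.Gamma (μ + n + 1))⁻¹‖ * K ^ n)
      (fun _ _ => by positivity) hn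
  rcases le_or_gt N n with h | h
  · exact (hstep n h).trans (hs N (by simp))
  · exact hs n (by simp; omega)

theorem exists_inv_Gamma_add_nat_le (μ : ℂ) :
    ∃ C, 0 ≤ C ∧ ∀ n : ℕ, ‖(Complex.Gamma (μ + n + 1))⁻¹‖ ≤ C := by
  simpa using exists_inv_Gamma_add_nat_mul_pow_le μ zero_le_one

theorem exists_norm_besselEnt_term_le (μ : ℂ) :
    ∃ C, 0 ≤ C ∧ ∀ (n : ℕ) (x : ℂ), ‖(-x) ^ n / (n.factorial * Complex.Gamma (μ + n + 1))‖ ≤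
      C * (‖x‖ ^ n / n.factorial) := by
  obtain ⟨C, hC, h⟩ := exists_inv_Gamma_add_nat_le μ
  refine ⟨C, hC, fun n x => ?_⟩
  rw [div_eq_mul_inv, mul_inv, norm_mul, norm_mul, norm_pow, norm_neg, norm_inv,
    Complex.norm_natCast]
  calc ‖x‖ ^ n * ((n.factorial : ℝ)⁻¹ * ‖(Complex.Gamma (μ + n + 1))⁻¹‖)
      ≤ ‖x‖ ^ n * ((n.factorial : ℝ)⁻¹ * C) := by gcongr; exact h n
    _ = _ := by ring

theorem summable_norm_besselEnt (μ x : ℂ) :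
    Summable fun n : ℕ => ‖(-x) ^ n / (n.factorial * Complex.Gamma (μ + n + 1))‖ := by
  obtain ⟨C, -, h⟩ := exists_norm_besselEnt_term_le μ
  exact Summable.of_nonneg_of_le (fun _ => norm_nonneg _) (fun n => h n x)
    ((Real.summable_pow_div_factorial ‖x‖).mul_left C)

theorem hasSum_besselEnt (μ x : ℂ) :
    HasSum (fun n : ℕ => (-x) ^ n / (n.factorial * Complex.Gamma (μ + n + 1)))
      (besselEnt μ x) :=
  (summable_norm_besselEnt μ x).of_norm.hasSum

/-- `e_{μ-1}(x) = μ e_μ(x) - x e_{μ+1}(x)`. -/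
theorem besselEnt_sub_one (μ x : ℂ) :
    besselEnt (μ - 1) x = μ * besselEnt μ x - x * besselEnt (μ + 1) x := by
  have h1 := (hasSum_besselEnt μ x).mul_left μ
  have h2 := (hasSum_besselEnt (μ + 1) x).mul_left x
  have h2' : HasSum (fun n : ℕ => if n = 0 then 0 else
      n * ((-x) ^ n / (n.factorial * Complex.Gamma (μ + n + 1)))) (-(x * besselEnt (μ + 1) x)) := by
    rw [← hasSum_nat_add_iff' 1]
    simp only [Finset.range_one, Finset.sum_singleton, if_true, sub_zero]
    refine h2.neg.congr_fun fun n => ?_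
    simp only [Nat.add_eq_zero_iff, one_ne_zero, and_false, if_false]
    rw [Nat.factorial_succ]
    have hn : ((n : ℂ) + 1) ≠ 0 := Nat.cast_add_one_ne_zero n
    push_cast
    rw [show μ + ((n : ℂ) + 1) + 1 = μ + 1 + n + 1 by ring, pow_succ]
    simp only [div_eq_mul_inv, mul_inv]
    field_simp
  have h3 := h1.add h2'
  rw [← sub_eq_add_neg] at h3
  refine (hasSum_besselEnt (μ - 1) x).unique (h3.congr_fun fun n => ?_)
  have key := Complex.one_div_Gamma_eq_self_mul_one_div_Gamma_add_one (μ + n)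
  rw [show μ - 1 + n + 1 = μ + n by ring]
  simp only [div_eq_mul_inv, mul_inv]
  rw [key]
  split_ifs with h
  · subst h; simp
  · ring

theorem hasDerivAt_besselEnt (μ x : ℂ) :
    HasDerivAt (besselEnt μ) (-besselEnt (μ + 1) x) x := by
  obtain ⟨C, hC, h⟩ := exists_norm_besselEnt_term_le (μ + 1)
  set R : ℝ := ‖x‖ + 1
  have hx : x ∈ Metric.ball (0 : ℂ) R := by simp [R]
  have hterm : ∀ (n : ℕ) (y : ℂ), HasDerivAt
      (fun z : ℂ => (-z) ^ n / (n.factorial * Complex.Gamma (μ + n + 1)))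
      (if n = 0 then 0 else -((-y) ^ (n - 1) / ((n - 1).factorial *
        Complex.Gamma (μ + 1 + (n - 1 : ℕ) + 1)))) y := by
    intro n y
    have h1 := (((hasDerivAt_id y).neg).pow n).div_const
      (n.factorial * Complex.Gamma (μ + n + 1))
    refine h1.congr_deriv ?_
    rcases n with _ | n
    · simp
    · simp only [Nat.add_sub_cancel, Nat.factorial_succ, Nat.add_eq_zero_iff, one_ne_zero,
        and_false, if_false]
      have hn : ((n : ℂ) + 1) ≠ 0 := Nat.cast_add_one_ne_zero n
      push_cast
      rw [show μ + ((n : ℂ) + 1) + 1 = μ + 1 + n + 1 by ring]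
      simp only [div_eq_mul_inv, mul_inv, id, Pi.neg_apply]
      field_simp
  have hmain := hasDerivAt_tsum_of_isPreconnected
    (u := fun n : ℕ => if n = 0 then 0 else C * (R ^ (n - 1) / (n - 1).factorial))
    (t := Metric.ball (0 : ℂ) R) ?_ Metric.isOpen_ball
    (convex_ball (0 : ℂ) R).isPreconnected (fun n y _ => hterm n y) ?_ hx
    (hasSum_besselEnt μ x).summable hx
  · refine hmain.congr_deriv ?_
    refine HasSum.tsum_eq ?_
    rw [← hasSum_nat_add_iff' 1]
    simpa using (hasSum_besselEnt (μ + 1) x).neg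
  · rw [← summable_nat_add_iff 1]
    simpa using (Real.summable_pow_div_factorial R).mul_left C
  · intro n y hy
    split_ifs with h0
    · simp
    · rw [norm_neg]
      refine (h _ y).trans ?_
      have : ‖y‖ ≤ R := by simpa using (mem_ball_zero_iff.1 hy).le
      gcongr

theorem differentiable_besselEnt (μ : ℂ) : Differentiable ℂ (besselEnt μ) :=
  fun x => (hasDerivAt_besselEnt μ x).differentiableAt

@[fun_prop]
theorem continuous_besselEnt (μ : ℂ) : Continuous (besselEnt μ) :=
  (differentiable_besselEnt μ).continuous

theorem besselEnt_zero (μ : ℂ) : besselEnt μ 0 = (Complex.Gamma (μ + 1))⁻¹ := by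
  rw [besselEnt, tsum_eq_single 0]
  · simp
  · intro n hn; simp [hn]

theorem conj_besselEnt (μ x : ℂ) : conj (besselEnt μ x) = besselEnt (conj μ) (conj x) := by
  rw [besselEnt, besselEnt, Complex.conj_tsum]
  refine tsum_congr fun n => ?_
  simp [map_div₀, ← Complex.Gamma_conj]

theorem besselE_eq_besselEnt (μ z : ℂ) : besselE μ z = besselEnt μ ((z / 2) ^ 2) := by
  unfold besselE besselEnt
  refine tsum_congr fun n => ?_
  rw [neg_pow ((z / 2) ^ 2), pow_mul]

/-! ### Growth of the Bessel functions -/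

theorem Gamma_nat_add_half_mul (n : ℕ) :
    Complex.Gamma (n + 1 / 2) * (4 ^ n * n.factorial) =
      (2 * n).factorial * Complex.Gamma (1 / 2) := by
  induction n with
  | zero => simp
  | succ n ih =>
    have h : (n : ℂ) + 1 / 2 ≠ 0 := by
      intro h
      have := congrArg Complex.re h
      simp at this
      have hn : (0 : ℝ) ≤ n := n.cast_nonneg
      linarith
    have e : ((n + 1 : ℕ) : ℂ) + 1 / 2 = (n + 1 / 2) + 1 := by push_cast; ring
    rw [e, Complex.Gamma_add_one _ h, show 2 * (n + 1) = 2 * n + 1 + 1 by ring,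
      Nat.factorial_succ, Nat.factorial_succ, Nat.factorial_succ]
    push_cast
    linear_combination (4 * (n + 1 / 2) * (n + 1) : ℂ) * ih

theorem cos_sqrt_hasSum (ζ : ℂ) (t : ℝ) (ht : 0 ≤ t) :
    HasSum (fun n : ℕ => (-1) ^ n * (4 * ζ ^ 2) ^ n * (t : ℂ) ^ n / (2 * n).factorial)
      (Complex.cos (2 * ζ * Real.sqrt t)) := by
  refine (Complex.hasSum_cos (2 * ζ * Real.sqrt t)).congr_fun fun n => ?_
  have : ((Real.sqrt t : ℝ) : ℂ) ^ 2 = t := by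
    rw [← Complex.ofReal_pow, Real.sq_sqrt ht]
  rw [pow_mul (2 * ζ * _) 2 n, mul_pow (2 * ζ), this, mul_pow 2 ζ, mul_pow _ (t : ℂ)]
  norm_num
  ring

/-- The integrand of Poisson's integral. -/
noncomputable def poissonKernel (μ : ℂ) (t : ℝ) : ℂ :=
  (t : ℂ) ^ (1 / 2 - 1 : ℂ) * (1 - (t : ℂ)) ^ (μ + 1 / 2 - 1)

theorem intervalIntegrable_poissonKernel {μ : ℂ} (hμ : 0 < μ.re) :
    IntervalIntegrable (poissonKernel μ) volume 0 1 :=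
  Complex.betaIntegral_convergent (by norm_num) (by simp; linarith)

theorem integral_poissonKernel_mul_pow {μ : ℂ} (hμ : 0 < μ.re) (n : ℕ) :
    ∫ t in (0 : ℝ)..1, poissonKernel μ t * (t : ℂ) ^ n =
      Complex.Gamma (n + 1 / 2) * Complex.Gamma (μ + 1 / 2) / Complex.Gamma (μ + n + 1) := by
  have hn : (0 : ℝ) ≤ n := n.cast_nonneg
  have h1 : 0 < ((n : ℂ) + 1 / 2).re := by simp; linarith
  have h2 : 0 < (μ + 1 / 2).re := by simp; linarith
  have h3 : Complex.Gamma (μ + n + 1) ≠ 0 :=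
    Complex.Gamma_ne_zero_of_re_pos (by simp; linarith)
  rw [Complex.Gamma_mul_Gamma_eq_betaIntegral h1 h2,
    show (n : ℂ) + 1 / 2 + (μ + 1 / 2) = μ + n + 1 by ring, mul_div_cancel_left₀ _ h3,
    Complex.betaIntegral]
  refine intervalIntegral.integral_congr_ae (Filter.Eventually.of_forall fun t ht => ?_)
  rw [Set.uIoc_of_le zero_le_one] at ht
  have h0 : (t : ℂ) ≠ 0 := by exact_mod_cast ht.1.ne'
  rw [poissonKernel, show (n : ℂ) + 1 / 2 - 1 = (1 / 2 - 1) + n by ring,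
    Complex.cpow_add _ _ h0, Complex.cpow_natCast]
  ring

/-- Poisson's integral. -/
theorem integral_poissonKernel_mul_cos {μ : ℂ} (hμ : 0 < μ.re) (ζ : ℂ) :
    ∫ t in (0 : ℝ)..1, poissonKernel μ t * Complex.cos (2 * ζ * Real.sqrt t) =
      Complex.Gamma (1 / 2) * Complex.Gamma (μ + 1 / 2) * besselEnt μ (ζ ^ 2) := by
  have hs : Summable fun n : ℕ => (4 * ‖ζ‖ ^ 2) ^ n / (2 * n).factorial := by
    refine Summable.of_nonneg_of_le (fun n => by positivity) (fun n => ?_)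
      (Real.summable_pow_div_factorial (4 * ‖ζ‖ ^ 2))
    gcongr
    omega
  have hmain := intervalIntegral.hasSum_integral_of_dominated_convergence (μ := volume)
    (a := 0) (b := 1)
    (F := fun (n : ℕ) (t : ℝ) =>
      poissonKernel μ t * ((-1) ^ n * (4 * ζ ^ 2) ^ n * (t : ℂ) ^ n / (2 * n).factorial))
    (f := fun t => poissonKernel μ t * Complex.cos (2 * ζ * Real.sqrt t))
    (fun n t => ‖poissonKernel μ t‖ * ((4 * ‖ζ‖ ^ 2) ^ n / (2 * n).factorial))
    (fun n => ?_) (fun n => Filter.Eventually.of_forall fun t ht => ?_)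
    (Filter.Eventually.of_forall fun t _ => hs.mul_left _) ?_
    (Filter.Eventually.of_forall fun t ht => ?_)
  · refine (hmain.unique (((hasSum_besselEnt μ (ζ ^ 2)).mul_left
      (Complex.Gamma (1 / 2) * Complex.Gamma (μ + 1 / 2))).congr_fun fun n => ?_))
    have e : (fun t : ℝ => poissonKernel μ t *
        ((-1) ^ n * (4 * ζ ^ 2) ^ n * (t : ℂ) ^ n / (2 * n).factorial)) =
        fun t : ℝ => ((-1) ^ n * (4 * ζ ^ 2) ^ n / (2 * n).factorial) *
          (poissonKernel μ t * (t : ℂ) ^ n) := by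
      funext t; ring
    rw [e, intervalIntegral.integral_const_mul, integral_poissonKernel_mul_pow hμ]
    have hg := Gamma_nat_add_half_mul n
    have hf1 : (n.factorial : ℂ) ≠ 0 := by exact_mod_cast n.factorial_ne_zero
    have hf2 : ((2 * n).factorial : ℂ) ≠ 0 := by exact_mod_cast (2 * n).factorial_ne_zero
    have hg2 : Complex.Gamma (n + 1 / 2) * 4 ^ n / (2 * n).factorial =
        Complex.Gamma (1 / 2) / n.factorial := by
      rw [div_eq_div_iff hf2 hf1]
      linear_combination hg
    rw [neg_pow (ζ ^ 2), mul_pow 4]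
    simp only [div_eq_mul_inv, mul_inv, one_mul] at hg2 ⊢
    linear_combination ((-1) ^ n * (ζ ^ 2) ^ n * Complex.Gamma (μ + 2⁻¹) *
      (Complex.Gamma (μ + n + 1))⁻¹) * hg2
  · have h1 := (intervalIntegrable_poissonKernel hμ).aestronglyMeasurable
    rw [Set.uIoc_of_le zero_le_one]
    exact h1.mul (by fun_prop)
  · rw [Set.uIoc_of_le zero_le_one] at ht
    rw [norm_mul, norm_div, norm_mul, norm_mul, norm_pow, norm_pow, norm_pow, norm_mul, norm_pow,
      Complex.norm_natCast]
    simp only [norm_neg, norm_one, one_pow, one_mul, Complex.norm_real, Complex.norm_ofNat]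
    gcongr
    rw [Real.norm_of_nonneg ht.1.le]
    exact mul_le_of_le_one_right (by positivity) (pow_le_one₀ ht.1.le ht.2)
  · simp_rw [tsum_mul_left]
    exact (intervalIntegrable_poissonKernel hμ).norm.mul_const _
  · rw [Set.uIoc_of_le zero_le_one] at ht
    exact (cos_sqrt_hasSum ζ t ht.1.le).mul_left _

theorem norm_cos_le (w : ℂ) : ‖Complex.cos w‖ ≤ Real.exp |w.im| := by
  rw [Complex.cos, norm_div, Complex.norm_ofNat, div_le_iff₀ two_pos]
  refine (norm_add_le _ _).trans ?_
  rw [Complex.norm_exp, Complex.norm_exp]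
  have h1 : (w * Complex.I).re ≤ |w.im| := by simpa using neg_le_abs w.im
  have h2 : (-w * Complex.I).re ≤ |w.im| := by simpa using le_abs_self w.im
  linarith [Real.exp_le_exp.2 h1, Real.exp_le_exp.2 h2]

theorem exists_norm_besselEnt_sq_le_of_re_pos {μ : ℂ} (hμ : 0 < μ.re) :
    ∃ C, 0 ≤ C ∧ ∀ ζ : ℂ, ‖besselEnt μ (ζ ^ 2)‖ ≤ C * Real.exp (2 * |ζ.im|) := by
  have hG : Complex.Gamma (1 / 2) * Complex.Gamma (μ + 1 / 2) ≠ 0 :=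
    mul_ne_zero (Complex.Gamma_ne_zero_of_re_pos (by norm_num))
      (Complex.Gamma_ne_zero_of_re_pos (by simp; linarith))
  refine ⟨(∫ t in (0 : ℝ)..1, ‖poissonKernel μ t‖) /
    ‖Complex.Gamma (1 / 2) * Complex.Gamma (μ + 1 / 2)‖, ?_, fun ζ => ?_⟩
  · exact div_nonneg (intervalIntegral.integral_nonneg zero_le_one fun _ _ => norm_nonneg _)
      (norm_nonneg _)
  rw [div_mul_eq_mul_div, le_div_iff₀ (norm_pos_iff.2 hG), mul_comm, ← norm_mul,
    ← integral_poissonKernel_mul_cos hμ, ← intervalIntegral.integral_mul_const]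
  refine intervalIntegral.norm_integral_le_of_norm_le zero_le_one
    (Filter.Eventually.of_forall fun t ht => ?_)
    ((intervalIntegrable_poissonKernel hμ).norm.mul_const _)
  rw [norm_mul]
  gcongr
  refine (norm_cos_le _).trans (Real.exp_le_exp.2 ?_)
  have h1 : Real.sqrt t ≤ 1 := Real.sqrt_le_one.2 ht.2
  have h0 := Real.sqrt_nonneg t
  have : (2 * ζ * (Real.sqrt t : ℂ)).im = 2 * ζ.im * Real.sqrt t := by simp
  rw [this, abs_mul, abs_mul, abs_of_nonneg h0, abs_two]
  exact mul_le_of_le_one_right (by positivity) h1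

/-- `besselEnt μ (ζ²) = O(|ζ|^{2 - Re μ} e^{2|Im ζ|})`. -/
def BesselGrowth (μ : ℂ) : Prop :=
  ∃ C, 0 ≤ C ∧ ∀ ζ : ℂ, 1 ≤ ‖ζ‖ →
    ‖besselEnt μ (ζ ^ 2)‖ ≤ C * ‖ζ‖ ^ (2 - μ.re) * Real.exp (2 * |ζ.im|)

theorem besselGrowth_of_mem_Ioo {μ : ℂ} (h0 : 0 < μ.re) (h2 : μ.re ≤ 2) : BesselGrowth μ := by
  obtain ⟨C, hC, h⟩ := exists_norm_besselEnt_sq_le_of_re_pos h0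
  refine ⟨C, hC, fun ζ hζ => (h ζ).trans ?_⟩
  gcongr
  exact le_mul_of_one_le_right hC (Real.one_le_rpow hζ (by linarith))

theorem BesselGrowth.sub_one {μ : ℂ} (h : BesselGrowth μ) (h' : BesselGrowth (μ + 1)) :
    BesselGrowth (μ - 1) := by
  obtain ⟨C, hC, h⟩ := h
  obtain ⟨C', hC', h'⟩ := h'
  refine ⟨‖μ‖ * C + C', by positivity, fun ζ hζ => ?_⟩
  have hpos : 0 < ‖ζ‖ := by linarith
  rw [besselEnt_sub_one]
  refine (norm_sub_le _ _).trans ?_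
  rw [norm_mul, norm_mul, norm_pow, add_mul, add_mul]
  have e1 : ‖ζ‖ ^ (2 - (μ - 1).re) = ‖ζ‖ ^ 2 * ‖ζ‖ ^ (2 - (μ + 1).re) := by
    rw [← Real.rpow_natCast, ← Real.rpow_add hpos]; congr 1; simp; ring
  refine add_le_add ?_ ?_
  · rw [mul_assoc, mul_assoc]
    gcongr
    refine (h ζ hζ).trans ?_
    rw [mul_assoc]
    have e2 : ‖ζ‖ ^ (2 - μ.re) ≤ ‖ζ‖ ^ (2 - (μ - 1).re) :=
      Real.rpow_le_rpow_of_exponent_le hζ (by simp; linarith)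
    gcongr
  · rw [e1]
    calc ‖ζ‖ ^ 2 * ‖besselEnt (μ + 1) (ζ ^ 2)‖
        ≤ ‖ζ‖ ^ 2 * (C' * ‖ζ‖ ^ (2 - (μ + 1).re) * Real.exp (2 * |ζ.im|)) := by
          gcongr; exact h' ζ hζ
      _ = _ := by ring

theorem BesselGrowth.add_one {μ : ℂ} (h : BesselGrowth μ) (h' : BesselGrowth (μ - 1)) :
    BesselGrowth (μ + 1) := by
  obtain ⟨C, hC, h⟩ := h
  obtain ⟨C', hC', h'⟩ := h'
  refine ⟨‖μ‖ * C + C', by positivity, fun ζ hζ => ?_⟩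
  have hpos : 0 < ‖ζ‖ := by linarith
  have key := besselEnt_sub_one μ (ζ ^ 2)
  have hz : ‖ζ‖ ^ 2 * ‖besselEnt (μ + 1) (ζ ^ 2)‖ ≤
      (‖μ‖ * C + C') * ‖ζ‖ ^ (3 - μ.re) * Real.exp (2 * |ζ.im|) := by
    rw [← norm_pow, ← norm_mul, show ζ ^ 2 * besselEnt (μ + 1) (ζ ^ 2) =
      μ * besselEnt μ (ζ ^ 2) - besselEnt (μ - 1) (ζ ^ 2) by rw [key]; ring]
    refine (norm_sub_le _ _).trans ?_
    rw [norm_mul, add_mul, add_mul]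
    refine add_le_add ?_ ?_
    · rw [mul_assoc, mul_assoc]
      gcongr
      refine (h ζ hζ).trans ?_
      rw [mul_assoc]
      have e2 : ‖ζ‖ ^ (2 - μ.re) ≤ ‖ζ‖ ^ (3 - μ.re) :=
        Real.rpow_le_rpow_of_exponent_le hζ (by linarith)
      gcongr
    · refine (h' ζ hζ).trans (le_of_eq ?_)
      congr 3
      simp; ring
  have e1 : ‖ζ‖ ^ (3 - μ.re) = ‖ζ‖ ^ 2 * ‖ζ‖ ^ (2 - (μ + 1).re) := by
    rw [← Real.rpow_natCast, ← Real.rpow_add hpos]; congr 1; simp; ring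
  rw [e1] at hz
  refine le_of_mul_le_mul_left (hz.trans (le_of_eq ?_)) (pow_pos hpos 2)
  ring

theorem besselGrowth (μ : ℂ) : BesselGrowth μ := by
  have key : ∀ n : ℕ, ∀ μ : ℂ, 0 < μ.re → μ.re ≤ 1 →
      (BesselGrowth (μ + n) ∧ BesselGrowth (μ + n + 1)) ∧
      (BesselGrowth (μ - n) ∧ BesselGrowth (μ - n + 1)) := by
    intro n μ h0 h1
    induction n with
    | zero =>
      have a : BesselGrowth μ := besselGrowth_of_mem_Ioo h0 (by linarith)
      have b : BesselGrowth (μ + 1) := besselGrowth_of_mem_Ioo (by simp; linarith)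
        (by simp; linarith)
      simpa using ⟨a, b⟩
    | succ n ih =>
      obtain ⟨⟨a, b⟩, c, d⟩ := ih
      push_cast
      rw [← add_assoc]
      refine ⟨⟨b, b.add_one (by simpa using a)⟩, ?_, ?_⟩
      · rw [← sub_sub]; exact c.sub_one d
      · rw [← sub_sub, sub_add_cancel]; exact c
  obtain ⟨k, hk⟩ : ∃ k : ℤ, 0 < (μ - k).re ∧ (μ - k).re ≤ 1 := by
    refine ⟨⌈μ.re⌉ - 1, ?_, ?_⟩
    · have := Int.ceil_lt_add_one μ.re
      simp; linarith
    · have := Int.le_ceil μ.re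
      simp; linarith
  obtain ⟨n, rfl | rfl⟩ := k.eq_nat_or_neg
  · simpa using (key n _ hk.1 hk.2).1.1
  · simpa using (key n _ hk.1 hk.2).2.1

/-! ### The Macdonald function -/

open Filter Topology Set

/-- The integrand of `∫₀^∞ e^{-y-t/y} y^{μ-1} dy`. -/
noncomputable def macdonaldKernel (μ : ℂ) (t y : ℝ) : ℂ :=
  (Real.exp (-y - t / y) : ℂ) * (y : ℂ) ^ (μ - 1)

/-- The function `2 t^{μ/2} K_μ(2√t)`. -/
noncomputable def macdonald (μ : ℂ) (t : ℝ) : ℂ := ∫ y in Ioi (0 : ℝ), macdonaldKernel μ t y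

theorem exists_rpow_le_exp {a : ℝ} (ha : 0 ≤ a) :
    ∃ C, 0 < C ∧ ∀ x : ℝ, 0 < x → x ^ a ≤ C * Real.exp x := by
  obtain ⟨n, hn⟩ := exists_nat_ge a
  refine ⟨1 + n.factorial, by positivity, fun x hx => ?_⟩
  have h1 : x ^ a ≤ 1 + x ^ n := by
    rcases le_total x 1 with h | h
    · have := Real.rpow_le_one hx.le h ha
      have : 0 ≤ x ^ n := by positivity
      linarith
    · have := Real.rpow_le_rpow_of_exponent_le h hn
      rw [Real.rpow_natCast] at this
      linarith
  have h2 := Real.pow_div_factorial_le_exp x hx.le n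
  rw [div_le_iff₀ (by positivity)] at h2
  have h3 := Real.one_le_exp hx.le
  linarith

theorem exists_exp_neg_div_le {a : ℝ} (ha : 0 ≤ a) :
    ∃ C, 0 < C ∧ ∀ t y : ℝ, 0 < t → 0 < y → Real.exp (-(t / y)) ≤ C * t ^ (-a) * y ^ a := by
  obtain ⟨C, hC, h⟩ := exists_rpow_le_exp ha
  refine ⟨C, hC, fun t y ht hy => ?_⟩
  have h1 := h (t / y) (div_pos ht hy)
  rw [Real.exp_neg, inv_le_comm₀ (Real.exp_pos _) (by positivity)]
  rw [← div_le_iff₀' hC, Real.div_rpow ht.le hy.le] at h1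
  refine le_trans (le_of_eq ?_) h1
  rw [Real.rpow_neg ht.le]
  field_simp

theorem norm_macdonaldKernel (μ : ℂ) (t : ℝ) {y : ℝ} (hy : 0 < y) :
    ‖macdonaldKernel μ t y‖ = Real.exp (-y) * Real.exp (-(t / y)) * y ^ (μ.re - 1) := by
  rw [macdonaldKernel, norm_mul, Complex.norm_real, Real.norm_of_nonneg (Real.exp_pos _).le,
    Complex.norm_cpow_eq_rpow_re_of_pos hy, ← Real.exp_add]
  simp [sub_eq_add_neg]

theorem continuousOn_macdonaldKernel (μ : ℂ) (t : ℝ) :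
    ContinuousOn (macdonaldKernel μ t) (Ioi 0) := by
  unfold macdonaldKernel
  refine ContinuousOn.mul ?_ ?_
  · refine Complex.continuous_ofReal.comp_continuousOn (Real.continuous_exp.comp_continuousOn ?_)
    exact continuousOn_id.neg.sub (continuousOn_const.div continuousOn_id fun y hy => (ne_of_gt hy))
  · intro y hy
    exact ((continuousAt_cpow_const (Complex.ofReal_mem_slitPlane.2 hy)).comp
      Complex.continuous_ofReal.continuousAt).continuousWithinAt

theorem integrableOn_exp_mul_rpow {s : ℝ} {t : ℝ} (ht : 0 < t) :
    IntegrableOn (fun y : ℝ => Real.exp (-y) * Real.exp (-(t / y)) * y ^ (s - 1)) (Ioi 0) := by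
  obtain ⟨C, hC, h⟩ := exists_exp_neg_div_le (a := |s| + 1) (by positivity)
  have hs : 0 < s + (|s| + 1) := by linarith [neg_abs_le s]
  refine Integrable.mono' ((Real.GammaIntegral_convergent hs).const_mul (C * t ^ (-(|s| + 1))))
    ?_ ?_
  · refine ContinuousOn.aestronglyMeasurable (fun y hy => ?_) measurableSet_Ioi
    have hy' : y ≠ 0 := ne_of_gt hy
    exact (((Real.continuous_exp.continuousAt.comp continuousAt_neg).mul
      (Real.continuous_exp.continuousAt.comp ((continuousAt_const.div continuousAt_id hy').neg))).mul
      (continuousAt_id.rpow_const (Or.inl hy'))).continuousWithinAt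
  · filter_upwards [ae_restrict_mem measurableSet_Ioi] with y hy
    have hy : 0 < y := hy
    rw [Real.norm_of_nonneg (by positivity)]
    calc Real.exp (-y) * Real.exp (-(t / y)) * y ^ (s - 1)
        ≤ Real.exp (-y) * (C * t ^ (-(|s| + 1)) * y ^ (|s| + 1)) * y ^ (s - 1) := by
          gcongr; exact h t y ht hy
      _ = C * t ^ (-(|s| + 1)) * (Real.exp (-y) * (y ^ (|s| + 1) * y ^ (s - 1))) := by ring
      _ = _ := by rw [← Real.rpow_add hy]; congr 3; ring

theorem integrableOn_macdonaldKernel (μ : ℂ) {t : ℝ} (ht : 0 < t) :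
    IntegrableOn (macdonaldKernel μ t) (Ioi 0) := by
  refine Integrable.mono' (integrableOn_exp_mul_rpow (s := μ.re) ht)
    ((continuousOn_macdonaldKernel μ t).aestronglyMeasurable measurableSet_Ioi) ?_
  filter_upwards [ae_restrict_mem measurableSet_Ioi] with y hy
  exact (norm_macdonaldKernel μ t hy).le

/-- `∫₀^∞ e^{-y-t/y} y^{s-1} dy = O(t^{-a})` for `a ≥ 0`, `a + s > 0`. -/
theorem exists_integral_exp_mul_rpow_le {a s : ℝ} (ha : 0 ≤ a) (has : 0 < a + s) :
    ∃ C, 0 < C ∧ ∀ t : ℝ, 0 < t →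
      ∫ y in Ioi (0 : ℝ), Real.exp (-y) * Real.exp (-(t / y)) * y ^ (s - 1) ≤ C * t ^ (-a) := by
  obtain ⟨C, hC, h⟩ := exists_exp_neg_div_le ha
  refine ⟨C * Real.Gamma (a + s), mul_pos hC (Real.Gamma_pos_of_pos has), fun t ht => ?_⟩
  rw [mul_right_comm, Real.Gamma_eq_integral has, ← integral_const_mul]
  refine setIntegral_mono_on (integrableOn_exp_mul_rpow ht)
    ((Real.GammaIntegral_convergent has).const_mul _) measurableSet_Ioi fun y hy => ?_
  have hy : 0 < y := hy
  calc Real.exp (-y) * Real.exp (-(t / y)) * y ^ (s - 1)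
      ≤ Real.exp (-y) * (C * t ^ (-a) * y ^ a) * y ^ (s - 1) := by
        gcongr; exact h t y ht hy
    _ = C * t ^ (-a) * (Real.exp (-y) * (y ^ a * y ^ (s - 1))) := by ring
    _ = _ := by rw [← Real.rpow_add hy, add_sub_assoc]

theorem norm_macdonald_le (μ : ℂ) (t : ℝ) : ‖macdonald μ t‖ ≤
    ∫ y in Ioi (0 : ℝ), Real.exp (-y) * Real.exp (-(t / y)) * y ^ (μ.re - 1) := by
  refine (norm_integral_le_integral_norm _).trans (le_of_eq ?_)
  exact setIntegral_congr_fun measurableSet_Ioi fun y hy => norm_macdonaldKernel μ t hy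

theorem tendsto_macdonald_zero {μ : ℂ} (hμ : 0 < μ.re) :
    Tendsto (macdonald μ) (𝓝[>] 0) (𝓝 (Complex.Gamma μ)) := by
  rw [Complex.Gamma_eq_integral hμ, Complex.GammaIntegral]
  refine tendsto_integral_filter_of_dominated_convergence
    (fun y => Real.exp (-y) * y ^ (μ.re - 1)) ?_ ?_ (Real.GammaIntegral_convergent hμ) ?_
  · exact Eventually.of_forall fun t =>
      (continuousOn_macdonaldKernel μ t).aestronglyMeasurable measurableSet_Ioi
  · filter_upwards [self_mem_nhdsWithin] with t ht
    filter_upwards [ae_restrict_mem measurableSet_Ioi] with y hy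
    rw [norm_macdonaldKernel μ t hy]
    have hy : 0 < y := hy
    have : Real.exp (-(t / y)) ≤ 1 := Real.exp_le_one_iff.2 (neg_nonpos.2 (div_pos ht hy).le)
    have := mul_le_mul_of_nonneg_left this (Real.exp_pos (-y)).le
    rw [mul_one] at this
    gcongr
  · filter_upwards with y
    have : Tendsto (macdonaldKernel μ · y) (𝓝 0) (𝓝 (macdonaldKernel μ 0 y)) := by
      refine ContinuousAt.tendsto (f := fun t => macdonaldKernel μ t y) ?_
      unfold macdonaldKernel
      fun_prop
    have e : macdonaldKernel μ 0 y = (Real.exp (-y) : ℂ) * (y : ℂ) ^ (μ - 1) := by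
      simp [macdonaldKernel]
    rw [e] at this
    exact this.mono_left nhdsWithin_le_nhds

theorem hasDerivAt_macdonald (μ : ℂ) {t : ℝ} (ht : 0 < t) :
    HasDerivAt (macdonald μ) (-macdonald (μ - 1) t) t := by
  have hs : Ioi (t / 2) ∈ 𝓝 t := Ioi_mem_nhds (by linarith)
  have h := hasDerivAt_integral_of_dominated_loc_of_deriv_le (μ := volume.restrict (Ioi (0 : ℝ)))
    (F := macdonaldKernel μ) (F' := fun t y => -macdonaldKernel (μ - 1) t y) (x₀ := t)
    (bound := fun y => Real.exp (-y) * Real.exp (-((t / 2) / y)) * y ^ ((μ - 1).re - 1)) hs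
    (Eventually.of_forall fun t =>
      (continuousOn_macdonaldKernel μ t).aestronglyMeasurable measurableSet_Ioi)
    (integrableOn_macdonaldKernel μ ht)
    ((continuousOn_macdonaldKernel (μ - 1) t).aestronglyMeasurable measurableSet_Ioi).neg
    ?_ (integrableOn_exp_mul_rpow (by linarith)) ?_
  · refine h.2.congr_deriv ?_
    rw [integral_neg, macdonald]
  · filter_upwards [ae_restrict_mem measurableSet_Ioi] with y hy x hx
    have hy : 0 < y := hy
    have hx : t / 2 < x := hx
    rw [norm_neg, norm_macdonaldKernel _ _ hy]
    gcongr
  · filter_upwards [ae_restrict_mem measurableSet_Ioi] with y hy x hx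
    have hy : 0 < y := hy
    have hy0 : (y : ℂ) ≠ 0 := by exact_mod_cast hy.ne'
    have h1 : HasDerivAt (fun t : ℝ => -y - t / y) (-(1 / y)) x := by
      simpa using ((hasDerivAt_id x).div_const y).const_sub (-y)
    have h2 := (h1.exp.ofReal_comp).mul_const ((y : ℂ) ^ (μ - 1))
    refine h2.congr_deriv ?_
    rw [macdonaldKernel, Complex.cpow_sub (μ - 1) 1 hy0, Complex.cpow_one]
    push_cast
    field_simp

theorem macdonald_add_one (μ : ℂ) {t : ℝ} (ht : 0 < t) :
    macdonald (μ + 1) t = μ * macdonald μ t + t * macdonald (μ - 1) t := by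
  have hderiv : ∀ y ∈ Ioi (0 : ℝ), HasDerivAt (macdonaldKernel (μ + 1) t)
      (μ * macdonaldKernel μ t y + t * macdonaldKernel (μ - 1) t y -
        macdonaldKernel (μ + 1) t y) y := by
    intro y hy
    have hy : 0 < y := hy
    have hy0 : (y : ℂ) ≠ 0 := by exact_mod_cast hy.ne'
    have h1 : HasDerivAt (fun y : ℝ => -y - t / y) (-1 + t / y ^ 2) y := by
      have := ((hasDerivAt_id y).neg).sub ((hasDerivAt_inv hy.ne').const_mul t)
      refine this.congr_deriv ?_
      field_simp
      ring
    have h2 := (h1.exp.ofReal_comp)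
    have h3 : HasDerivAt (fun y : ℝ => (y : ℂ) ^ (μ + 1 - 1)) (μ * (y : ℂ) ^ (μ - 1)) y := by
      have := (hasDerivAt_id (y : ℂ)).cpow_const (c := μ)
        (Complex.ofReal_mem_slitPlane.2 hy)
      simpa using this.comp_ofReal
    refine (h2.mul h3).congr_deriv ?_
    simp only [macdonaldKernel]
    rw [Complex.cpow_sub (μ - 1) 1 hy0, Complex.cpow_one, add_sub_cancel_right,
      show (y : ℂ) ^ μ = (y : ℂ) ^ (μ - 1) * y by
        rw [Complex.cpow_sub _ 1 hy0, Complex.cpow_one]; field_simp]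
    push_cast
    field_simp
    ring
  have hi : IntegrableOn (fun y => μ * macdonaldKernel μ t y + t * macdonaldKernel (μ - 1) t y -
      macdonaldKernel (μ + 1) t y) (Ioi 0) :=
    (((integrableOn_macdonaldKernel μ ht).const_mul μ).add
      ((integrableOn_macdonaldKernel (μ - 1) ht).const_mul (t : ℂ))).sub
      (integrableOn_macdonaldKernel (μ + 1) ht)
  have hinf := tendsto_zero_of_hasDerivAt_of_integrableOn_Ioi hderiv hi
    (integrableOn_macdonaldKernel (μ + 1) ht)
  have hzero : Tendsto (macdonaldKernel (μ + 1) t) (𝓝[>] 0) (𝓝 0) := by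
    obtain ⟨C, hC, h⟩ := exists_exp_neg_div_le (a := |μ.re| + 1) (by positivity)
    have hp : 0 < μ.re + (|μ.re| + 1) := by linarith [neg_abs_le μ.re]
    have hlim : Tendsto (fun y : ℝ => C * t ^ (-(|μ.re| + 1)) * y ^ (μ.re + (|μ.re| + 1)))
        (𝓝[>] 0) (𝓝 0) := by
      have : Tendsto (fun y : ℝ => y ^ (μ.re + (|μ.re| + 1))) (𝓝 0)
          (𝓝 (0 ^ (μ.re + (|μ.re| + 1)))) :=
        (Real.continuousAt_rpow_const 0 _ (Or.inr hp.le)).tendsto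
      rw [Real.zero_rpow hp.ne'] at this
      simpa using (this.mono_left nhdsWithin_le_nhds).const_mul (C * t ^ (-(|μ.re| + 1)))
    refine squeeze_zero_norm' ?_ hlim
    filter_upwards [self_mem_nhdsWithin] with y hy
    have hy : 0 < y := hy
    rw [norm_macdonaldKernel _ _ hy, show (μ + 1).re - 1 = μ.re by simp]
    calc Real.exp (-y) * Real.exp (-(t / y)) * y ^ μ.re
        ≤ 1 * (C * t ^ (-(|μ.re| + 1)) * y ^ (|μ.re| + 1)) * y ^ μ.re := by
          gcongr
          · exact Real.exp_le_one_iff.2 (by linarith)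
          · exact h t y ht hy
      _ = C * t ^ (-(|μ.re| + 1)) * (y ^ μ.re * y ^ (|μ.re| + 1)) := by ring
      _ = _ := by rw [← Real.rpow_add hy]
  have key := integral_Ioi_deriv_mul_eq_sub (a := (0 : ℝ)) (u := fun _ => (1 : ℂ))
    (u' := fun _ => 0) (v := macdonaldKernel (μ + 1) t) (fun x _ => hasDerivAt_const x 1)
    hderiv (by simpa [Pi.mul_def, Pi.add_def] using hi) (a' := 0) (b' := 0)
    (by simpa [Pi.mul_def] using hzero) (by simpa [Pi.mul_def] using hinf)
  simp only [zero_mul, one_mul, zero_add, sub_zero] at key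
  have hadd : Integrable (fun y => μ * macdonaldKernel μ t y + t * macdonaldKernel (μ - 1) t y)
      (volume.restrict (Ioi 0)) := ((integrableOn_macdonaldKernel μ ht).const_mul μ).add
      ((integrableOn_macdonaldKernel (μ - 1) ht).const_mul (t : ℂ))
  rw [integral_sub hadd (integrableOn_macdonaldKernel (μ + 1) ht),
    integral_add ((integrableOn_macdonaldKernel μ ht).const_mul μ)
      ((integrableOn_macdonaldKernel (μ - 1) ht).const_mul (t : ℂ)),
    integral_const_mul, integral_const_mul] at key
  exact (sub_eq_zero.1 key).symm

theorem macdonald_neg (μ : ℂ) {t : ℝ} (ht : 0 < t) :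
    macdonald (-μ) t = (t : ℂ) ^ (-μ) * macdonald μ t := by
  have ht0 : (t : ℂ) ≠ 0 := by exact_mod_cast ht.ne'
  have h1 := integral_comp_rpow_Ioi (macdonaldKernel (-μ) t) (p := -1) (by norm_num)
  have h2 := integral_comp_mul_left_Ioi' (fun y : ℝ => (|(-1 : ℝ)| * y ^ ((-1 : ℝ) - 1)) •
    macdonaldKernel (-μ) t (y ^ (-1 : ℝ))) 0 (b := t⁻¹) (inv_pos.2 ht)
  rw [mul_zero, h1] at h2
  rw [macdonald, macdonald, ← h2, ← integral_const_mul, ← integral_smul]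
  refine setIntegral_congr_fun measurableSet_Ioi fun y hy => ?_
  have hy : 0 < y := hy
  have hy0 : (y : ℂ) ≠ 0 := by exact_mod_cast hy.ne'
  simp only [macdonaldKernel]
  have e1 : (t⁻¹ * y) ^ (-1 : ℝ) = t / y := by
    rw [Real.rpow_neg_one]; field_simp
  have e2 : (t⁻¹ * y) ^ ((-1 : ℝ) - 1) = t ^ 2 / y ^ 2 := by
    rw [show (-1 : ℝ) - 1 = -(2 : ℕ) by norm_num, Real.rpow_neg (by positivity),
      Real.rpow_natCast]
    field_simp
  have e3 : -(t / y) - t / (t / y) = -y - t / y := by field_simp; ring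
  have e4 : ((t / y : ℝ) : ℂ) ^ (-μ - 1) = (t : ℂ) ^ (-μ - 1) * (y : ℂ) ^ (μ + 1) := by
    rw [div_eq_mul_inv, Complex.ofReal_mul, Complex.mul_cpow_ofReal_nonneg ht.le (by positivity),
      Complex.ofReal_inv, Complex.inv_cpow, ← Complex.cpow_neg]
    · congr 2; ring
    · rw [Complex.arg_ofReal_of_nonneg hy.le]; exact Real.pi_pos.ne
  rw [e1, e2, e3, e4]
  rw [Complex.cpow_sub (-μ) 1 ht0, Complex.cpow_one, Complex.cpow_add _ 1 hy0,
    Complex.cpow_sub _ 1 hy0, Complex.cpow_one]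
  simp only [abs_neg, abs_one, one_mul, Complex.real_smul]
  push_cast
  field_simp

/-- The series expansion of `macdonald`, in terms of the two solutions at the origin. -/
noncomputable def macdonaldSeries (μ : ℂ) (t : ℝ) : ℂ :=
  Real.pi / Complex.sin (Real.pi * μ) *
    (besselEnt (-μ) (-t) - (t : ℂ) ^ μ * besselEnt μ (-t))

theorem sin_pi_mul_add_one (μ : ℂ) :
    Complex.sin (Real.pi * (μ + 1)) = -Complex.sin (Real.pi * μ) := by
  rw [mul_add, mul_one, Complex.sin_add_pi]

theorem sin_pi_mul_sub_one (μ : ℂ) :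
    Complex.sin (Real.pi * (μ - 1)) = -Complex.sin (Real.pi * μ) := by
  rw [mul_sub, mul_one, Complex.sin_sub_pi]

theorem sin_pi_mul_ne_zero {μ : ℂ} (hμ : ∀ n : ℤ, μ ≠ n) : Complex.sin (Real.pi * μ) ≠ 0 := by
  rw [Complex.sin_ne_zero_iff]
  intro k hk
  apply hμ k
  have : (Real.pi : ℂ) ≠ 0 := by exact_mod_cast Real.pi_ne_zero
  exact mul_left_cancel₀ this (by rw [hk]; ring)

theorem hasDerivAt_macdonaldSeries (μ : ℂ) {t : ℝ} (ht : 0 < t) :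
    HasDerivAt (macdonaldSeries μ) (-macdonaldSeries (μ - 1) t) t := by
  have ht0 : (t : ℂ) ≠ 0 := by exact_mod_cast ht.ne'
  have hE : ∀ a : ℂ, HasDerivAt (fun s : ℝ => besselEnt a (-(s : ℂ))) (besselEnt (a + 1) (-t)) t := by
    intro a
    have := (hasDerivAt_besselEnt a (-(t : ℂ))).scomp (t : ℂ) (hasDerivAt_neg (t : ℂ))
    simpa [Function.comp_def] using this.comp_ofReal
  have hp : HasDerivAt (fun s : ℝ => (s : ℂ) ^ μ) (μ * (t : ℂ) ^ (μ - 1)) t := by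
    have := (hasDerivAt_id (t : ℂ)).cpow_const (c := μ) (Complex.ofReal_mem_slitPlane.2 ht)
    simpa using this.comp_ofReal
  refine (((hE (-μ)).sub (hp.mul (hE μ))).const_mul _).congr_deriv ?_
  rw [macdonaldSeries, sin_pi_mul_sub_one, besselEnt_sub_one,
    show (t : ℂ) ^ μ = (t : ℂ) ^ (μ - 1) * t by
      rw [Complex.cpow_sub _ 1 ht0, Complex.cpow_one]; field_simp,
    show -(μ - 1) = -μ + 1 by ring]
  ring

theorem macdonaldSeries_add_one (μ : ℂ) {t : ℝ} (ht : 0 < t) :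
    macdonaldSeries (μ + 1) t = μ * macdonaldSeries μ t + t * macdonaldSeries (μ - 1) t := by
  have ht0 : (t : ℂ) ≠ 0 := by exact_mod_cast ht.ne'
  simp only [macdonaldSeries, sin_pi_mul_sub_one, sin_pi_mul_add_one]
  have h1 := besselEnt_sub_one μ (-t)
  have h2 := besselEnt_sub_one (-μ) (-t)
  rw [show -(μ + 1) = -μ - 1 by ring, show -(μ - 1) = -μ + 1 by ring, h1, h2,
    Complex.cpow_add _ 1 ht0, Complex.cpow_sub _ 1 ht0, Complex.cpow_one]
  field_simp
  ring

theorem macdonaldSeries_neg (μ : ℂ) {t : ℝ} (ht : 0 < t) :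
    macdonaldSeries (-μ) t = (t : ℂ) ^ (-μ) * macdonaldSeries μ t := by
  have ht0 : (t : ℂ) ≠ 0 := by exact_mod_cast ht.ne'
  have h : (t : ℂ) ^ (-μ) * (t : ℂ) ^ μ = 1 := by
    rw [← Complex.cpow_add _ _ ht0]; simp
  simp only [macdonaldSeries, mul_neg, Complex.sin_neg, neg_neg, div_neg]
  linear_combination ((Real.pi / Complex.sin (Real.pi * μ)) * besselEnt μ (-t)) * h

theorem tendsto_ofReal_cpow_zero {μ : ℂ} (hμ : 0 < μ.re) :
    Tendsto (fun t : ℝ => (t : ℂ) ^ μ) (𝓝[>] 0) (𝓝 0) := by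
  have h := (Complex.continuousAt_ofReal_cpow_const 0 μ (Or.inl hμ)).tendsto
  have h0 : μ ≠ 0 := by rintro rfl; simp at hμ
  rw [Complex.ofReal_zero, Complex.zero_cpow h0] at h
  exact h.mono_left nhdsWithin_le_nhds

theorem tendsto_macdonaldSeries_zero {μ : ℂ} (hμ' : ∀ n : ℤ, μ ≠ n) (hμ : 0 < μ.re) :
    Tendsto (macdonaldSeries μ) (𝓝[>] 0) (𝓝 (Complex.Gamma μ)) := by
  have hE : ∀ a : ℂ, Tendsto (fun s : ℝ => besselEnt a (-(s : ℂ))) (𝓝[>] 0)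
      (𝓝 (Complex.Gamma (a + 1))⁻¹) := by
    intro a
    have : Continuous fun s : ℝ => besselEnt a (-(s : ℂ)) := by fun_prop
    have := (this.tendsto 0).mono_left (nhdsWithin_le_nhds (s := Ioi 0))
    simpa [besselEnt_zero] using this
  have h := ((hE (-μ)).sub ((tendsto_ofReal_cpow_zero hμ).mul (hE μ))).const_mul
    (Real.pi / Complex.sin (Real.pi * μ))
  have h1 : Complex.Gamma (1 - μ) ≠ 0 := Complex.Gamma_ne_zero fun m hm =>
    hμ' (m + 1) (by push_cast; linear_combination -hm)
  have e : Real.pi / Complex.sin (Real.pi * μ) * ((Complex.Gamma (-μ + 1))⁻¹ -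
      0 * (Complex.Gamma (μ + 1))⁻¹) = Complex.Gamma μ := by
    rw [zero_mul, sub_zero, ← Complex.Gamma_mul_Gamma_one_sub, show -μ + 1 = 1 - μ by ring]
    field_simp
  rw [e] at h
  exact h

/-- A pair of functions on `(0, ∞)` that tends to zero at zero and satisfies a linear system with
integrable coefficients vanishes. -/
theorem eq_zero_of_linear_system {A C A' C' : ℝ → ℂ} {k s : ℝ} (hs : |s| < 1) (hk : 0 ≤ k)
    (hA : ∀ t, 0 < t → HasDerivAt A (A' t) t) (hC : ∀ t, 0 < t → HasDerivAt C (C' t) t)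
    (hA0 : Tendsto A (𝓝[>] 0) (𝓝 0)) (hC0 : Tendsto C (𝓝[>] 0) (𝓝 0))
    (hA' : ∀ t, 0 < t → ‖A' t‖ ≤ k * (‖A t‖ + t ^ s * ‖C t‖))
    (hC' : ∀ t, 0 < t → ‖C' t‖ ≤ k * (t ^ (-s) * ‖A t‖ + ‖C t‖)) {t : ℝ} (ht : 0 < t) :
    A t = 0 := by
  obtain ⟨hs1, hs2⟩ := abs_lt.1 hs
  set E : ℝ → ℝ := fun t => ‖A t‖ ^ 2 + ‖C t‖ ^ 2
  set W : ℝ → ℝ := fun t => t + t ^ (1 + s) / (1 + s) + t ^ (1 - s) / (1 - s)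
  have hW : ∀ t, 0 < t → HasDerivAt W (1 + t ^ s + t ^ (-s)) t := by
    intro t ht
    have h1 := (Real.hasDerivAt_rpow_const (p := 1 + s) (Or.inl ht.ne')).div_const (1 + s)
    have h2 := (Real.hasDerivAt_rpow_const (p := 1 - s) (Or.inl ht.ne')).div_const (1 - s)
    refine (((hasDerivAt_id t).add h1).add h2).congr_deriv ?_
    have a1 : 1 + s ≠ 0 := by linarith
    have a2 : 1 - s ≠ 0 := by linarith
    rw [mul_div_cancel_left₀ _ a1, mul_div_cancel_left₀ _ a2]
    simp
  set Φ : ℝ → ℝ := fun t => E t * Real.exp (-(2 * k * W t))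
  have hΦ : ∀ t, 0 < t → HasDerivAt Φ ((2 * inner ℝ (A t) (A' t) + 2 * inner ℝ (C t) (C' t)) *
      Real.exp (-(2 * k * W t)) + E t * (Real.exp (-(2 * k * W t)) *
      -(2 * k * (1 + t ^ s + t ^ (-s))))) t := fun t ht =>
    ((hA t ht).norm_sq.add (hC t ht).norm_sq).mul ((((hW t ht).const_mul (2 * k)).neg).exp)
  have hanti : AntitoneOn Φ (Ioi 0) := by
    refine antitoneOn_of_deriv_nonpos (convex_Ioi 0)
      (fun t ht => (hΦ t ht).continuousAt.continuousWithinAt) ?_ ?_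
    · rw [interior_Ioi]
      exact fun t ht => (hΦ t ht).differentiableAt.differentiableWithinAt
    · rw [interior_Ioi]
      intro t ht
      have ht' : 0 < t := ht
      rw [(hΦ t ht).deriv]
      have h1 : inner ℝ (A t) (A' t) ≤ ‖A t‖ * ‖A' t‖ := real_inner_le_norm _ _
      have h2 : inner ℝ (C t) (C' t) ≤ ‖C t‖ * ‖C' t‖ := real_inner_le_norm _ _
      have h3 := mul_le_mul_of_nonneg_left (hA' t ht) (norm_nonneg (A t))
      have h4 := mul_le_mul_of_nonneg_left (hC' t ht) (norm_nonneg (C t))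
      have hp : 0 < t ^ s := Real.rpow_pos_of_pos ht' _
      have hq : 0 < t ^ (-s) := Real.rpow_pos_of_pos ht' _
      have h5 : 2 * (‖A t‖ * ‖C t‖) ≤ E t := by
        simp only [E]; nlinarith [sq_nonneg (‖A t‖ - ‖C t‖)]
      have h0 : 0 ≤ E t := by simp only [E]; positivity
      have h6 : 2 * inner ℝ (A t) (A' t) + 2 * inner ℝ (C t) (C' t) ≤
          2 * k * (1 + t ^ s + t ^ (-s)) * E t := by
        have e : 2 * (‖A t‖ * (k * (‖A t‖ + t ^ s * ‖C t‖))) +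
            2 * (‖C t‖ * (k * (t ^ (-s) * ‖A t‖ + ‖C t‖))) =
            2 * k * E t + k * (t ^ s + t ^ (-s)) * (2 * (‖A t‖ * ‖C t‖)) := by
          simp only [E]; ring
        have h7 := mul_le_mul_of_nonneg_left h5 (show 0 ≤ k * (t ^ s + t ^ (-s)) by positivity)
        have h8 : 0 ≤ k * (t ^ s + t ^ (-s)) * E t := by positivity
        nlinarith
      have := mul_le_mul_of_nonneg_right h6 (Real.exp_pos (-(2 * k * W t))).le
      nlinarith
  have hΦ0 : Tendsto Φ (𝓝[>] 0) (𝓝 0) := by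
    have hE0 : Tendsto E (𝓝[>] 0) (𝓝 0) := by
      simpa using (hA0.norm.pow 2).add (hC0.norm.pow 2)
    refine squeeze_zero' ?_ ?_ hE0
    · exact Eventually.of_forall fun t => by simp only [Φ, E]; positivity
    · filter_upwards [self_mem_nhdsWithin] with t ht
      have ht : 0 < t := ht
      refine mul_le_of_le_one_right (by simp only [E]; positivity) (Real.exp_le_one_iff.2 ?_)
      have a1 : 0 < 1 + s := by linarith
      have a2 : 0 < 1 - s := by linarith
      have : 0 ≤ W t := by simp only [W]; positivity
      have := mul_nonneg (mul_nonneg zero_le_two hk) this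
      linarith
  have hle : Φ t ≤ 0 := by
    refine ge_of_tendsto hΦ0 ?_
    filter_upwards [Ioo_mem_nhdsGT ht] with u hu
    exact hanti hu.1 ht hu.2.le
  have hE : E t ≤ 0 := by
    by_contra h
    exact absurd hle (not_le.2 (mul_pos (not_le.1 h) (Real.exp_pos _)))
  have h1 : ‖A t‖ ^ 2 ≤ 0 := by
    have : 0 ≤ ‖C t‖ ^ 2 := by positivity
    simp only [E] at hE
    linarith
  have h2 : ‖A t‖ ^ 2 = 0 := le_antisymm h1 (by positivity)
  simpa using h2

theorem macdonald_eq_series_of_re_mem_Ioo {μ : ℂ} (hμ : ∀ n : ℤ, μ ≠ n) (h0 : 0 < μ.re)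
    (h2 : μ.re < 2) {t : ℝ} (ht : 0 < t) : macdonald μ t = macdonaldSeries μ t := by
  set D : ℂ → ℝ → ℂ := fun μ t => macdonald μ t - macdonaldSeries μ t
  have hD' : ∀ (μ : ℂ) (t : ℝ), 0 < t → HasDerivAt (D μ) (-D (μ - 1) t) t := fun μ t ht =>
    ((hasDerivAt_macdonald μ ht).sub (hasDerivAt_macdonaldSeries μ ht)).congr_deriv (by
      simp only [D]; ring)
  have hDr : ∀ (μ : ℂ) (t : ℝ), 0 < t → D (μ + 1) t = μ * D μ t + t * D (μ - 1) t :=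
    fun μ t ht => by
      simp only [D, macdonald_add_one μ ht, macdonaldSeries_add_one μ ht]; ring
  have hDn : ∀ (μ : ℂ) (t : ℝ), 0 < t → D (-μ) t = (t : ℂ) ^ (-μ) * D μ t := fun μ t ht => by
    simp only [D, macdonald_neg μ ht, macdonaldSeries_neg μ ht]; ring
  have hD0 : ∀ μ : ℂ, (∀ n : ℤ, μ ≠ n) → 0 < μ.re → Tendsto (D μ) (𝓝[>] 0) (𝓝 0) :=
    fun μ hμ' hμ => by
      simpa using (tendsto_macdonald_zero hμ).sub (tendsto_macdonaldSeries_zero hμ' hμ)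
  have h1 : 1 - μ ≠ 0 := fun h => hμ 1 (by push_cast; linear_combination -h)
  have hk : 0 < ‖1 - μ‖ := norm_pos_iff.2 h1
  have key : ∀ t : ℝ, 0 < t → D (1 - μ) t =
      (D (2 - μ) t - (t : ℂ) ^ (1 - μ) * D μ t) / (1 - μ) := by
    intro t ht
    have ht0 : (t : ℂ) ≠ 0 := by exact_mod_cast ht.ne'
    have e := hDr (1 - μ) t ht
    rw [show 1 - μ + 1 = 2 - μ by ring, show 1 - μ - 1 = -μ by ring, hDn μ t ht] at e
    rw [eq_div_iff h1, e, sub_eq_add_neg 1 μ, Complex.cpow_add _ _ ht0, Complex.cpow_one]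
    ring
  refine sub_eq_zero.1 (eq_zero_of_linear_system (A := D μ) (C := D (2 - μ)) (k := ‖1 - μ‖⁻¹)
    (s := μ.re - 1) (by rw [abs_lt]; constructor <;> linarith) (by positivity)
    (hD' μ) (hD' (2 - μ)) (hD0 μ hμ h0) (hD0 (2 - μ)
    (fun n hn => hμ (2 - n) (by push_cast; linear_combination -hn)) (by simp; linarith)) ?_ ?_ ht)
  · intro t ht
    have ht0 : (t : ℂ) ≠ 0 := by exact_mod_cast ht.ne'
    have e : D (μ - 1) t = (t : ℂ) ^ (μ - 1) * D (1 - μ) t := by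
      have := hDn (1 - μ) t ht
      rwa [neg_sub] at this
    have e2 : (t : ℂ) ^ (μ - 1) * (t : ℂ) ^ (1 - μ) = 1 := by
      rw [← Complex.cpow_add _ _ ht0]; simp
    have e3 : D (μ - 1) t = (1 - μ)⁻¹ * ((t : ℂ) ^ (μ - 1) * D (2 - μ) t - D μ t) := by
      rw [e, key t ht]
      linear_combination (-(D μ t) / (1 - μ)) * e2
    rw [norm_neg, e3, norm_mul, norm_inv]
    gcongr
    refine (norm_sub_le _ _).trans ?_
    rw [norm_mul, Complex.norm_cpow_eq_rpow_re_of_pos ht, add_comm]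
    simp
  · intro t ht
    rw [norm_neg, show 2 - μ - 1 = 1 - μ by ring, key t ht, div_eq_inv_mul, norm_mul, norm_inv]
    gcongr
    refine (norm_sub_le _ _).trans ?_
    rw [norm_mul, Complex.norm_cpow_eq_rpow_re_of_pos ht, add_comm]
    simp

theorem macdonald_eq_series {μ : ℂ} (hμ : ∀ n : ℤ, μ ≠ n) {t : ℝ} (ht : 0 < t) :
    macdonald μ t = macdonaldSeries μ t := by
  have down : ∀ μ : ℂ, (∀ t : ℝ, 0 < t → macdonald μ t = macdonaldSeries μ t) →
      ∀ t : ℝ, 0 < t → macdonald (μ - 1) t = macdonaldSeries (μ - 1) t := by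
    intro μ h t ht
    have e : macdonald μ =ᶠ[𝓝 t] macdonaldSeries μ := by
      filter_upwards [Ioi_mem_nhds ht] with s hs using h s hs
    have := ((hasDerivAt_macdonald μ ht).congr_of_eventuallyEq e.symm).unique
      (hasDerivAt_macdonaldSeries μ ht)
    exact neg_injective this
  have key : ∀ (n : ℕ) (μ : ℂ), (∀ n : ℤ, μ ≠ n) → 0 < μ.re → μ.re < 2 →
      ∀ t : ℝ, 0 < t → macdonald (μ - n) t = macdonaldSeries (μ - n) t := by
    intro n μ h h0 h2
    induction n with
    | zero => intro t ht; simpa using macdonald_eq_series_of_re_mem_Ioo h h0 h2 ht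
    | succ n ih =>
      intro t ht
      have := down _ ih t ht
      rwa [sub_sub, ← Nat.cast_add_one] at this
  have hneg : ∀ μ : ℂ, (∀ n : ℤ, μ ≠ n) → μ.re < 1 → ∀ t : ℝ, 0 < t →
      macdonald μ t = macdonaldSeries μ t := by
    intro μ hμ hre t ht
    obtain ⟨n, hn⟩ : ∃ n : ℕ, 0 < (μ + n).re ∧ (μ + n).re < 2 := by
      refine ⟨⌈1 - μ.re⌉.toNat, ?_⟩
      have h0 : 0 ≤ ⌈1 - μ.re⌉ := Int.ceil_nonneg (by linarith)
      have h1 := Int.le_ceil (1 - μ.re)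
      have h2 := Int.ceil_lt_add_one (1 - μ.re)
      have h3 : ((⌈1 - μ.re⌉.toNat : ℕ) : ℝ) = (⌈1 - μ.re⌉ : ℝ) := by
        exact_mod_cast congrArg (Int.cast (R := ℝ)) (Int.toNat_of_nonneg h0)
      simp only [Complex.add_re, Complex.natCast_re, h3]
      constructor <;> linarith
    have := key n (μ + n) (fun k hk => hμ (k - n) (by push_cast; linear_combination hk)) hn.1 hn.2
      t ht
    simpa using this
  rcases lt_or_ge μ.re 1 with h | h
  · exact hneg μ hμ h t ht
  · have h1 := hneg (-μ) (fun k hk => hμ (-k) (by push_cast; linear_combination -hk))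
      (by simp; linarith) t ht
    have h2 := macdonald_neg (-μ) ht
    have h3 := macdonaldSeries_neg (-μ) ht
    rw [neg_neg] at h2 h3
    rw [h2, h3, h1]

theorem exists_norm_macdonald_sq_le (μ : ℂ) :
    ∃ C, 0 ≤ C ∧ ∀ y : ℝ, 1 ≤ y →
      ‖macdonald μ (y ^ 2)‖ ≤ C * y ^ μ.re * Real.exp (-2 * y) := by
  refine ⟨Real.exp 2 * ∫ v in Ioi (0 : ℝ), Real.exp (-v) * Real.exp (-(1 / v)) * v ^ (μ.re - 1),
    mul_nonneg (Real.exp_pos _).le (setIntegral_nonneg measurableSet_Ioi fun v hv => ?_),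
    fun y hy => ?_⟩
  · have : 0 < v := hv
    positivity
  have hy0 : 0 < y := by linarith
  refine (norm_macdonald_le μ (y ^ 2)).trans ?_
  have h2 := integral_comp_mul_left_Ioi' (fun τ : ℝ =>
    Real.exp (-τ) * Real.exp (-(y ^ 2 / τ)) * τ ^ (μ.re - 1)) 0 hy0
  rw [mul_zero] at h2
  rw [← h2, smul_eq_mul, ← integral_const_mul, mul_assoc, mul_assoc, ← integral_mul_const,
    ← integral_const_mul]
  have hb : IntegrableOn (fun v : ℝ => Real.exp 2 * (Real.exp (-v) * Real.exp (-(1 / v)) *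
      v ^ (μ.re - 1) * (y ^ μ.re * Real.exp (-2 * y)))) (Ioi 0) :=
    ((integrableOn_exp_mul_rpow one_pos).mul_const _).const_mul _
  refine integral_mono_of_nonneg ?_ hb ?_
  · filter_upwards [ae_restrict_mem measurableSet_Ioi] with v hv
    have : 0 < v := hv
    simp only [Pi.zero_apply]
    positivity
  · filter_upwards [ae_restrict_mem measurableSet_Ioi] with v hv
    have hv : 0 < v := hv
    have e1 : y ^ 2 / (y * v) = y / v := by field_simp
    have e2 : y * y ^ (μ.re - 1) = y ^ μ.re := by
      rw [Real.rpow_sub_one hy0.ne']; field_simp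
    rw [e1, Real.mul_rpow hy0.le hv.le]
    have e3 : Real.exp (-(y * v)) * Real.exp (-(y / v)) ≤
        Real.exp 2 * (Real.exp (-v) * Real.exp (-(1 / v)) * Real.exp (-2 * y)) := by
      simp only [← Real.exp_add]
      refine Real.exp_le_exp.2 ?_
      have h3 : 2 ≤ v + 1 / v := by
        rw [← sub_nonneg, show v + 1 / v - 2 = (v - 1) ^ 2 / v by field_simp; ring]
        positivity
      have h4 : y / v = y * (1 / v) := by ring
      rw [h4]
      nlinarith [mul_nonneg (sub_nonneg.2 hy) (sub_nonneg.2 h3)]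
    calc y * (Real.exp (-(y * v)) * Real.exp (-(y / v)) * (y ^ (μ.re - 1) * v ^ (μ.re - 1)))
        = (Real.exp (-(y * v)) * Real.exp (-(y / v))) * (v ^ (μ.re - 1) *
          (y * y ^ (μ.re - 1))) := by ring
      _ ≤ (Real.exp 2 * (Real.exp (-v) * Real.exp (-(1 / v)) * Real.exp (-2 * y))) *
          (v ^ (μ.re - 1) * (y * y ^ (μ.re - 1))) := by gcongr
      _ = _ := by rw [e2]; ring

/-- The combination of Bessel functions that is proportional to `z^μ H_μ^{(1)}(2z)`. -/
noncomputable def hankelOne (μ z : ℂ) : ℂ :=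
  besselEnt (-μ) (z ^ 2) - Complex.exp (-(Complex.I * Real.pi * μ)) * z ^ (2 * μ) *
    besselEnt μ (z ^ 2)

theorem hankelOne_mul_I {μ : ℂ} (hμ : ∀ n : ℤ, μ ≠ n) {y : ℝ} (hy : 0 < y) :
    hankelOne μ (y * Complex.I) =
      Complex.sin (Real.pi * μ) / Real.pi * macdonald μ (y ^ 2) := by
  have hs := sin_pi_mul_ne_zero hμ
  have hp : (Real.pi : ℂ) ≠ 0 := by exact_mod_cast Real.pi_ne_zero
  have hy0 : (y : ℂ) ≠ 0 := by exact_mod_cast hy.ne'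
  have hyI : (y : ℂ) * Complex.I ≠ 0 := mul_ne_zero hy0 Complex.I_ne_zero
  have e1 : ((y : ℂ) * Complex.I) ^ 2 = -((y ^ 2 : ℝ) : ℂ) := by
    rw [mul_pow, Complex.I_sq]; push_cast; ring
  have e2 : Complex.exp (-(Complex.I * Real.pi * μ)) * ((y : ℂ) * Complex.I) ^ (2 * μ) =
      ((y ^ 2 : ℝ) : ℂ) ^ μ := by
    rw [Complex.cpow_def_of_ne_zero hyI, Complex.cpow_def_of_ne_zero (by exact_mod_cast
      (pow_pos hy 2).ne'), ← Complex.exp_add, Complex.log_ofReal_mul hy Complex.I_ne_zero,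
      Complex.log_I, ← Complex.ofReal_log (pow_pos hy 2).le, Real.log_pow]
    congr 1
    push_cast
    ring
  rw [hankelOne, e1, e2, macdonald_eq_series hμ (pow_pos hy 2), macdonaldSeries, ← mul_assoc,
    div_mul_div_cancel₀ hp, div_self hs, one_mul]

/-- `hankelOne` with the exponential factor removed, damped at zero and at infinity. -/
noncomputable def hankelDamped (μ : ℂ) (k : ℕ) (z : ℂ) : ℂ :=
  (z ^ (k - μ) * besselEnt (-μ) (z ^ 2) -
    Complex.exp (-(Complex.I * Real.pi * μ)) * (z ^ (k + μ) * besselEnt μ (z ^ 2))) *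
    Complex.exp (-2 * Complex.I * z) / (z + 1) ^ (k + 3)

theorem hankelDamped_eq (μ : ℂ) (k : ℕ) {z : ℂ} (hz : z ≠ 0) :
    hankelDamped μ k z =
      z ^ (k - μ) * hankelOne μ z * Complex.exp (-2 * Complex.I * z) / (z + 1) ^ (k + 3) := by
  have : z ^ (k - μ) * z ^ (2 * μ) = z ^ (k + μ) := by
    rw [← Complex.cpow_add _ _ hz]; congr 1; ring
  rw [hankelDamped, hankelOne, ← this]
  ring

theorem add_one_ne_zero_of_re_nonneg {z : ℂ} (hz : 0 ≤ z.re) : z + 1 ≠ 0 := by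
  intro h
  have := congrArg Complex.re h
  simp at this
  linarith

theorem continuousAt_hankelDamped {μ : ℂ} {k : ℕ} (hk : |μ.re| < k) {z : ℂ} (hz : 0 ≤ z.re) :
    ContinuousAt (hankelDamped μ k) z := by
  obtain ⟨h1, h2⟩ := abs_lt.1 hk
  have c1 : ContinuousAt (fun z : ℂ => z ^ (k - μ)) z :=
    Complex.continuousAt_cpow_const_of_re_pos (Or.inl hz) (by simp; linarith)
  have c2 : ContinuousAt (fun z : ℂ => z ^ (k + μ)) z :=
    Complex.continuousAt_cpow_const_of_re_pos (Or.inl hz) (by simp; linarith)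
  unfold hankelDamped
  refine ContinuousAt.div ?_ (by fun_prop)
    (pow_ne_zero _ (add_one_ne_zero_of_re_nonneg hz))
  fun_prop

theorem norm_exp_neg_two_I_mul (z : ℂ) :
    ‖Complex.exp (-2 * Complex.I * z)‖ = Real.exp (2 * z.im) := by
  rw [Complex.norm_exp]; simp

theorem norm_cpow_le_of_exp (z w : ℂ) :
    ‖z ^ w‖ ≤ ‖z‖ ^ w.re * Real.exp (Real.pi * |w.im|) := by
  refine (Complex.norm_cpow_le z w).trans ?_
  rw [div_eq_mul_inv, ← Real.exp_neg]
  have h1 : |z.arg| * |w.im| ≤ Real.pi * |w.im| := by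
    gcongr; exact Complex.abs_arg_le_pi z
  rw [← abs_mul] at h1
  gcongr
  exact (neg_le_abs _).trans h1

theorem le_norm_cpow {z : ℂ} (hz : z ≠ 0) (w : ℂ) :
    ‖z‖ ^ w.re ≤ ‖z ^ w‖ * Real.exp (Real.pi * |w.im|) := by
  rw [Complex.norm_cpow_of_ne_zero hz, div_mul_eq_mul_div, le_div_iff₀ (Real.exp_pos _)]
  have h1 : |z.arg| * |w.im| ≤ Real.pi * |w.im| := by
    gcongr; exact Complex.abs_arg_le_pi z
  rw [← abs_mul] at h1
  exact mul_le_mul_of_nonneg_left (Real.exp_le_exp.2 ((le_abs_self _).trans h1)) (by positivity)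

theorem norm_le_norm_add_one {z : ℂ} (hz : 0 ≤ z.re) : ‖z‖ ≤ ‖z + 1‖ := by
  rw [← sq_le_sq₀ (norm_nonneg _) (norm_nonneg _), Complex.sq_norm, Complex.sq_norm,
    Complex.normSq_apply, Complex.normSq_apply]
  simp
  nlinarith

theorem exists_norm_hankelDamped_le (μ : ℂ) (k : ℕ) :
    ∃ C, 0 ≤ C ∧ ∀ z : ℂ, 0 ≤ z.re → 1 ≤ ‖z‖ →
      ‖hankelDamped μ k z‖ ≤ C * Real.exp (2 * |z.im| + 2 * z.im) := by
  obtain ⟨C1, hC1, h1⟩ := besselGrowth (-μ)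
  obtain ⟨C2, hC2, h2⟩ := besselGrowth μ
  set M := Real.exp (Real.pi * |μ.im|)
  set q := ‖Complex.exp (-(Complex.I * Real.pi * μ))‖
  refine ⟨M * C1 + q * (M * C2), by positivity, fun z hz hz1 => ?_⟩
  have hpos : 0 < ‖z‖ := by linarith
  have hpow : ‖z‖ ^ ((k : ℝ) + 2) ≤ ‖z + 1‖ ^ (k + 3) := by
    calc ‖z‖ ^ ((k : ℝ) + 2) = ‖z‖ ^ (k + 2) := by rw [← Real.rpow_natCast]; push_cast; rfl
      _ ≤ ‖z‖ ^ (k + 3) := pow_le_pow_right₀ hz1 (by omega)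
      _ ≤ _ := by gcongr; exact norm_le_norm_add_one hz
  have a1 : ‖z ^ (k - μ) * besselEnt (-μ) (z ^ 2)‖ ≤
      M * C1 * ‖z‖ ^ ((k : ℝ) + 2) * Real.exp (2 * |z.im|) := by
    rw [norm_mul]
    refine (mul_le_mul (norm_cpow_le_of_exp z (k - μ)) (h1 z hz1) (norm_nonneg _)
      (by positivity)).trans (le_of_eq ?_)
    have : ‖z‖ ^ ((k : ℝ) + 2) = ‖z‖ ^ (k - μ).re * ‖z‖ ^ (2 - (-μ).re) := by
      rw [← Real.rpow_add hpos]; congr 1; simp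
    rw [this]
    simp only [Complex.sub_im, Complex.natCast_im, zero_sub, abs_neg, M]
    ring
  have a2 : ‖z ^ (k + μ) * besselEnt μ (z ^ 2)‖ ≤
      M * C2 * ‖z‖ ^ ((k : ℝ) + 2) * Real.exp (2 * |z.im|) := by
    rw [norm_mul]
    refine (mul_le_mul (norm_cpow_le_of_exp z (k + μ)) (h2 z hz1) (norm_nonneg _)
      (by positivity)).trans (le_of_eq ?_)
    have : ‖z‖ ^ ((k : ℝ) + 2) = ‖z‖ ^ (k + μ).re * ‖z‖ ^ (2 - μ.re) := by
      rw [← Real.rpow_add hpos]; congr 1; simp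
    rw [this]
    simp only [Complex.add_im, Complex.natCast_im, zero_add, M]
    ring
  have hz0 : 0 < ‖z + 1‖ := norm_pos_iff.2 (add_one_ne_zero_of_re_nonneg hz)
  rw [hankelDamped, norm_div, norm_mul, norm_pow, norm_exp_neg_two_I_mul,
    div_le_iff₀ (pow_pos hz0 _), Real.exp_add]
  calc _ ≤ (M * C1 * ‖z‖ ^ ((k : ℝ) + 2) * Real.exp (2 * |z.im|) +
        q * (M * C2 * ‖z‖ ^ ((k : ℝ) + 2) * Real.exp (2 * |z.im|))) * Real.exp (2 * z.im) := by
        gcongr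
        refine (norm_sub_le _ _).trans (add_le_add a1 ?_)
        rw [norm_mul]
        gcongr
    _ = (M * C1 + q * (M * C2)) * (Real.exp (2 * |z.im|) * Real.exp (2 * z.im)) *
        ‖z‖ ^ ((k : ℝ) + 2) := by ring
    _ ≤ _ := by gcongr

theorem exists_norm_hankelDamped_mul_I_le {μ : ℂ} (hμ : ∀ n : ℤ, μ ≠ n) (k : ℕ) :
    ∃ C, 0 ≤ C ∧ ∀ y : ℝ, 1 ≤ y → ‖hankelDamped μ k (y * Complex.I)‖ ≤ C := by
  obtain ⟨C, hC, h⟩ := exists_norm_macdonald_sq_le μ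
  set M := Real.exp (Real.pi * |μ.im|)
  set q := ‖Complex.sin (Real.pi * μ) / Real.pi‖
  refine ⟨M * (q * C), by positivity, fun y hy => ?_⟩
  have hy0 : 0 < y := by linarith
  have hyI : (y : ℂ) * Complex.I ≠ 0 :=
    mul_ne_zero (by exact_mod_cast hy0.ne') Complex.I_ne_zero
  have hn : ‖(y : ℂ) * Complex.I‖ = y := by simp [abs_of_pos hy0]
  have hre : 0 ≤ ((y : ℂ) * Complex.I).re := by simp
  have hpow : y ^ (k : ℝ) ≤ ‖(y : ℂ) * Complex.I + 1‖ ^ (k + 3) := by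
    calc y ^ (k : ℝ) = y ^ k := Real.rpow_natCast _ _
      _ ≤ y ^ (k + 3) := pow_le_pow_right₀ hy (by omega)
      _ ≤ _ := by
        gcongr
        calc y = ‖(y : ℂ) * Complex.I‖ := hn.symm
          _ ≤ _ := norm_le_norm_add_one hre
  have hz0 : 0 < ‖(y : ℂ) * Complex.I + 1‖ :=
    norm_pos_iff.2 (add_one_ne_zero_of_re_nonneg hre)
  rw [hankelDamped_eq μ k hyI, hankelOne_mul_I hμ hy0, norm_div, norm_mul, norm_mul, norm_mul,
    norm_pow, norm_exp_neg_two_I_mul, div_le_iff₀ (pow_pos hz0 _)]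
  have e1 := norm_cpow_le_of_exp ((y : ℂ) * Complex.I) (k - μ)
  rw [hn] at e1
  simp only [Complex.sub_im, Complex.natCast_im, zero_sub, abs_neg] at e1
  calc _ ≤ (y ^ ((k : ℂ) - μ).re * M) * (q * (C * y ^ μ.re * Real.exp (-2 * y))) *
        Real.exp (2 * ((y : ℂ) * Complex.I).im) := by
        gcongr
        exact h y hy
    _ = M * (q * C) * (y ^ ((k : ℂ) - μ).re * y ^ μ.re) *
        (Real.exp (-2 * y) * Real.exp (2 * ((y : ℂ) * Complex.I).im)) := by ring
    _ = M * (q * C) * y ^ (k : ℝ) := by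
        rw [← Real.rpow_add hy0, ← Real.exp_add]; simp
    _ ≤ _ := by gcongr

theorem exists_norm_hankelDamped_le_const {μ : ℂ} (hμ : ∀ n : ℤ, μ ≠ n) {k : ℕ}
    (hk : |μ.re| < k) : ∃ C, ∀ z : ℂ, 0 ≤ z.re → ‖hankelDamped μ k z‖ ≤ C := by
  obtain ⟨C1, hC1, h1⟩ := exists_norm_hankelDamped_le μ k
  obtain ⟨C2, hC2, h2⟩ := exists_norm_hankelDamped_mul_I_le hμ k
  obtain ⟨C3, h3⟩ : ∃ C, ∀ z ∈ Metric.closedBall (0 : ℂ) 1 ∩ {z | 0 ≤ z.re},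
      ‖hankelDamped μ k z‖ ≤ C := by
    refine IsCompact.exists_bound_of_continuousOn ((isCompact_closedBall 0 1).inter_right
      (isClosed_le continuous_const Complex.continuous_re)) ?_
    exact fun z hz => (continuousAt_hankelDamped hk hz.2).continuousWithinAt
  have h3' : ∀ z : ℂ, 0 ≤ z.re → ‖z‖ ≤ 1 → ‖hankelDamped μ k z‖ ≤ C3 :=
    fun z hz hz1 => h3 z ⟨by simpa using hz1, hz⟩
  have hC3 : 0 ≤ C3 := (norm_nonneg _).trans (h3' 0 le_rfl (by simp))
  have hneg : ∀ z : ℂ, 0 ≤ z.re → z.im ≤ 0 → ‖hankelDamped μ k z‖ ≤ C1 + C2 + C3 := by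
    intro z hz hz'
    rcases le_total ‖z‖ 1 with h | h
    · linarith [h3' z hz h]
    · have := h1 z hz h
      rw [abs_of_nonpos hz'] at this
      simp at this
      linarith
  refine ⟨C1 + C2 + C3, fun z hz => ?_⟩
  rcases le_total z.im 0 with hi | hi
  · exact hneg z hz hi
  refine PhragmenLindelof.quadrant_I ⟨?_, ?_⟩ ⟨1, one_lt_two, 4, ?_⟩ ?_ ?_ hz hi
  · intro w hw
    rw [Complex.mem_reProdIm] at hw
    have hs : w ∈ Complex.slitPlane := Or.inl hw.1
    refine DifferentiableAt.differentiableWithinAt ?_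
    unfold hankelDamped
    refine DifferentiableAt.div ?_ (by fun_prop)
      (pow_ne_zero _ (add_one_ne_zero_of_re_nonneg (le_of_lt hw.1)))
    have d1 : ∀ a : ℂ, DifferentiableAt ℂ (fun z : ℂ => z ^ a) w := fun a =>
      differentiableAt_id.cpow_const hs
    have d2 : ∀ a : ℂ, DifferentiableAt ℂ (fun z : ℂ => besselEnt a (z ^ 2)) w := fun a =>
      (differentiable_besselEnt a).differentiableAt.comp w (by fun_prop)
    exact ((((d1 _).mul (d2 _)).sub (((d1 _).mul (d2 _)).const_mul _))).mul (by fun_prop)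
  · intro w hw
    rw [Complex.closure_reProdIm, closure_Ioi, Complex.mem_reProdIm] at hw
    exact (continuousAt_hankelDamped hk hw.1).continuousWithinAt
  · refine Asymptotics.IsBigO.of_bound C1 ?_
    have : ∀ᶠ w : ℂ in Bornology.cobounded ℂ ⊓ 𝓟 (Ioi 0 ×ℂ Ioi 0), 1 ≤ ‖w‖ :=
      (tendsto_norm_cobounded_atTop.eventually_ge_atTop 1).filter_mono inf_le_left
    filter_upwards [this, mem_inf_of_right (mem_principal_self _)] with w hw hw'
    rw [Complex.mem_reProdIm] at hw'
    refine (h1 w (le_of_lt hw'.1) hw).trans ?_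
    rw [Real.norm_of_nonneg (Real.exp_pos _).le, Real.rpow_one]
    gcongr
    have := Complex.abs_im_le_norm w
    linarith [le_abs_self w.im]
  · intro x hx
    exact hneg x (by simpa using hx) (by simp)
  · intro y hy
    rcases le_total y 1 with h | h
    · linarith [h3' (y * Complex.I) (by simp) (by simpa [abs_of_nonneg hy] using h)]
    · linarith [h2 y h]

theorem exists_norm_hankelOne_le {μ : ℂ} (hμ : ∀ n : ℤ, μ ≠ n) :
    ∃ C, 0 ≤ C ∧ ∀ z : ℂ, 0 ≤ z.re → 1 ≤ ‖z‖ →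
      ‖hankelOne μ z‖ ≤ C * ‖z‖ ^ (μ.re + 3) * Real.exp (-2 * z.im) := by
  obtain ⟨k, hk⟩ := exists_nat_gt |μ.re|
  obtain ⟨C, h⟩ := exists_norm_hankelDamped_le_const hμ hk
  have hC : 0 ≤ C := (norm_nonneg _).trans (h 0 le_rfl)
  set M := Real.exp (Real.pi * |μ.im|)
  refine ⟨C * M * 2 ^ (k + 3), by positivity, fun z hz hz1 => ?_⟩
  have hpos : 0 < ‖z‖ := by linarith
  have hz0 : z ≠ 0 := norm_pos_iff.1 hpos
  have hz1' : 0 < ‖z + 1‖ := norm_pos_iff.2 (add_one_ne_zero_of_re_nonneg hz)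
  have h1 := h z hz
  rw [hankelDamped_eq μ k hz0, norm_div, norm_mul, norm_mul, norm_pow, norm_exp_neg_two_I_mul,
    div_le_iff₀ (pow_pos hz1' _)] at h1
  have h2 := le_norm_cpow hz0 (k - μ)
  simp only [Complex.sub_im, Complex.natCast_im, zero_sub, abs_neg] at h2
  have h3 : ‖z + 1‖ ^ (k + 3) ≤ (2 * ‖z‖) ^ (k + 3) := by
    gcongr
    refine (norm_add_le _ _).trans ?_
    rw [norm_one]; linarith
  have e : ‖z‖ ^ (k + 3) = ‖z‖ ^ ((k : ℂ) - μ).re * ‖z‖ ^ (μ.re + 3) := by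
    rw [← Real.rpow_add hpos, ← Real.rpow_natCast]; congr 1; simp; ring
  have hp : 0 < ‖z‖ ^ ((k : ℂ) - μ).re * Real.exp (2 * z.im) :=
    mul_pos (Real.rpow_pos_of_pos hpos _) (Real.exp_pos _)
  refine le_of_mul_le_mul_left ?_ hp
  calc ‖z‖ ^ ((k : ℂ) - μ).re * Real.exp (2 * z.im) * ‖hankelOne μ z‖
      ≤ (‖z ^ ((k : ℂ) - μ)‖ * M) * Real.exp (2 * z.im) * ‖hankelOne μ z‖ := by gcongr
    _ = M * (‖z ^ ((k : ℂ) - μ)‖ * ‖hankelOne μ z‖ * Real.exp (2 * z.im)) := by ring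
    _ ≤ M * (C * (2 * ‖z‖) ^ (k + 3)) := by
        refine mul_le_mul_of_nonneg_left (h1.trans ?_) (Real.exp_pos _).le
        gcongr
    _ = C * M * 2 ^ (k + 3) * (‖z‖ ^ ((k : ℂ) - μ).re * ‖z‖ ^ (μ.re + 3)) *
        (Real.exp (2 * z.im) * Real.exp (-2 * z.im)) := by
        rw [mul_pow, e, ← Real.exp_add]
        simp
        ring
    _ = _ := by ring

/-! ### Wirtinger derivatives -/

/-- The real-linear map `h ↦ b * conj h`, as a function of `b`. -/
noncomputable def mulConjL : ℂ →L[ℝ] ℂ →L[ℝ] ℂ :=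
  ((ContinuousLinearMap.compL ℝ ℂ ℂ ℂ).flip (Complex.conjCLE : ℂ →L[ℝ] ℂ)).comp
    (ContinuousLinearMap.mul ℝ ℂ)

theorem mulConjL_apply (b h : ℂ) : mulConjL b h = b * conj h := by
  simp [mulConjL]

theorem norm_mulConjL_le : ‖mulConjL‖ ≤ 1 := by
  refine ContinuousLinearMap.opNorm_le_bound _ zero_le_one fun b => ?_
  refine ContinuousLinearMap.opNorm_le_bound _ (by positivity) fun h => ?_
  rw [mulConjL_apply, norm_mul, Complex.norm_conj, one_mul]

/-- `f` has Wirtinger derivatives `∂f = a` and `∂̄f = b` at `x`. -/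
def HasWirtingerAt (f : ℂ → ℂ) (a b x : ℂ) : Prop :=
  HasFDerivAt f (ContinuousLinearMap.mul ℝ ℂ a + mulConjL b) x

theorem _root_.HasDerivAt.hasWirtingerAt {f : ℂ → ℂ} {a x : ℂ} (h : HasDerivAt f a x) :
    HasWirtingerAt f a 0 x := by
  refine (h.hasFDerivAt.restrictScalars ℝ).congr_fderiv ?_
  ext h
  simp [mul_comm]

theorem _root_.HasDerivAt.hasWirtingerAt_conj {f : ℂ → ℂ} {b x : ℂ}
    (h : HasDerivAt f b (conj x)) : HasWirtingerAt (fun x => f (conj x)) 0 b x := by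
  have h1 : HasFDerivAt (fun x : ℂ => conj x) (Complex.conjCLE : ℂ →L[ℝ] ℂ) x :=
    Complex.conjCLE.hasFDerivAt
  refine ((h.hasFDerivAt.restrictScalars ℝ).comp x h1).congr_fderiv ?_
  ext h
  simp [mulConjL_apply, mul_comm]

namespace HasWirtingerAt

variable {f g : ℂ → ℂ} {a b a' b' x : ℂ}

theorem congr_values (h : HasWirtingerAt f a b x) (ha : a = a') (hb : b = b') :
    HasWirtingerAt f a' b' x := ha ▸ hb ▸ h

theorem mul (hf : HasWirtingerAt f a b x) (hg : HasWirtingerAt g a' b' x) :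
    HasWirtingerAt (fun x => f x * g x) (a * g x + f x * a') (b * g x + f x * b') x := by
  refine (HasFDerivAt.mul hf hg).congr_fderiv ?_
  ext h
  simp [mulConjL_apply]
  ring

theorem sub (hf : HasWirtingerAt f a b x) (hg : HasWirtingerAt g a' b' x) :
    HasWirtingerAt (fun x => f x - g x) (a - a') (b - b') x := by
  refine (HasFDerivAt.sub hf hg).congr_fderiv ?_
  ext h
  simp [mulConjL_apply]
  ring

theorem const_mul (c : ℂ) (hf : HasWirtingerAt f a b x) :
    HasWirtingerAt (fun x => c * f x) (c * a) (c * b) x := by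
  refine (HasFDerivAt.const_mul hf c).congr_fderiv ?_
  ext h
  simp [mulConjL_apply]
  ring

theorem comp_mul_left (c : ℂ) (hf : HasWirtingerAt f a b (c * x)) :
    HasWirtingerAt (fun x => f (c * x)) (c * a) (conj c * b) x := by
  have h1 : HasFDerivAt (fun x : ℂ => c * x) (ContinuousLinearMap.mul ℝ ℂ c) x :=
    (ContinuousLinearMap.mul ℝ ℂ c).hasFDerivAt
  refine (HasFDerivAt.comp x hf h1).congr_fderiv ?_
  ext h
  simp [mulConjL_apply]
  ring

theorem congr_of_eventuallyEq (hf : HasWirtingerAt f a b x) (h : g =ᶠ[𝓝 x] f) :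
    HasWirtingerAt g a b x := HasFDerivAt.congr_of_eventuallyEq hf h

end HasWirtingerAt

/-- The derivative `∂`. -/
noncomputable def dz (f : ℂ → ℂ) (x : ℂ) : ℂ :=
  (fderiv ℝ f x 1 - Complex.I * fderiv ℝ f x Complex.I) / 2

/-- The derivative `∂̄`. -/
noncomputable def dzbar (f : ℂ → ℂ) (x : ℂ) : ℂ :=
  (fderiv ℝ f x 1 + Complex.I * fderiv ℝ f x Complex.I) / 2

theorem _root_.DifferentiableAt.hasWirtingerAt {f : ℂ → ℂ} {x : ℂ} (h : DifferentiableAt ℝ f x) :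
    HasWirtingerAt f (dz f x) (dzbar f x) x := by
  refine h.hasFDerivAt.congr_fderiv ?_
  ext v
  have e : fderiv ℝ f x v = v.re * fderiv ℝ f x 1 + v.im * fderiv ℝ f x Complex.I := by
    have hv : v = v.re • (1 : ℂ) + v.im • Complex.I := by simp
    conv_lhs => rw [hv, map_add, map_smul, map_smul]
    simp
  have e1 : (v.re : ℂ) = (v + conj v) / 2 := by rw [Complex.add_conj]; push_cast; ring
  have e2 : (v.im : ℂ) = -Complex.I * (v - conj v) / 2 := by
    rw [Complex.sub_conj]; push_cast; linear_combination (v.im : ℂ) * Complex.I_sq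
  rw [e, e1, e2]
  simp only [add_apply, ContinuousLinearMap.mul_apply', mulConjL_apply, dz, dzbar]
  ring

/-- The sum of `N j` over all the `2 ^ n` indices `j` that come from `i` by applying `d₁` or `d₂`
altogether `n` times. -/
def wordSum {ι : Type*} (d₁ d₂ : ι → ι) (N : ι → ℝ) : ℕ → ι → ℝ
  | 0, i => N i
  | n + 1, i => wordSum d₁ d₂ N n (d₁ i) + wordSum d₁ d₂ N n (d₂ i)

section Family

variable {ι : Type*} {F : ι → ℂ → ℂ} {d₁ d₂ : ι → ι} {U : Set ℂ}

theorem contDiffOn_of_hasWirtingerAt_family (hU : IsOpen U)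
    (h : ∀ i, ∀ u ∈ U, HasWirtingerAt (F i) (F (d₁ i) u) (F (d₂ i) u) u) (n : ℕ) (i : ι) :
    ContDiffOn ℝ n (F i) U := by
  induction n generalizing i with
  | zero =>
    rw [Nat.cast_zero, contDiffOn_zero]
    exact fun u hu => (HasFDerivAt.continuousAt (h i u hu)).continuousWithinAt
  | succ n ih =>
    rw [Nat.cast_succ, contDiffOn_succ_iff_fderiv_of_isOpen hU]
    refine ⟨fun u hu => (HasFDerivAt.differentiableAt (h i u hu)).differentiableWithinAt,
      by simp, ?_⟩
    refine ContDiffOn.congr (f := fun u => ContinuousLinearMap.mul ℝ ℂ (F (d₁ i) u) +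
      mulConjL (F (d₂ i) u)) ?_ fun u hu => HasFDerivAt.fderiv (h i u hu)
    exact ((ContinuousLinearMap.contDiff _).comp_contDiffOn (ih _)).add
      ((ContinuousLinearMap.contDiff _).comp_contDiffOn (ih _))

theorem norm_iteratedFDeriv_le_wordSum (hU : IsOpen U)
    (h : ∀ i, ∀ u ∈ U, HasWirtingerAt (F i) (F (d₁ i) u) (F (d₂ i) u) u) (n : ℕ) (i : ι)
    {u : ℂ} (hu : u ∈ U) :
    ‖iteratedFDeriv ℝ n (F i) u‖ ≤ wordSum d₁ d₂ (fun j => ‖F j u‖) n i := by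
  induction n generalizing i with
  | zero => simp [wordSum]
  | succ n ih =>
    have hc : ∀ j, ContDiffAt ℝ n (F j) u := fun j =>
      (contDiffOn_of_hasWirtingerAt_family hU h n j).contDiffAt (hU.mem_nhds hu)
    rw [← norm_iteratedFDeriv_fderiv]
    have e : fderiv ℝ (F i) =ᶠ[𝓝 u] (ContinuousLinearMap.mul ℝ ℂ ∘ F (d₁ i)) +
        (mulConjL ∘ F (d₂ i)) := by
      filter_upwards [hU.mem_nhds hu] with v hv
      exact HasFDerivAt.fderiv (h i v hv)
    rw [(e.iteratedFDeriv ℝ n).eq_of_nhds, iteratedFDeriv_add_apply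
      (ContDiffAt.continuousLinearMap_comp _ (hc _)) (ContDiffAt.continuousLinearMap_comp _ (hc _))]
    refine (norm_add_le _ _).trans (add_le_add ?_ ?_)
    · refine ((ContinuousLinearMap.mul ℝ ℂ).norm_iteratedFDeriv_comp_left (hc _) le_rfl).trans ?_
      refine (mul_le_of_le_one_left (norm_nonneg _) ?_).trans (ih _)
      exact ContinuousLinearMap.opNorm_mul_le ℝ ℂ
    · refine (mulConjL.norm_iteratedFDeriv_comp_left (hc _) le_rfl).trans ?_
      exact (mul_le_of_le_one_left (norm_nonneg _) norm_mulConjL_le).trans (ih _)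

end Family

/-! ### The kernel and its antiderivatives -/

/-- The function `|x|^s (x/|x|)^k` on the plane. -/
noncomputable def polarPow (s : ℂ) (k : ℤ) (x : ℂ) : ℂ :=
  ((‖x‖ : ℝ) : ℂ) ^ s * (x / (‖x‖ : ℝ)) ^ k

theorem norm_polarPow (s : ℂ) (k : ℤ) {x : ℂ} (hx : x ≠ 0) : ‖polarPow s k x‖ = ‖x‖ ^ s.re := by
  have h : 0 < ‖x‖ := norm_pos_iff.2 hx
  rw [polarPow, norm_mul, norm_zpow, norm_div, Complex.norm_cpow_eq_rpow_re_of_pos h]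
  simp [h.ne']

theorem polarPow_mul (s : ℂ) (k : ℤ) (x y : ℂ) :
    polarPow s k (x * y) = polarPow s k x * polarPow s k y := by
  simp only [polarPow, norm_mul, Complex.ofReal_mul]
  rw [Complex.mul_cpow_ofReal_nonneg (norm_nonneg _) (norm_nonneg _), mul_div_mul_comm, mul_zpow]
  ring

theorem polarPow_add (s s' : ℂ) (k k' : ℤ) {x : ℂ} (hx : x ≠ 0) :
    polarPow (s + s') (k + k') x = polarPow s k x * polarPow s' k' x := by
  have h : ((‖x‖ : ℝ) : ℂ) ≠ 0 := by simpa using hx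
  simp only [polarPow]
  rw [Complex.cpow_add _ _ h, zpow_add₀ (div_ne_zero hx h)]
  ring

theorem polarPow_zero_zero (x : ℂ) : polarPow 0 0 x = 1 := by simp [polarPow]

theorem polarPow_ne_zero (s : ℂ) (k : ℤ) {x : ℂ} (hx : x ≠ 0) : polarPow s k x ≠ 0 := by
  have h : ((‖x‖ : ℝ) : ℂ) ≠ 0 := by simpa using hx
  exact mul_ne_zero (by simp [Complex.cpow_eq_zero_iff, hx]) (zpow_ne_zero _ (div_ne_zero hx h))

theorem polarPow_neg (s : ℂ) (k : ℤ) {x : ℂ} (hx : x ≠ 0) :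
    polarPow (-s) (-k) x = (polarPow s k x)⁻¹ := by
  refine eq_inv_of_mul_eq_one_left ?_
  rw [← polarPow_add _ _ _ _ hx]
  simp [polarPow_zero_zero]

theorem measurable_polarPow (s : ℂ) (k : ℤ) : Measurable (polarPow s k) := by
  unfold polarPow
  have h1 : Measurable fun x : ℂ => ((‖x‖ : ℝ) : ℂ) ^ s := by fun_prop
  refine h1.mul ?_
  have h2 : Measurable fun x : ℂ => x / (‖x‖ : ℝ) := by fun_prop
  rcases k with n | n
  · simpa using h2.pow_const n
  · simp only [zpow_negSucc]
    exact (h2.pow_const (n + 1)).inv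

/-- For `x = ζ²` with `ζ` off the cut, `|x|^{2ν} (x/|x|)^{2p} x^i x̄^j` is a product of a power of
`ζ` and a power of its conjugate. -/
theorem polarPow_sq_eq (ν : ℂ) (p i j : ℤ) {ζ : ℂ} (hζ : ζ ∈ Complex.slitPlane) :
    polarPow (2 * ν) (2 * p) (ζ ^ 2) * (ζ ^ 2) ^ i * conj (ζ ^ 2) ^ j =
      ζ ^ (2 * (ν + p + i)) * (conj ζ) ^ (2 * (ν - p + j)) := by
  have h0 : ζ ≠ 0 := Complex.slitPlane_ne_zero hζ
  have hc : conj ζ ≠ 0 := (map_ne_zero _).2 h0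
  have harg : ζ.arg ≠ Real.pi := (Complex.mem_slitPlane_iff_arg.1 hζ).1
  have hnn : conj ζ * ζ = ((‖ζ‖ : ℝ) : ℂ) ^ 2 := Complex.conj_mul' ζ
  have hnorm : ((‖ζ ^ 2‖ : ℝ) : ℂ) = conj ζ * ζ := by rw [hnn, norm_pow]; push_cast; rfl
  have h1 : ζ ^ (2 * ν) * (conj ζ) ^ (2 * ν) = ((‖ζ ^ 2‖ : ℝ) : ℂ) ^ (2 * ν) := by
    have hne : ((‖ζ ^ 2‖ : ℝ) : ℂ) ≠ 0 := by simpa using h0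
    rw [Complex.cpow_def_of_ne_zero h0, Complex.cpow_def_of_ne_zero hc,
      Complex.cpow_def_of_ne_zero hne, ← Complex.exp_add, Complex.log_conj _ harg]
    congr 1
    rw [← add_mul, Complex.add_conj, Complex.log_re, ← Complex.ofReal_log (norm_nonneg _),
      norm_pow, Real.log_pow]
    push_cast
    ring
  have e1 : ζ ^ (2 * (ν + p + i)) = ζ ^ (2 * ν) * (ζ ^ 2) ^ (p + i) := by
    rw [show 2 * (ν + p + i) = 2 * ν + ((2 * (p + i) : ℤ) : ℂ) by push_cast; ring,
      Complex.cpow_add _ _ h0, Complex.cpow_intCast, zpow_mul]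
    norm_cast
  have e2 : (conj ζ) ^ (2 * (ν - p + j)) = (conj ζ) ^ (2 * ν) * ((conj ζ) ^ 2) ^ (j - p) := by
    rw [show 2 * (ν - p + j) = 2 * ν + ((2 * (j - p) : ℤ) : ℂ) by push_cast; ring,
      Complex.cpow_add _ _ hc, Complex.cpow_intCast, zpow_mul]
    norm_cast
  rw [e1, e2, polarPow, ← h1, hnorm, map_pow, zpow_add₀ (pow_ne_zero 2 h0),
    zpow_sub₀ (pow_ne_zero 2 hc), zpow_mul]
  have e3 : (ζ ^ 2 / (conj ζ * ζ)) ^ (2 : ℤ) = ζ ^ 2 / (conj ζ) ^ 2 := by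
    rw [zpow_ofNat]; field_simp
  rw [e3, div_zpow]
  ring

/-- `|x|^{2ν} (x/|x|)^{2p} x^i x̄^j`. -/
noncomputable def charPow (ν : ℂ) (p i j : ℤ) (x : ℂ) : ℂ :=
  polarPow (2 * ν) (2 * p) x * x ^ i * conj x ^ j

theorem norm_charPow (ν : ℂ) (p i j : ℤ) {x : ℂ} (hx : x ≠ 0) :
    ‖charPow ν p i j x‖ = ‖x‖ ^ (2 * ν.re + i + j) := by
  have h : 0 < ‖x‖ := norm_pos_iff.2 hx
  rw [charPow, norm_mul, norm_mul, norm_polarPow _ _ hx, norm_zpow, norm_zpow, Complex.norm_conj,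
    ← Real.rpow_intCast, ← Real.rpow_intCast, ← Real.rpow_add h, ← Real.rpow_add h]
  simp

theorem charPow_eq (ν : ℂ) (p i j : ℤ) {x : ℂ} (hx : x ≠ 0) :
    charPow ν p i j x = (x * conj x) ^ (ν - p) * x ^ (2 * p + i) * conj x ^ j := by
  have h : 0 < ‖x‖ := norm_pos_iff.2 hx
  have hn : ((‖x‖ : ℝ) : ℂ) ≠ 0 := by simpa using hx
  have hc : conj x ≠ 0 := (map_ne_zero _).2 hx
  have e1 : (x * conj x) ^ (ν - p) = ((‖x‖ : ℝ) : ℂ) ^ (2 * ν) * ((‖x‖ : ℝ) : ℂ) ^ (-(2 * p)) := by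
    rw [Complex.mul_conj', ← Complex.cpow_intCast, ← Complex.cpow_add _ _ hn,
      ← Complex.ofReal_pow, Complex.cpow_def_of_ne_zero (by exact_mod_cast (pow_pos h 2).ne'),
      Complex.cpow_def_of_ne_zero hn, ← Complex.ofReal_log (by positivity),
      ← Complex.ofReal_log h.le, Real.log_pow]
    congr 1
    push_cast
    ring
  rw [charPow, polarPow, e1, zpow_add₀ hx, div_zpow, zpow_neg]
  ring

theorem hasWirtingerAt_zpow (n : ℤ) {x : ℂ} (hx : x ≠ 0) :
    HasWirtingerAt (fun x => x ^ n) (n * x ^ (n - 1)) 0 x :=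
  (hasDerivAt_zpow n x (Or.inl hx)).hasWirtingerAt

theorem hasWirtingerAt_conj_zpow (n : ℤ) {x : ℂ} (hx : x ≠ 0) :
    HasWirtingerAt (fun x => conj x ^ n) 0 (n * conj x ^ (n - 1)) x :=
  HasDerivAt.hasWirtingerAt_conj (f := fun x => x ^ n)
    (hasDerivAt_zpow n (conj x) (Or.inl ((map_ne_zero _).2 hx)))

theorem hasWirtingerAt_id (x : ℂ) : HasWirtingerAt (fun x => x) 1 0 x :=
  (hasDerivAt_id x).hasWirtingerAt

theorem hasWirtingerAt_conj (x : ℂ) : HasWirtingerAt (fun x => conj x) 0 1 x :=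
  HasDerivAt.hasWirtingerAt_conj (f := fun x => x) (hasDerivAt_id (conj x))

theorem HasWirtingerAt.comp_hasDerivAt {f g : ℂ → ℂ} {a b x g' : ℂ}
    (hg : HasDerivAt g g' (f x)) (hf : HasWirtingerAt f a b x) :
    HasWirtingerAt (fun x => g (f x)) (g' * a) (g' * b) x := by
  refine ((hg.hasFDerivAt.restrictScalars ℝ).comp x hf).congr_fderiv ?_
  ext h
  simp [mulConjL_apply]
  ring

theorem hasWirtingerAt_charPow (ν : ℂ) (p i j : ℤ) {x : ℂ} (hx : x ≠ 0) :
    HasWirtingerAt (charPow ν p i j) ((ν + p + i) * charPow ν p (i - 1) j x)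
      ((ν - p + j) * charPow ν p i (j - 1) x) x := by
  have hc : conj x ≠ 0 := (map_ne_zero _).2 hx
  have hs : x * conj x ∈ Complex.slitPlane := by
    rw [Complex.mul_conj]
    exact Complex.ofReal_mem_slitPlane.2 (Complex.normSq_pos.2 hx)
  have hs0 : x * conj x ≠ 0 := mul_ne_zero hx hc
  have h1 : HasWirtingerAt (fun x : ℂ => (x * conj x) ^ (ν - p))
      ((ν - p) * (x * conj x) ^ (ν - p - 1) * conj x)
      ((ν - p) * (x * conj x) ^ (ν - p - 1) * x) x := by
    refine (HasWirtingerAt.comp_hasDerivAt (f := fun x : ℂ => x * conj x)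
      (g := fun y => y ^ (ν - p))
      ((hasDerivAt_id _).cpow_const hs)
      ((hasWirtingerAt_id x).mul (hasWirtingerAt_conj x))).congr_values ?_ ?_ <;> simp
  have h2 := (h1.mul (hasWirtingerAt_zpow (2 * p + i) hx)).mul (hasWirtingerAt_conj_zpow j hx)
  have e : charPow ν p i j =ᶠ[𝓝 x]
      fun x => (x * conj x) ^ (ν - p) * x ^ (2 * p + i) * conj x ^ j := by
    filter_upwards [isOpen_ne.mem_nhds hx] with y hy using charPow_eq ν p i j hy
  refine (h2.congr_of_eventuallyEq e).congr_values ?_ ?_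
  · rw [charPow_eq _ _ _ _ hx, Complex.cpow_sub _ 1 hs0, Complex.cpow_one,
      show 2 * p + (i - 1) = 2 * p + i - 1 by ring, zpow_sub_one₀ hx (2 * p + i)]
    push_cast
    field_simp
    ring
  · rw [charPow_eq _ _ _ _ hx, Complex.cpow_sub _ 1 hs0, Complex.cpow_one, zpow_sub_one₀ hc j]
    field_simp
    ring

/-- The smooth part of the kernel. -/
noncomputable def kerA (ν : ℂ) (p i j : ℤ) (x : ℂ) : ℂ :=
  besselEnt (-(ν + p + i)) x * besselEnt (-(ν - p + j)) (conj x)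

/-- The smooth factor of the singular part of the kernel. -/
noncomputable def kerB (ν : ℂ) (p i j : ℤ) (x : ℂ) : ℂ :=
  (-1) ^ (i + j) * (besselEnt (ν + p + i) x * besselEnt (ν - p + j) (conj x))

/-- The kernel `G_{i,j}`, with `∂ G_{i,j} = -G_{i-1,j}` and `∂̄ G_{i,j} = -G_{i,j-1}`. -/
noncomputable def kerG (ν : ℂ) (p i j : ℤ) (x : ℂ) : ℂ :=
  kerA ν p i j x - charPow ν p i j x * kerB ν p i j x

theorem hasWirtingerAt_besselEnt (μ x : ℂ) :
    HasWirtingerAt (besselEnt μ) (-besselEnt (μ + 1) x) 0 x :=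
  (hasDerivAt_besselEnt μ x).hasWirtingerAt

theorem hasWirtingerAt_besselEnt_conj (μ x : ℂ) :
    HasWirtingerAt (fun x => besselEnt μ (conj x)) 0 (-besselEnt (μ + 1) (conj x)) x :=
  (hasDerivAt_besselEnt μ (conj x)).hasWirtingerAt_conj

theorem hasWirtingerAt_kerA (ν : ℂ) (p i j : ℤ) (x : ℂ) :
    HasWirtingerAt (kerA ν p i j) (-kerA ν p (i - 1) j x) (-kerA ν p i (j - 1) x) x := by
  refine ((hasWirtingerAt_besselEnt _ x).mul (hasWirtingerAt_besselEnt_conj _ x)).congr_values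
    ?_ ?_
  · rw [kerA, show -(ν + p + i) + 1 = -(ν + p + ((i - 1 : ℤ) : ℂ)) by push_cast; ring]
    ring
  · rw [kerA, show -(ν - p + j) + 1 = -(ν - p + ((j - 1 : ℤ) : ℂ)) by push_cast; ring]
    ring

theorem hasWirtingerAt_kerG (ν : ℂ) (p i j : ℤ) {x : ℂ} (hx : x ≠ 0) :
    HasWirtingerAt (kerG ν p i j) (-kerG ν p (i - 1) j x) (-kerG ν p i (j - 1) x) x := by
  have hc : conj x ≠ 0 := (map_ne_zero _).2 hx
  have h1 : (-1 : ℂ) ≠ 0 := by norm_num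
  have h2 := ((hasWirtingerAt_besselEnt (ν + p + i) x).mul
    (hasWirtingerAt_besselEnt_conj (ν - p + j) x)).const_mul ((-1) ^ (i + j))
  refine ((hasWirtingerAt_kerA ν p i j x).sub
    ((hasWirtingerAt_charPow ν p i j hx).mul h2)).congr_values ?_ ?_
  · have e := besselEnt_sub_one (ν + p + i) x
    rw [show ν + p + i - 1 = ν + p + ((i - 1 : ℤ) : ℂ) by push_cast; ring] at e
    have e3 : charPow ν p i j x = charPow ν p (i - 1) j x * x := by
      rw [charPow, charPow, zpow_sub_one₀ hx]; field_simp
    have e4 : (-1 : ℂ) ^ (i + j) = -(-1) ^ (i - 1 + j) := by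
      rw [show i + j = i - 1 + j + 1 by ring, zpow_add_one₀ h1]; ring
    simp only [kerG, kerB]
    rw [e, e3, e4]
    ring
  · have e := besselEnt_sub_one (ν - p + j) (conj x)
    rw [show ν - p + j - 1 = ν - p + ((j - 1 : ℤ) : ℂ) by push_cast; ring] at e
    have e3 : charPow ν p i j x = charPow ν p i (j - 1) x * conj x := by
      rw [charPow, charPow, zpow_sub_one₀ hc]; field_simp
    have e4 : (-1 : ℂ) ^ (i + j) = -(-1) ^ (i + (j - 1)) := by
      rw [show i + j = i + (j - 1) + 1 by ring, zpow_add_one₀ h1]; ring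
    simp only [kerG, kerB]
    rw [e, e3, e4]
    ring

/-- The combination of Bessel functions that is proportional to `z^μ H_μ^{(2)}(2z)`. -/
noncomputable def hankelTwo (μ z : ℂ) : ℂ :=
  besselEnt (-μ) (z ^ 2) - Complex.exp (Complex.I * Real.pi * μ) * z ^ (2 * μ) *
    besselEnt μ (z ^ 2)

theorem mem_slitPlane_of_re_nonneg {z : ℂ} (hz : 0 ≤ z.re) (h0 : z ≠ 0) :
    z ∈ Complex.slitPlane := by
  rcases hz.lt_or_eq with h | h
  · exact Or.inl h
  · exact Or.inr fun hi => h0 (Complex.ext h.symm hi)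

theorem hankelTwo_eq (μ : ℂ) {z : ℂ} (hz : 0 ≤ z.re) (h0 : z ≠ 0) :
    hankelTwo μ z = conj (hankelOne (conj μ) (conj z)) := by
  have harg : z.arg ≠ Real.pi :=
    (Complex.mem_slitPlane_iff_arg.1 (mem_slitPlane_of_re_nonneg hz h0)).1
  have e : conj z ^ (2 * conj μ) = conj (z ^ (2 * μ)) := by
    rw [Complex.conj_cpow _ _ harg, map_mul, Complex.conj_conj, Complex.conj_ofNat]
  rw [hankelOne, hankelTwo, e]
  simp only [map_sub, map_mul, conj_besselEnt, map_pow, map_neg, Complex.conj_conj,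
    ← Complex.exp_conj, Complex.conj_I, Complex.conj_ofReal]
  ring_nf

theorem exists_norm_hankelTwo_le {μ : ℂ} (hμ : ∀ n : ℤ, μ ≠ n) :
    ∃ C, 0 ≤ C ∧ ∀ z : ℂ, 0 ≤ z.re → 1 ≤ ‖z‖ →
      ‖hankelTwo μ z‖ ≤ C * ‖z‖ ^ (μ.re + 3) * Real.exp (2 * z.im) := by
  have hμ' : ∀ n : ℤ, conj μ ≠ n := fun n hn => hμ n (by
    rw [← Complex.conj_conj μ, hn]; simp)
  obtain ⟨C, hC, h⟩ := exists_norm_hankelOne_le hμ'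
  refine ⟨C, hC, fun z hz hz1 => ?_⟩
  have h0 : z ≠ 0 := norm_pos_iff.1 (by linarith)
  rw [hankelTwo_eq μ hz h0, Complex.norm_conj]
  simpa using h (conj z) (by simpa using hz) (by simpa using hz1)

theorem kerG_sq_eq (ν : ℂ) (p i j : ℤ) {ζ : ℂ} (hζ : ζ ∈ Complex.slitPlane) :
    (Complex.exp (Complex.I * Real.pi * (ν + p + i)) -
        Complex.exp (-(Complex.I * Real.pi * (ν + p + i)))) ^ 2 * kerG ν p i j (ζ ^ 2) =
      (Complex.exp (Complex.I * Real.pi * (ν + p + i)) ^ 2 - 1) *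
        (hankelOne (ν + p + i) ζ * hankelOne (ν - p + j) (conj ζ)) +
      (Complex.exp (-(Complex.I * Real.pi * (ν + p + i))) ^ 2 - 1) *
        (hankelTwo (ν + p + i) ζ * hankelTwo (ν - p + j) (conj ζ)) := by
  set q := Complex.exp (Complex.I * Real.pi * (ν + p + i)) with hq
  set r := Complex.exp (-(Complex.I * Real.pi * (ν + p + i))) with hr
  have hqr : q * r = 1 := by rw [hq, hr, ← Complex.exp_add]; simp
  set σ : ℂ := (-1) ^ (i + j) with hσ
  have hexp : ∀ n : ℤ, Complex.exp (Complex.I * Real.pi * n) = (-1) ^ n := by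
    intro n
    rw [show Complex.I * Real.pi * n = n * (Real.pi * Complex.I) by ring, Complex.exp_int_mul,
      Complex.exp_pi_mul_I]
  have hpar : ((-1 : ℂ)) ^ (-(2 * p) - i + j) = σ := by
    rw [hσ, show -(2 * p) - i + j = i + j + 2 * (-p - i) by ring, zpow_add₀ (by norm_num),
      zpow_mul]
    norm_num
  have hpar' : ((-1 : ℂ)) ^ (2 * p + i - j) = σ := by
    rw [hσ, show 2 * p + i - j = i + j + 2 * (p - j) by ring, zpow_add₀ (by norm_num),
      zpow_mul]
    norm_num
  have hq' : Complex.exp (Complex.I * Real.pi * (ν - p + j)) = q * σ := by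
    rw [← hpar, ← hexp, hq, ← Complex.exp_add]; congr 1; push_cast; ring
  have hr' : Complex.exp (-(Complex.I * Real.pi * (ν - p + j))) = r * σ := by
    rw [← hpar', ← hexp, hr, ← Complex.exp_add]; congr 1; push_cast; ring
  have hc := polarPow_sq_eq ν p i j hζ
  simp only [kerG, kerA, kerB, charPow, hankelOne, hankelTwo, hq', hr']
  rw [hc, map_pow]
  set a := besselEnt (-(ν + p + i)) (ζ ^ 2)
  set a' := besselEnt (-(ν - p + j)) (conj ζ ^ 2)
  set b := besselEnt (ν + p + i) (ζ ^ 2)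
  set b' := besselEnt (ν - p + j) (conj ζ ^ 2)
  set w := ζ ^ (2 * (ν + p + i))
  set w' := conj ζ ^ (2 * (ν - p + j))
  linear_combination (-2 * a * a' - 2 * w * w' * σ * b * b' * q * r +
    (r + q) * (a * w' * σ * b' + a' * w * b)) * hqr

/-- Polynomial growth of the kernels. -/
theorem exists_norm_kerG_le {ν : ℂ} (hν : ∀ n : ℤ, ν ≠ n) (p i j : ℤ) :
    ∃ C, 0 ≤ C ∧ ∀ x : ℂ, 1 ≤ ‖x‖ →
      ‖kerG ν p i j x‖ ≤ C * ‖x‖ ^ (ν.re + (i + j) / 2 + 3) := by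
  have hμ : ∀ n : ℤ, ν + p + i ≠ n := fun n hn => hν (n - p - i) (by
    push_cast; linear_combination hn)
  have hμ' : ∀ n : ℤ, ν - p + j ≠ n := fun n hn => hν (n + p - j) (by
    push_cast; linear_combination hn)
  obtain ⟨C1, hC1, h1⟩ := exists_norm_hankelOne_le hμ
  obtain ⟨C1', hC1', h1'⟩ := exists_norm_hankelOne_le hμ'
  obtain ⟨C2, hC2, h2⟩ := exists_norm_hankelTwo_le hμ
  obtain ⟨C2', hC2', h2'⟩ := exists_norm_hankelTwo_le hμ'
  set q := Complex.exp (Complex.I * Real.pi * (ν + p + i)) with hq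
  set r := Complex.exp (-(Complex.I * Real.pi * (ν + p + i))) with hr
  have hd : q - r ≠ 0 := by
    have hs := sin_pi_mul_ne_zero hμ
    intro h
    apply hs
    rw [Complex.sin, show -(Real.pi * (ν + p + i)) * Complex.I =
      -(Complex.I * Real.pi * (ν + p + i)) by ring, show Real.pi * (ν + p + i) * Complex.I =
      Complex.I * Real.pi * (ν + p + i) by ring, ← hq, ← hr, ← neg_sub, h]
    simp
  have hd' : 0 < ‖(q - r) ^ 2‖ := norm_pos_iff.2 (pow_ne_zero 2 hd)
  refine ⟨(‖q ^ 2 - 1‖ * (C1 * C1') + ‖r ^ 2 - 1‖ * (C2 * C2')) / ‖(q - r) ^ 2‖, by positivity,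
    fun x hx => ?_⟩
  have hx0 : x ≠ 0 := norm_pos_iff.1 (by linarith)
  set ζ : ℂ := x ^ (1 / 2 : ℂ) with hζ
  have hsq : ζ ^ 2 = x := by
    rw [hζ, ← Complex.cpow_nat_mul]; norm_num
  have hre : 0 ≤ ζ.re := by
    rw [hζ, one_div, Complex.cpow_inv_two_re]; positivity
  have hnorm : ‖ζ‖ ^ 2 = ‖x‖ := by rw [← norm_pow, hsq]
  have hζ1 : 1 ≤ ‖ζ‖ := by nlinarith [norm_nonneg ζ]
  have hpos : 0 < ‖ζ‖ := by linarith
  have hζ0 : ζ ≠ 0 := norm_pos_iff.1 hpos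
  have key := congrArg norm (kerG_sq_eq ν p i j (mem_slitPlane_of_re_nonneg hre hζ0))
  rw [norm_mul, hsq, ← hq, ← hr] at key
  rw [div_mul_eq_mul_div, le_div_iff₀ hd', mul_comm, key]
  have ex : ‖x‖ ^ (ν.re + (i + j) / 2 + 3) =
      ‖ζ‖ ^ ((ν + p + i).re + 3) * ‖ζ‖ ^ ((ν - p + j).re + 3) := by
    rw [← Real.rpow_add hpos, ← hnorm, ← Real.rpow_natCast, ← Real.rpow_mul hpos.le]
    congr 1
    simp
    ring
  have hre' : 0 ≤ (conj ζ).re := by simpa using hre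
  have hn' : ‖conj ζ‖ = ‖ζ‖ := Complex.norm_conj ζ
  have b1 := mul_le_mul (h1 ζ hre hζ1) (h1' (conj ζ) hre' (by rwa [hn'])) (norm_nonneg _)
    (by positivity)
  have b2 := mul_le_mul (h2 ζ hre hζ1) (h2' (conj ζ) hre' (by rwa [hn'])) (norm_nonneg _)
    (by positivity)
  rw [hn', ← norm_mul] at b1 b2
  have x1 : Real.exp (-2 * ζ.im) * Real.exp (-2 * (conj ζ).im) = 1 := by
    rw [← Real.exp_add]; simp
  have x2 : Real.exp (2 * ζ.im) * Real.exp (2 * (conj ζ).im) = 1 := by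
    rw [← Real.exp_add]; simp
  refine (norm_add_le _ _).trans ?_
  rw [norm_mul, norm_mul (r ^ 2 - 1), add_mul, ex]
  refine add_le_add ?_ ?_
  · rw [mul_assoc]
    refine mul_le_mul_of_nonneg_left (b1.trans (le_of_eq ?_)) (norm_nonneg _)
    linear_combination (C1 * C1' * (‖ζ‖ ^ ((ν + p + i).re + 3) *
      ‖ζ‖ ^ ((ν - p + j).re + 3))) * x1
  · rw [mul_assoc]
    refine mul_le_mul_of_nonneg_left (b2.trans (le_of_eq ?_)) (norm_nonneg _)
    linear_combination (C2 * C2' * (‖ζ‖ ^ ((ν + p + i).re + 3) *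
      ‖ζ‖ ^ ((ν - p + j).re + 3))) * x2

/-! ### Integrals over the plane -/

theorem measurable_zpow_complex (k : ℤ) : Measurable fun x : ℂ => x ^ k := by
  rcases k with n | n
  · simpa using measurable_id.pow_const n
  · simp only [zpow_negSucc]
    exact (measurable_id.pow_const (n + 1)).inv

theorem measurable_kerG (ν : ℂ) (p i j : ℤ) : Measurable (kerG ν p i j) := by
  have h1 : Measurable fun x : ℂ => conj x ^ j :=
    (measurable_zpow_complex j).comp Complex.continuous_conj.measurable
  have hb : ∀ μ, Measurable (besselEnt μ) := fun μ => (continuous_besselEnt μ).measurable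
  have hb' : ∀ μ, Measurable fun x => besselEnt μ (conj x) := fun μ =>
    (hb μ).comp Complex.continuous_conj.measurable
  exact ((hb _).mul (hb' _)).sub ((((measurable_polarPow _ _).mul (measurable_zpow_complex i)).mul
    h1).mul (((hb _).mul (hb' _)).const_mul _))

theorem exists_norm_kerG_le_of_norm_le_one (ν : ℂ) (p i j : ℤ) :
    ∃ C, 0 ≤ C ∧ ∀ x : ℂ, x ≠ 0 → ‖x‖ ≤ 1 →
      ‖kerG ν p i j x‖ ≤ C * (1 + ‖x‖ ^ (2 * ν.re + i + j)) := by
  have hb : ∀ μ μ' : ℂ, Continuous fun x => besselEnt μ x * besselEnt μ' (conj x) := fun μ μ' =>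
    (continuous_besselEnt μ).mul ((continuous_besselEnt μ').comp Complex.continuous_conj)
  obtain ⟨A, hA⟩ := (isCompact_closedBall (0 : ℂ) 1).exists_bound_of_continuousOn
    (hb (-(ν + p + i)) (-(ν - p + j))).continuousOn
  obtain ⟨B, hB⟩ := (isCompact_closedBall (0 : ℂ) 1).exists_bound_of_continuousOn
    (hb (ν + p + i) (ν - p + j)).continuousOn
  have hA0 : 0 ≤ A := (norm_nonneg _).trans (hA 0 (by simp))
  have hB0 : 0 ≤ B := (norm_nonneg _).trans (hB 0 (by simp))
  refine ⟨A + B, by positivity, fun x hx hx1 => ?_⟩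
  have h1 := hA x (by simpa using hx1)
  have h2 := hB x (by simpa using hx1)
  rw [kerG, kerA, kerB]
  refine (norm_sub_le _ _).trans ?_
  rw [norm_mul (charPow ν p i j x), norm_mul ((-1 : ℂ) ^ (i + j)), norm_zpow, norm_neg, norm_one,
    one_zpow, one_mul, norm_charPow _ _ _ _ hx]
  have h3 : 0 ≤ ‖x‖ ^ (2 * ν.re + i + j) := by positivity
  nlinarith [mul_le_mul_of_nonneg_left h2 h3]

theorem exists_norm_kerG_le_add {ν : ℂ} (hν : ∀ n : ℤ, ν ≠ n) (p i j : ℤ) {σ P : ℝ} (hσ0 : σ ≤ 0)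
    (hσ : σ ≤ 2 * ν.re + i + j) (hP : ν.re + (i + j) / 2 + 3 ≤ P) :
    ∃ C, 0 ≤ C ∧ ∀ x : ℂ, x ≠ 0 → ‖kerG ν p i j x‖ ≤ C * (‖x‖ ^ σ + ‖x‖ ^ P) := by
  obtain ⟨C1, hC1, h1⟩ := exists_norm_kerG_le hν p i j
  obtain ⟨C2, hC2, h2⟩ := exists_norm_kerG_le_of_norm_le_one ν p i j
  refine ⟨C1 + 2 * C2, by positivity, fun x hx => ?_⟩
  have hpos : 0 < ‖x‖ := norm_pos_iff.2 hx
  have p1 : 0 ≤ ‖x‖ ^ σ := by positivity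
  have p2 : 0 ≤ ‖x‖ ^ P := by positivity
  rcases le_total 1 ‖x‖ with h | h
  · have e := mul_le_mul_of_nonneg_left (Real.rpow_le_rpow_of_exponent_le h hP) hC1
    nlinarith [h1 x h, mul_nonneg hC1 p1, mul_nonneg hC2 p1, mul_nonneg hC2 p2]
  · have e1 := Real.rpow_le_rpow_of_exponent_ge hpos h hσ0
    have e2 := Real.rpow_le_rpow_of_exponent_ge hpos h hσ
    rw [Real.rpow_zero] at e1
    have e3 := mul_le_mul_of_nonneg_left (add_le_add e1 e2) hC2
    nlinarith [h2 x hx h, mul_nonneg hC1 p1, mul_nonneg hC1 p2, mul_nonneg hC2 p2]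

theorem integrable_norm_rpow_mul_inv_pow {σ : ℝ} (hσ : -2 < σ) {k : ℕ} (hk : σ + 2 < k) :
    Integrable fun z : ℂ => ‖z‖ ^ σ * ((1 + ‖z‖) ^ k)⁻¹ := by
  have h := (integrable_fun_norm_addHaar (volume : Measure ℂ)
    (f := fun y : ℝ => y ^ σ * ((1 + y) ^ k)⁻¹)).2
  refine h ?_
  have hm : Measurable fun y : ℝ => y ^ (σ + 1) * ((1 + y) ^ k)⁻¹ := by fun_prop
  have e : EqOn (fun y : ℝ => y ^ (σ + 1) * ((1 + y) ^ k)⁻¹)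
      (fun y : ℝ => y ^ (Module.finrank ℝ ℂ - 1) • (y ^ σ * ((1 + y) ^ k)⁻¹)) (Ioi 0) := by
    intro y hy
    simp only [Complex.finrank_real_complex, smul_eq_mul]
    rw [Real.rpow_add_one (ne_of_gt hy)]
    ring
  refine IntegrableOn.congr_fun ?_ e measurableSet_Ioi
  rw [← Ioc_union_Ioi_eq_Ioi zero_le_one]
  refine IntegrableOn.union ?_ ?_
  · have h1 : IntegrableOn (fun y : ℝ => y ^ (σ + 1)) (Ioc 0 1) := by
      rw [← intervalIntegrable_iff_integrableOn_Ioc_of_le zero_le_one]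
      exact intervalIntegral.intervalIntegrable_rpow' (by linarith)
    refine h1.mono' hm.aestronglyMeasurable ?_
    filter_upwards [ae_restrict_mem measurableSet_Ioc] with y hy
    have hy0 : 0 < y := hy.1
    rw [Real.norm_of_nonneg (by positivity)]
    refine mul_le_of_le_one_right (by positivity) (inv_le_one_of_one_le₀ ?_)
    exact one_le_pow₀ (by linarith)
  · have h1 : IntegrableOn (fun y : ℝ => y ^ (σ + 1 - k)) (Ioi 1) :=
      integrableOn_Ioi_rpow_of_lt (by linarith) zero_lt_one
    refine h1.mono' hm.aestronglyMeasurable ?_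
    filter_upwards [ae_restrict_mem measurableSet_Ioi] with y hy
    have hy0 : (0 : ℝ) < y := zero_lt_one.trans hy
    rw [Real.norm_of_nonneg (by positivity), Real.rpow_sub hy0, Real.rpow_natCast, div_eq_mul_inv]
    gcongr
    linarith

theorem integral_complex_eq (f : ℂ → ℂ) :
    ∫ z, f z = ∫ w : ℝ × ℝ, f (w.1 + w.2 * Complex.I) := by
  rw [← Complex.volume_preserving_equiv_real_prod.symm.integral_comp
    Complex.measurableEquivRealProd.symm.measurableEmbedding]
  refine integral_congr_ae (Eventually.of_forall fun w => ?_)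
  simp only [Complex.measurableEquivRealProd_symm_apply, Complex.mk_eq_add_mul_I]

theorem integrable_complex_iff {f : ℂ → ℂ} :
    Integrable f ↔ Integrable fun w : ℝ × ℝ => f (w.1 + w.2 * Complex.I) := by
  rw [← Complex.volume_preserving_equiv_real_prod.symm.integrable_comp_emb
    Complex.measurableEquivRealProd.symm.measurableEmbedding]
  refine integrable_congr (Eventually.of_forall fun w => ?_)
  simp only [Function.comp, Complex.measurableEquivRealProd_symm_apply, Complex.mk_eq_add_mul_I]

/-- Integration by parts on the plane, for functions that may be singular at the origin. -/
theorem integral_wirtinger_eq_zero {F a b : ℂ → ℂ}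
    (h : ∀ x, x ≠ 0 → HasWirtingerAt F (a x) (b x) x) (hF : Integrable F) (ha : Integrable a)
    (hb : Integrable b) : ∫ x, a x = 0 := by
  have hne : ∀ᵐ y : ℝ, y ≠ 0 := (countable_singleton (0 : ℝ)).ae_notMem volume
  have h1 : ∫ x, (a x + b x) = 0 := by
    have hi : Integrable fun x => a x + b x := ha.add hb
    rw [integral_complex_eq, Measure.volume_eq_prod,
      integral_prod_symm _ (by simpa [Measure.volume_eq_prod] using integrable_complex_iff.1 hi)]
    refine integral_eq_zero_of_ae ?_
    have i1 := integrable_complex_iff.1 hi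
    have i2 := integrable_complex_iff.1 hF
    rw [Measure.volume_eq_prod] at i1 i2
    filter_upwards [hne, i1.prod_left_ae, i2.prod_left_ae] with y hy j1 j2
    refine integral_eq_zero_of_hasDerivAt_of_integrable (f := fun x : ℝ => F (x + y * Complex.I))
      (fun x => ?_) j1 j2
    have hx : ((x : ℂ) + y * Complex.I) ≠ 0 := fun h0 => hy (by simpa using congrArg Complex.im h0)
    have hd : HasDerivAt (fun x : ℝ => (x : ℂ) + y * Complex.I) 1 x :=
      (Complex.ofRealCLM.hasDerivAt (x := x)).add_const _
    have := HasFDerivAt.comp_hasDerivAt x (h _ hx) hd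
    exact HasDerivAt.congr_deriv this (by simp [mulConjL_apply])
  have h2 : ∫ x, (a x - b x) * Complex.I = 0 := by
    have hi : Integrable fun x => (a x - b x) * Complex.I := (ha.sub hb).mul_const _
    rw [integral_complex_eq, Measure.volume_eq_prod,
      integral_prod _ (by simpa [Measure.volume_eq_prod] using integrable_complex_iff.1 hi)]
    refine integral_eq_zero_of_ae ?_
    have i1 := integrable_complex_iff.1 hi
    have i2 := integrable_complex_iff.1 hF
    rw [Measure.volume_eq_prod] at i1 i2
    filter_upwards [hne, i1.prod_right_ae, i2.prod_right_ae] with y hy j1 j2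
    refine integral_eq_zero_of_hasDerivAt_of_integrable (f := fun x : ℝ => F (y + x * Complex.I))
      (fun x => ?_) j1 j2
    have hx : ((y : ℂ) + x * Complex.I) ≠ 0 := fun h0 => hy (by simpa using congrArg Complex.re h0)
    have hd : HasDerivAt (fun x : ℝ => (y : ℂ) + x * Complex.I) (1 * Complex.I) x :=
      ((Complex.ofRealCLM.hasDerivAt (x := x)).mul_const _).const_add _
    have := HasFDerivAt.comp_hasDerivAt x (h _ hx) hd
    exact HasDerivAt.congr_deriv this (by simp [mulConjL_apply]; ring)
  rw [integral_mul_const, mul_eq_zero, or_iff_left Complex.I_ne_zero, integral_sub ha hb] at h2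
  rw [integral_add ha hb] at h1
  linear_combination (h1 + h2) / 2

/-- Differentiation under the integral sign. -/
theorem hasWirtingerAt_integral {ψ f f₁ f₂ : ℂ → ℂ} {U : Set ℂ} {u₀ : ℂ} {bound : ℂ → ℝ}
    (hU : U ∈ 𝓝 u₀) (hψ : Measurable ψ) (hf : Measurable f) (hf₁ : Measurable f₁)
    (hf₂ : Measurable f₂)
    (hd : ∀ u ∈ U, ∀ z, z ≠ 0 → HasWirtingerAt f (f₁ (u * z)) (f₂ (u * z)) (u * z))
    (hi : Integrable fun z => ψ z * f (u₀ * z)) (hbound : Integrable bound)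
    (h₁ : ∀ u ∈ U, ∀ z, z ≠ 0 → ‖z * ψ z * f₁ (u * z)‖ ≤ bound z)
    (h₂ : ∀ u ∈ U, ∀ z, z ≠ 0 → ‖conj z * ψ z * f₂ (u * z)‖ ≤ bound z) :
    HasWirtingerAt (fun u => ∫ z, ψ z * f (u * z)) (∫ z, z * ψ z * f₁ (u₀ * z))
      (∫ z, conj z * ψ z * f₂ (u₀ * z)) u₀ := by
  have hne : ∀ᵐ z : ℂ, z ≠ 0 := (countable_singleton (0 : ℂ)).ae_notMem volume
  have hmul : ∀ u : ℂ, Measurable fun z : ℂ => u * z := fun u => measurable_const_mul u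
  have m₁ : Measurable fun z => z * ψ z * f₁ (u₀ * z) :=
    (measurable_id.mul hψ).mul (hf₁.comp (hmul _))
  have m₂ : Measurable fun z => conj z * ψ z * f₂ (u₀ * z) :=
    (Complex.continuous_conj.measurable.mul hψ).mul (hf₂.comp (hmul _))
  have i₁ : Integrable fun z => z * ψ z * f₁ (u₀ * z) :=
    hbound.mono' m₁.aestronglyMeasurable (hne.mono fun z hz => h₁ u₀ (mem_of_mem_nhds hU) z hz)
  have i₂ : Integrable fun z => conj z * ψ z * f₂ (u₀ * z) :=
    hbound.mono' m₂.aestronglyMeasurable (hne.mono fun z hz => h₂ u₀ (mem_of_mem_nhds hU) z hz)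
  set F' : ℂ → ℂ → ℂ →L[ℝ] ℂ := fun u z =>
    ContinuousLinearMap.mul ℝ ℂ (z * ψ z * f₁ (u * z)) + mulConjL (conj z * ψ z * f₂ (u * z))
    with hF'
  have e : ∫ z, F' u₀ z = ContinuousLinearMap.mul ℝ ℂ (∫ z, z * ψ z * f₁ (u₀ * z)) +
      mulConjL (∫ z, conj z * ψ z * f₂ (u₀ * z)) := by
    rw [hF', integral_add ((ContinuousLinearMap.mul ℝ ℂ).integrable_comp i₁)
      (mulConjL.integrable_comp i₂), ContinuousLinearMap.integral_comp_comm _ i₁,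
      ContinuousLinearMap.integral_comp_comm _ i₂]
  unfold HasWirtingerAt
  rw [← e]
  refine hasFDerivAt_integral_of_dominated_of_fderiv_le (bound := fun z => bound z + bound z) hU
    (Eventually.of_forall fun u => (hψ.mul (hf.comp (hmul u))).aestronglyMeasurable) hi
    (((ContinuousLinearMap.mul ℝ ℂ).integrable_comp i₁).add
      (mulConjL.integrable_comp i₂)).aestronglyMeasurable ?_ (hbound.add hbound) ?_
  · filter_upwards [hne] with z hz u hu
    refine (norm_add_le _ _).trans (add_le_add ?_ ?_)
    · exact (ContinuousLinearMap.opNorm_mul_apply_le ℝ ℂ _).trans (h₁ u hu z hz)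
    · refine (mulConjL.le_opNorm _).trans ?_
      exact (mul_le_of_le_one_left (norm_nonneg _) norm_mulConjL_le).trans (h₂ u hu z hz)
  · filter_upwards [hne] with z hz u hu
    have h0 := hd u hu z hz
    have h3 : HasWirtingerAt (fun u => f (z * u)) (z * f₁ (u * z)) (conj z * f₂ (u * z)) u :=
      HasWirtingerAt.comp_mul_left z (by rw [mul_comm z u]; exact h0)
    refine ((h3.const_mul (ψ z)).congr_of_eventuallyEq
      (Eventually.of_forall fun v => ?_)).congr_values ?_ ?_
    · simp only [mul_comm z v]
    · ring
    · ring

/-! ### Bounds by continuous seminorms of the Schwartz space -/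

/-- Nonnegative functions on the Schwartz space that are bounded by a continuous seminorm. -/
def SeminormBdd (q : 𝓢(ℂ, ℂ) → ℝ) : Prop :=
  (∀ φ, 0 ≤ q φ) ∧ ∃ Q : Seminorm ℂ 𝓢(ℂ, ℂ), Continuous Q ∧ ∀ φ, q φ ≤ Q φ

namespace SeminormBdd

variable {q r : 𝓢(ℂ, ℂ) → ℝ}

theorem add (hq : SeminormBdd q) (hr : SeminormBdd r) : SeminormBdd fun φ => q φ + r φ := by
  obtain ⟨h0, Q, hQ, h⟩ := hq
  obtain ⟨k0, R, hR, k⟩ := hr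
  exact ⟨fun φ => add_nonneg (h0 φ) (k0 φ), Q + R, hQ.add hR, fun φ => add_le_add (h φ) (k φ)⟩

theorem const_mul (hq : SeminormBdd q) {C : ℝ} (hC : 0 ≤ C) : SeminormBdd fun φ => C * q φ := by
  obtain ⟨h0, Q, hQ, h⟩ := hq
  lift C to NNReal using hC
  refine ⟨fun φ => mul_nonneg C.coe_nonneg (h0 φ), C • Q, ?_, fun φ => ?_⟩
  · exact continuous_const.mul hQ
  · exact mul_le_mul_of_nonneg_left (h φ) C.coe_nonneg

theorem comp (hq : SeminormBdd q) (A : 𝓢(ℂ, ℂ) →L[ℂ] 𝓢(ℂ, ℂ)) :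
    SeminormBdd fun φ => q (A φ) := by
  obtain ⟨h0, Q, hQ, h⟩ := hq
  exact ⟨fun φ => h0 _, Q.comp A.toLinearMap, hQ.comp A.continuous, fun φ => h _⟩

theorem zero : SeminormBdd fun _ => 0 :=
  ⟨fun _ => le_rfl, 0, continuous_const, fun _ => le_rfl⟩

theorem sum {ι : Type*} (s : Finset ι) {q : ι → 𝓢(ℂ, ℂ) → ℝ}
    (h : ∀ i ∈ s, SeminormBdd (q i)) : SeminormBdd fun φ => ∑ i ∈ s, q i φ := by
  classical
  induction s using Finset.induction_on with
  | empty => simpa using zero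
  | insert i s hi ih =>
    simp only [Finset.sum_insert hi]
    exact (h i (Finset.mem_insert_self i s)).add
      (ih fun j hj => h j (Finset.mem_insert_of_mem hj))

end SeminormBdd

theorem exists_norm_schwartz_le (k : ℕ) :
    ∃ q, SeminormBdd q ∧ ∀ (φ : 𝓢(ℂ, ℂ)) z, ‖φ z‖ ≤ q φ * ((1 + ‖z‖) ^ k)⁻¹ := by
  set Q : Seminorm ℂ 𝓢(ℂ, ℂ) :=
    (Finset.Iic ((k, 0) : ℕ × ℕ)).sup fun m => SchwartzMap.seminorm ℂ m.1 m.2 with hQ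
  have hs : SeminormBdd fun φ => Q φ := by
    have h1 : SeminormBdd fun φ => ∑ m ∈ Finset.Iic ((k, 0) : ℕ × ℕ),
        schwartzSeminormFamily ℂ ℂ ℂ m φ := SeminormBdd.sum _ fun m _ =>
      ⟨fun φ => apply_nonneg _ φ, _, (schwartz_withSeminorms ℂ ℂ ℂ).continuous_seminorm m,
        fun φ => le_rfl⟩
    obtain ⟨-, R, hR, h2⟩ := h1
    refine ⟨fun φ => apply_nonneg Q φ, R, hR, fun φ => le_trans ?_ (h2 φ)⟩
    exact Seminorm.finset_sup_apply_le (Finset.sum_nonneg fun m _ => apply_nonneg _ φ)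
      fun m hm => Finset.single_le_sum (f := fun m => schwartzSeminormFamily ℂ ℂ ℂ m φ)
        (fun m _ => apply_nonneg _ φ) hm
  refine ⟨_, hs.const_mul (C := 2 ^ k) (by positivity), fun φ z => ?_⟩
  have h := SchwartzMap.one_add_le_sup_seminorm_apply (𝕜 := ℂ) (m := (k, 0)) (k := k) (n := 0)
    le_rfl le_rfl φ z
  rw [norm_iteratedFDeriv_zero] at h
  rw [← div_eq_mul_inv, le_div_iff₀ (by positivity), mul_comm]
  exact h

theorem exists_clm_of_bounds (T : 𝓢(ℂ, ℂ) →ₗ[ℂ] (ℂ → ℂ))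
    (hs : ∀ φ (n : ℕ), ContDiff ℝ n (T φ))
    (hb : ∀ k n : ℕ, ∃ q, SeminormBdd q ∧
      ∀ φ u, ‖u‖ ^ k * ‖iteratedFDeriv ℝ n (T φ) u‖ ≤ q φ) :
    ∃ A : 𝓢(ℂ, ℂ) →L[ℂ] 𝓢(ℂ, ℂ), ∀ φ u, A φ u = T φ u := by
  refine ⟨SchwartzMap.mkCLM (fun φ => T φ) (fun f g x => by simp) (fun a f x => by simp)
    (fun φ => contDiff_infty.2 (hs φ)) ?_, fun φ u => rfl⟩
  rintro ⟨k, n⟩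
  obtain ⟨q, ⟨_, Q, hQ, hqQ⟩, h⟩ := hb k n
  obtain ⟨s, C, -, hC⟩ := Seminorm.bound_of_continuous (schwartz_withSeminorms ℂ ℂ ℂ) Q hQ
  exact ⟨s, C, C.coe_nonneg, fun φ u => (h φ u).trans ((hqQ φ).trans (hC φ))⟩

theorem exists_wordSum_le {ι Φ : Type*} {d₁ d₂ : ι → ι} {S : (Φ → ℝ) → Prop}
    (hS : ∀ q r, S q → S r → S fun φ => q φ + r φ) {N : ι → Φ → ℂ → ℝ} {U : Set ℂ} {w : ℂ → ℝ}
    (h : ∀ i, ∃ q, S q ∧ ∀ φ, ∀ u ∈ U, N i φ u ≤ q φ * w u) (n : ℕ) (i : ι) :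
    ∃ q, S q ∧ ∀ φ, ∀ u ∈ U, wordSum d₁ d₂ (fun j => N j φ u) n i ≤ q φ * w u := by
  induction n generalizing i with
  | zero => exact h i
  | succ n ih =>
    obtain ⟨q, hq, h1⟩ := ih (d₁ i)
    obtain ⟨r, hr, h2⟩ := ih (d₂ i)
    refine ⟨_, hS q r hq hr, fun φ u hu => ?_⟩
    rw [wordSum, add_mul]
    exact add_le_add (h1 φ u hu) (h2 φ u hu)

/-! ### Integral transforms with temperate kernels -/

theorem _root_.Function.HasTemperateGrowth.fderiv_apply {f : ℂ → ℂ} (hf : f.HasTemperateGrowth)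
    (v : ℂ) : (fun x => fderiv ℝ f x v).HasTemperateGrowth := by
  have h : (fderiv ℝ f).HasTemperateGrowth := by
    refine ⟨hf.1.fderiv_right (by simp), fun n => ?_⟩
    obtain ⟨k, C, h⟩ := hf.2 (n + 1)
    exact ⟨k, C, fun x => by rw [norm_iteratedFDeriv_fderiv]; exact h x⟩
  exact ((ContinuousLinearMap.apply ℝ ℂ v).hasTemperateGrowth).comp h

theorem _root_.Function.HasTemperateGrowth.dz {f : ℂ → ℂ} (hf : f.HasTemperateGrowth) :
    (SisHankel.dz f).HasTemperateGrowth := by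
  have := (Function.HasTemperateGrowth.const (E := ℂ) ((1 : ℂ) / 2)).mul
    ((hf.fderiv_apply 1).sub ((Function.HasTemperateGrowth.const Complex.I).mul
      (hf.fderiv_apply Complex.I)))
  refine (congrArg Function.HasTemperateGrowth ?_).mp this
  funext x
  simp only [SisHankel.dz, Pi.mul_apply, Pi.sub_apply]
  ring

theorem _root_.Function.HasTemperateGrowth.dzbar {f : ℂ → ℂ} (hf : f.HasTemperateGrowth) :
    (SisHankel.dzbar f).HasTemperateGrowth := by
  have := (Function.HasTemperateGrowth.const (E := ℂ) ((1 : ℂ) / 2)).mul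
    ((hf.fderiv_apply 1).add ((Function.HasTemperateGrowth.const Complex.I).mul
      (hf.fderiv_apply Complex.I)))
  refine (congrArg Function.HasTemperateGrowth ?_).mp this
  funext x
  simp only [SisHankel.dzbar, Pi.mul_apply, Pi.add_apply]
  ring

/-- The transform with kernel `f(uz)` and weight `|z|^s (z/|z|)^k z^i z̄^j`. -/
noncomputable def tempInt (s : ℂ) (k : ℤ) (f : ℂ → ℂ) (i j : ℕ) (φ : ℂ → ℂ) (u : ℂ) : ℂ :=
  ∫ z, polarPow s k z * z ^ i * conj z ^ j * φ z * f (u * z)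

theorem exists_norm_tempInt_integrand_le (s : ℂ) (k : ℤ) {f : ℂ → ℂ} (hf : f.HasTemperateGrowth)
    (i j : ℕ) (R : ℝ) (K : ℕ) :
    ∃ q, SeminormBdd q ∧ ∀ (φ : 𝓢(ℂ, ℂ)) (u : ℂ), ‖u‖ ≤ R → ∀ z : ℂ, z ≠ 0 →
      ‖polarPow s k z * z ^ i * conj z ^ j * φ z * f (u * z)‖ ≤
        q φ * (‖z‖ ^ s.re * ((1 + ‖z‖) ^ K)⁻¹) := by
  obtain ⟨m, C, hC⟩ := hf.2 0
  obtain ⟨q, hq, h⟩ := exists_norm_schwartz_le (m + i + j + K)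
  have hC0 : 0 ≤ C := by simpa using (norm_nonneg _).trans (hC 0)
  rcases lt_or_ge R 0 with hR | hR
  · exact ⟨_, SeminormBdd.zero, fun φ u hu => absurd (norm_nonneg u) (by linarith)⟩
  refine ⟨_, hq.const_mul (C := C * (1 + R) ^ m) (by positivity), fun φ u hu z hz => ?_⟩
  have h1 := hC (u * z)
  rw [norm_iteratedFDeriv_zero] at h1
  have h2 : ‖f (u * z)‖ ≤ C * ((1 + R) ^ m * (1 + ‖z‖) ^ m) := by
    refine h1.trans (mul_le_mul_of_nonneg_left ?_ hC0)
    rw [← mul_pow, norm_mul]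
    have : ‖u‖ * ‖z‖ ≤ R * ‖z‖ := by gcongr
    gcongr
    nlinarith [norm_nonneg z]
  rw [norm_mul, norm_mul, norm_mul, norm_mul, norm_polarPow _ _ hz, norm_pow, norm_pow,
    Complex.norm_conj]
  have hz1 : ‖z‖ ≤ 1 + ‖z‖ := by linarith
  have h0 : 0 ≤ q φ := hq.1 φ
  calc ‖z‖ ^ s.re * ‖z‖ ^ i * ‖z‖ ^ j * ‖φ z‖ * ‖f (u * z)‖
      ≤ ‖z‖ ^ s.re * (1 + ‖z‖) ^ i * (1 + ‖z‖) ^ j *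
        (q φ * ((1 + ‖z‖) ^ (m + i + j + K))⁻¹) * (C * ((1 + R) ^ m * (1 + ‖z‖) ^ m)) := by
        gcongr
        exact h φ z
    _ = _ := by
        have : (1 + ‖z‖) ≠ 0 := by positivity
        rw [pow_add, pow_add, pow_add]
        field_simp

theorem exists_nat_weight {σ : ℝ} (hσ : -2 < σ) :
    ∃ K : ℕ, Integrable fun z : ℂ => ‖z‖ ^ σ * ((1 + ‖z‖) ^ K)⁻¹ := by
  obtain ⟨K, hK⟩ := exists_nat_gt (σ + 2)
  exact ⟨K, integrable_norm_rpow_mul_inv_pow hσ hK⟩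

theorem ae_ne_zero : ∀ᵐ z : ℂ, z ≠ 0 := (countable_singleton (0 : ℂ)).ae_notMem volume

theorem measurable_weight (s : ℂ) (k : ℤ) (i j : ℕ) (φ : 𝓢(ℂ, ℂ)) :
    Measurable fun z => polarPow s k z * z ^ i * conj z ^ j * φ z :=
  (((measurable_polarPow s k).mul (measurable_id.pow_const i)).mul
    (Complex.continuous_conj.measurable.pow_const j)).mul φ.continuous.measurable

theorem integrable_tempInt {s : ℂ} (hs : -2 < s.re) (k : ℤ) {f : ℂ → ℂ}
    (hf : f.HasTemperateGrowth) (i j : ℕ) (φ : 𝓢(ℂ, ℂ)) (u : ℂ) :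
    Integrable fun z => polarPow s k z * z ^ i * conj z ^ j * φ z * f (u * z) := by
  obtain ⟨K, hK⟩ := exists_nat_weight hs
  obtain ⟨q, hq, h⟩ := exists_norm_tempInt_integrand_le s k hf i j ‖u‖ K
  refine (hK.const_mul (q φ)).mono' ?_ (ae_ne_zero.mono fun z hz => h φ u le_rfl z hz)
  exact ((measurable_weight s k i j φ).mul
    (hf.1.continuous.measurable.comp (measurable_const_mul u))).aestronglyMeasurable

theorem exists_norm_tempInt_le {s : ℂ} (hs : -2 < s.re) (k : ℤ) {f : ℂ → ℂ}
    (hf : f.HasTemperateGrowth) (i j : ℕ) (R : ℝ) :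
    ∃ q, SeminormBdd q ∧ ∀ φ : 𝓢(ℂ, ℂ), ∀ u : ℂ, ‖u‖ ≤ R → ‖tempInt s k f i j φ u‖ ≤ q φ := by
  obtain ⟨K, hK⟩ := exists_nat_weight hs
  obtain ⟨q, hq, h⟩ := exists_norm_tempInt_integrand_le s k hf i j R K
  refine ⟨_, hq.const_mul (C := ∫ z : ℂ, ‖z‖ ^ s.re * ((1 + ‖z‖) ^ K)⁻¹)
    (integral_nonneg fun z => by positivity), fun φ u hu => ?_⟩
  rw [mul_comm, ← integral_const_mul]
  exact norm_integral_le_of_norm_le (hK.const_mul (q φ))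
    (ae_ne_zero.mono fun z hz => h φ u hu z hz)

theorem hasWirtingerAt_tempInt {s : ℂ} (hs : -2 < s.re) (k : ℤ) {f : ℂ → ℂ}
    (hf : f.HasTemperateGrowth) (i j : ℕ) (φ : 𝓢(ℂ, ℂ)) (u : ℂ) :
    HasWirtingerAt (tempInt s k f i j φ) (tempInt s k (dz f) (i + 1) j φ u)
      (tempInt s k (dzbar f) i (j + 1) φ u) u := by
  obtain ⟨K, hK⟩ := exists_nat_weight hs
  obtain ⟨q₁, hq₁, h₁⟩ := exists_norm_tempInt_integrand_le s k hf.dz (i + 1) j (‖u‖ + 1) K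
  obtain ⟨q₂, hq₂, h₂⟩ := exists_norm_tempInt_integrand_le s k hf.dzbar i (j + 1) (‖u‖ + 1) K
  have hU : Metric.closedBall (0 : ℂ) (‖u‖ + 1) ∈ 𝓝 u :=
    mem_of_superset (Metric.isOpen_ball.mem_nhds (by simp : u ∈ Metric.ball (0 : ℂ) (‖u‖ + 1)))
      Metric.ball_subset_closedBall
  have hm : ∀ {g : ℂ → ℂ}, g.HasTemperateGrowth → Measurable g :=
    fun hg => hg.1.continuous.measurable
  have e₁ : ∀ v z : ℂ, z * (polarPow s k z * z ^ i * conj z ^ j * φ z) * dz f (v * z) =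
    polarPow s k z * z ^ (i + 1) * conj z ^ j * φ z * dz f (v * z) := fun v z => by ring
  have e₂ : ∀ v z : ℂ, conj z * (polarPow s k z * z ^ i * conj z ^ j * φ z) * dzbar f (v * z) =
    polarPow s k z * z ^ i * conj z ^ (j + 1) * φ z * dzbar f (v * z) := fun v z => by ring
  have hw : ∀ z : ℂ, 0 ≤ ‖z‖ ^ s.re * ((1 + ‖z‖) ^ K)⁻¹ := fun z => by positivity
  refine (hasWirtingerAt_integral (f := f) (f₁ := dz f) (f₂ := dzbar f)
    (bound := fun z => (q₁ φ + q₂ φ) * (‖z‖ ^ s.re * ((1 + ‖z‖) ^ K)⁻¹)) hU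
    (measurable_weight s k i j φ) (hm hf) (hm hf.dz) (hm hf.dzbar)
    (fun v _ z _ => ((hf.1.differentiable (by simp)) _).hasWirtingerAt)
    (integrable_tempInt hs k hf i j φ u) (hK.const_mul _) ?_ ?_).congr_values ?_ ?_
  · intro v hv z hz
    rw [e₁]
    refine (h₁ φ v (by simpa using hv) z hz).trans ?_
    exact mul_le_mul_of_nonneg_right (le_add_of_nonneg_right (hq₂.1 φ)) (hw z)
  · intro v hv z hz
    rw [e₂]
    refine (h₂ φ v (by simpa using hv) z hz).trans ?_
    exact mul_le_mul_of_nonneg_right (le_add_of_nonneg_left (hq₁.1 φ)) (hw z)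
  · simp only [e₁, tempInt]
  · simp only [e₂, tempInt]

theorem contDiff_tempInt {s : ℂ} (hs : -2 < s.re) (k : ℤ) {f : ℂ → ℂ}
    (hf : f.HasTemperateGrowth) (i j : ℕ) (φ : 𝓢(ℂ, ℂ)) (n : ℕ) :
    ContDiff ℝ n (tempInt s k f i j φ) :=
  contDiffOn_univ.1 (contDiffOn_of_hasWirtingerAt_family
    (ι := {f : ℂ → ℂ // f.HasTemperateGrowth} × ℕ × ℕ)
    (F := fun x => tempInt s k x.1.1 x.2.1 x.2.2 φ)
    (d₁ := fun x => (⟨dz x.1.1, x.1.2.dz⟩, x.2.1 + 1, x.2.2))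
    (d₂ := fun x => (⟨dzbar x.1.1, x.1.2.dzbar⟩, x.2.1, x.2.2 + 1)) isOpen_univ
    (fun x u _ => hasWirtingerAt_tempInt hs k x.1.2 x.2.1 x.2.2 φ u) n (⟨f, hf⟩, i, j))

theorem exists_norm_iteratedFDeriv_tempInt_le {s : ℂ} (hs : -2 < s.re) (k : ℤ) {f : ℂ → ℂ}
    (hf : f.HasTemperateGrowth) (i j : ℕ) (R : ℝ) (n : ℕ) :
    ∃ q, SeminormBdd q ∧ ∀ φ : 𝓢(ℂ, ℂ), ∀ u : ℂ, ‖u‖ ≤ R →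
      ‖iteratedFDeriv ℝ n (tempInt s k f i j φ) u‖ ≤ q φ := by
  obtain ⟨q, hq, h⟩ := exists_wordSum_le (ι := {f : ℂ → ℂ // f.HasTemperateGrowth} × ℕ × ℕ)
    (d₁ := fun x => (⟨dz x.1.1, x.1.2.dz⟩, x.2.1 + 1, x.2.2))
    (d₂ := fun x => (⟨dzbar x.1.1, x.1.2.dzbar⟩, x.2.1, x.2.2 + 1))
    (S := SeminormBdd) (fun q r hq hr => hq.add hr)
    (N := fun x (φ : 𝓢(ℂ, ℂ)) u => ‖tempInt s k x.1.1 x.2.1 x.2.2 φ u‖)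
    (U := Metric.closedBall 0 R) (w := fun _ => 1) (fun x => by
      simpa using exists_norm_tempInt_le hs k x.1.2 x.2.1 x.2.2 R) n (⟨f, hf⟩, i, j)
  refine ⟨q, hq, fun φ u hu => ?_⟩
  refine (norm_iteratedFDeriv_le_wordSum (U := univ)
    (F := fun x : {f : ℂ → ℂ // f.HasTemperateGrowth} × ℕ × ℕ => tempInt s k x.1.1 x.2.1 x.2.2 φ)
    (d₁ := fun x => (⟨dz x.1.1, x.1.2.dz⟩, x.2.1 + 1, x.2.2))
    (d₂ := fun x => (⟨dzbar x.1.1, x.1.2.dzbar⟩, x.2.1, x.2.2 + 1)) isOpen_univ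
    (fun x u _ => hasWirtingerAt_tempInt hs k x.1.2 x.2.1 x.2.2 φ u) n (⟨f, hf⟩, i, j)
    (mem_univ u)).trans ?_
  simpa using h φ u (by simpa using hu)

/-! ### Integral transforms with the kernels `G_{k,l}` -/

/-- The transform with kernel `G_{k,l}(uz)` and weight `z^a z̄^b`. -/
noncomputable def kerInt (ν : ℂ) (p k l : ℤ) (a b : ℕ) (φ : ℂ → ℂ) (u : ℂ) : ℂ :=
  ∫ z, z ^ a * conj z ^ b * φ z * kerG ν p k l (u * z)

theorem measurable_kerInt_integrand (ν : ℂ) (p k l : ℤ) (a b : ℕ) (φ : 𝓢(ℂ, ℂ)) (u : ℂ) :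
    Measurable fun z => z ^ a * conj z ^ b * φ z * kerG ν p k l (u * z) :=
  (((measurable_id.pow_const a).mul (Complex.continuous_conj.measurable.pow_const b)).mul
    φ.continuous.measurable).mul ((measurable_kerG ν p k l).comp (measurable_const_mul u))

/-- The derivative `∂` on the Schwartz space. -/
theorem exists_clm_dz : ∃ A B : 𝓢(ℂ, ℂ) →L[ℂ] 𝓢(ℂ, ℂ), ∀ (φ : 𝓢(ℂ, ℂ)) (z : ℂ),
    HasWirtingerAt φ (A φ z) (B φ z) z := by
  have hc : ∀ v : ℂ, ∃ D : 𝓢(ℂ, ℂ) →L[ℂ] 𝓢(ℂ, ℂ), ∀ (φ : 𝓢(ℂ, ℂ)) z,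
      D φ z = fderiv ℝ φ z v := fun v =>
    ⟨(SchwartzMap.evalCLM ℂ ℂ ℂ v).comp (SchwartzMap.fderivCLM ℂ ℂ ℂ), fun φ z => by simp⟩
  obtain ⟨D₁, h₁⟩ := hc 1
  obtain ⟨D₂, h₂⟩ := hc Complex.I
  refine ⟨(1 / 2 : ℂ) • (D₁ - Complex.I • D₂), (1 / 2 : ℂ) • (D₁ + Complex.I • D₂),
    fun φ z => (φ.differentiable z).hasWirtingerAt.congr_values ?_ ?_⟩
  · simp [dz, h₁, h₂]; ring
  · simp [dzbar, h₁, h₂]; ring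



theorem exists_norm_kerInt_integrand_le {ν : ℂ} (hν : ∀ n : ℤ, ν ≠ n) (hre : |ν.re| < 1) (p : ℤ)
    (k l : ℤ) (a b : ℕ) (hab : 0 ≤ a + b + k + l) {P : ℝ}
    (hP0 : 0 ≤ P) (hP : ν.re + (k + l) / 2 + 3 ≤ P) :
    ∃ q, SeminormBdd q ∧ ∃ σ : ℝ, σ ≤ 0 ∧ ∃ W : ℂ → ℝ, Integrable W ∧ (∀ z, 0 ≤ W z) ∧
      ∀ (φ : 𝓢(ℂ, ℂ)) (u z : ℂ), u ≠ 0 → z ≠ 0 →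
        ‖z ^ a * conj z ^ b * φ z * kerG ν p k l (u * z)‖ ≤
          q φ * (‖u‖ ^ σ + ‖u‖ ^ P) * W z := by
  set σ : ℝ := min 0 (2 * ν.re + k + l) with hσ
  have hre' := abs_lt.1 hre
  have hσ2 : -2 < σ + (a + b) := by
    have h2 : (0 : ℝ) ≤ a + b + k + l := by exact_mod_cast hab
    rw [hσ]
    rcases min_cases 0 (2 * ν.re + k + l) with ⟨e, _⟩ | ⟨e, _⟩ <;> rw [e]
    · linarith [(by positivity : (0 : ℝ) ≤ a + b)]
    · linarith
  have hP2 : -2 < P + (a + b) := by linarith [(by positivity : (0 : ℝ) ≤ a + b)]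
  obtain ⟨C, hC, hG⟩ := exists_norm_kerG_le_add hν p k l (σ := σ) (min_le_left _ _)
    (min_le_right _ _) hP
  obtain ⟨K, hK⟩ := exists_nat_gt (P + (a + b) + 2)
  obtain ⟨q, hq, hφ⟩ := exists_norm_schwartz_le K
  have hσP : σ ≤ P := (min_le_left _ _).trans hP0
  refine ⟨_, hq.const_mul hC, σ, min_le_left _ _,
    fun z => (‖z‖ ^ (σ + (a + b)) * ((1 + ‖z‖) ^ K)⁻¹ + ‖z‖ ^ (P + (a + b)) * ((1 + ‖z‖) ^ K)⁻¹),
    (integrable_norm_rpow_mul_inv_pow hσ2 (by linarith)).add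
      (integrable_norm_rpow_mul_inv_pow hP2 hK), fun z => by positivity, fun φ u z hu hz => ?_⟩
  have hu0 : 0 < ‖u‖ := norm_pos_iff.2 hu
  have hz0 : 0 < ‖z‖ := norm_pos_iff.2 hz
  have h1 := hG (u * z) (mul_ne_zero hu hz)
  have h2 : ‖u * z‖ ^ σ + ‖u * z‖ ^ P ≤ (‖u‖ ^ σ + ‖u‖ ^ P) * (‖z‖ ^ σ + ‖z‖ ^ P) := by
    rw [norm_mul, Real.mul_rpow hu0.le hz0.le, Real.mul_rpow hu0.le hz0.le]
    have e1 : 0 ≤ ‖u‖ ^ σ * ‖z‖ ^ P := by positivity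
    have e2 : 0 ≤ ‖u‖ ^ P * ‖z‖ ^ σ := by positivity
    nlinarith
  have h3 := h1.trans (mul_le_mul_of_nonneg_left h2 hC)
  rw [norm_mul, norm_mul, norm_mul, norm_pow, norm_pow, Complex.norm_conj]
  have h0 : 0 ≤ q φ := hq.1 φ
  calc ‖z‖ ^ a * ‖z‖ ^ b * ‖φ z‖ * ‖kerG ν p k l (u * z)‖
      ≤ ‖z‖ ^ a * ‖z‖ ^ b * (q φ * ((1 + ‖z‖) ^ K)⁻¹) *
        (C * ((‖u‖ ^ σ + ‖u‖ ^ P) * (‖z‖ ^ σ + ‖z‖ ^ P))) := by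
        gcongr
        exact hφ φ z
    _ = _ := by
        beta_reduce
        rw [← Nat.cast_add, Real.rpow_add hz0, Real.rpow_add hz0, Real.rpow_natCast, pow_add]
        ring

theorem integrable_kerInt {ν : ℂ} (hν : ∀ n : ℤ, ν ≠ n) (hre : |ν.re| < 1) (p : ℤ)
    (k l : ℤ) (a b : ℕ) (hab : 0 ≤ a + b + k + l) (φ : 𝓢(ℂ, ℂ)) {u : ℂ}
    (hu : u ≠ 0) : Integrable fun z => z ^ a * conj z ^ b * φ z * kerG ν p k l (u * z) := by
  obtain ⟨q, -, σ, -, W, hW, -, h⟩ := exists_norm_kerInt_integrand_le hν hre p k l a b hab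
    (le_max_left 0 _) (le_max_right _ _)
  exact (hW.const_mul (q φ * (‖u‖ ^ σ + ‖u‖ ^ (max 0 (ν.re + (k + l) / 2 + 3))))).mono'
    (measurable_kerInt_integrand ν p k l a b φ u).aestronglyMeasurable
    (ae_ne_zero.mono fun z hz => h φ u z hu hz)

theorem exists_norm_kerInt_le {ν : ℂ} (hν : ∀ n : ℤ, ν ≠ n) (hre : |ν.re| < 1) (p : ℤ)
    (k l : ℤ) (a b : ℕ) (hab : 0 ≤ a + b + k + l) {P : ℝ}
    (hP0 : 0 ≤ P) (hP : ν.re + (k + l) / 2 + 3 ≤ P) :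
    ∃ q, SeminormBdd q ∧ ∀ (φ : 𝓢(ℂ, ℂ)) (u : ℂ), 1 ≤ ‖u‖ →
      ‖kerInt ν p k l a b φ u‖ ≤ q φ * ‖u‖ ^ P := by
  obtain ⟨q, hq, σ, hσ, W, hW, hW0, h⟩ := exists_norm_kerInt_integrand_le hν hre p k l a b hab
    hP0 hP
  refine ⟨_, hq.const_mul (C := 2 * ∫ z, W z) (mul_nonneg zero_le_two (integral_nonneg hW0)),
    fun φ u hu => ?_⟩
  have hu0 : u ≠ 0 := norm_pos_iff.1 (by linarith)
  have h1 := norm_integral_le_of_norm_le (hW.const_mul (q φ * (‖u‖ ^ σ + ‖u‖ ^ P)))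
    (ae_ne_zero.mono fun z hz => h φ u z hu0 hz)
  refine h1.trans ?_
  rw [integral_const_mul]
  have h2 : ‖u‖ ^ σ ≤ ‖u‖ ^ P := Real.rpow_le_rpow_of_exponent_le hu (hσ.trans hP0)
  have h3 := mul_le_mul_of_nonneg_left h2 (mul_nonneg (hq.1 φ)
    (integral_nonneg (μ := volume) hW0))
  nlinarith [h3]

theorem hasWirtingerAt_kerInt {ν : ℂ} (hν : ∀ n : ℤ, ν ≠ n) (hre : |ν.re| < 1) (p : ℤ)
    (i j : ℕ) (φ : 𝓢(ℂ, ℂ)) {u : ℂ} (hu : u ≠ 0) :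
    HasWirtingerAt (fun u => (-1) ^ (i + j) * kerInt ν p (-i) (-j) i j φ u)
      ((-1) ^ (i + 1 + j) * kerInt ν p (-(i + 1 : ℕ)) (-j) (i + 1) j φ u)
      ((-1) ^ (i + (j + 1)) * kerInt ν p (-i) (-(j + 1 : ℕ)) i (j + 1) φ u) u := by
  have hpos : 0 < ‖u‖ := norm_pos_iff.2 hu
  obtain ⟨q₁, hq₁, σ₁, hσ₁, W₁, hW₁, hW₁0, h₁⟩ := exists_norm_kerInt_integrand_le hν hre p
    (-(i + 1 : ℕ)) (-j) (i + 1) j (by push_cast; linarith) (le_max_left 0 _) (le_max_right _ _)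
  obtain ⟨q₂, hq₂, σ₂, hσ₂, W₂, hW₂, hW₂0, h₂⟩ := exists_norm_kerInt_integrand_le hν hre p
    (-i) (-(j + 1 : ℕ)) i (j + 1) (by push_cast; linarith) (le_max_left 0 _) (le_max_right _ _)
  set P₁ := max 0 (ν.re + (((-(i + 1 : ℕ) : ℤ) : ℝ) + ((-j : ℤ) : ℝ)) / 2 + 3)
  set P₂ := max 0 (ν.re + (((-i : ℤ) : ℝ) + ((-(j + 1 : ℕ) : ℤ) : ℝ)) / 2 + 3)
  have hP₁ : 0 ≤ P₁ := le_max_left _ _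
  have hP₂ : 0 ≤ P₂ := le_max_left _ _
  have hU : {v : ℂ | ‖u‖ / 2 < ‖v‖ ∧ ‖v‖ < 2 * ‖u‖} ∈ 𝓝 u :=
    ((isOpen_lt continuous_const continuous_norm).inter
      (isOpen_lt continuous_norm continuous_const)).mem_nhds ⟨half_lt_self hpos, lt_two_mul_self hpos⟩
  have e₁ : ∀ v z : ℂ, z * (z ^ i * conj z ^ j * φ z) * -kerG ν p (-i - 1) (-j) (v * z) =
      -(z ^ (i + 1) * conj z ^ j * φ z * kerG ν p (-(i + 1 : ℕ)) (-j) (v * z)) := fun v z => by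
    rw [show (-(i + 1 : ℕ) : ℤ) = -i - 1 by push_cast; ring]; ring
  have e₂ : ∀ v z : ℂ, conj z * (z ^ i * conj z ^ j * φ z) * -kerG ν p (-i) (-j - 1) (v * z) =
      -(z ^ i * conj z ^ (j + 1) * φ z * kerG ν p (-i) (-(j + 1 : ℕ)) (v * z)) := fun v z => by
    rw [show (-(j + 1 : ℕ) : ℤ) = -j - 1 by push_cast; ring]; ring
  have key : ∀ v : ℂ, ‖u‖ / 2 < ‖v‖ ∧ ‖v‖ < 2 * ‖u‖ → ∀ {σ P : ℝ}, σ ≤ 0 → 0 ≤ P →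
      ‖v‖ ^ σ + ‖v‖ ^ P ≤ (‖u‖ / 2) ^ σ + (2 * ‖u‖) ^ P := fun v hv σ P hσ hP =>
    add_le_add (Real.rpow_le_rpow_of_nonpos (by linarith) hv.1.le hσ)
      (Real.rpow_le_rpow (norm_nonneg _) hv.2.le hP)
  have main := hasWirtingerAt_integral (ψ := fun z => z ^ i * conj z ^ j * φ z)
    (f := kerG ν p (-i) (-j)) (f₁ := fun x => -kerG ν p (-i - 1) (-j) x)
    (f₂ := fun x => -kerG ν p (-i) (-j - 1) x)
    (bound := fun z => q₁ φ * ((‖u‖ / 2) ^ σ₁ + (2 * ‖u‖) ^ P₁) * W₁ z +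
      q₂ φ * ((‖u‖ / 2) ^ σ₂ + (2 * ‖u‖) ^ P₂) * W₂ z) hU
    (((measurable_id.pow_const i).mul (Complex.continuous_conj.measurable.pow_const j)).mul
      φ.continuous.measurable) (measurable_kerG ν p _ _) (measurable_kerG ν p _ _).neg
    (measurable_kerG ν p _ _).neg
    (fun v hv z hz => hasWirtingerAt_kerG ν p (-i) (-j)
      (mul_ne_zero (norm_pos_iff.1 (by linarith [hv.1])) hz))
    (integrable_kerInt hν hre p (-i) (-j) i j (by linarith) φ hu)
    ((hW₁.const_mul _).add (hW₂.const_mul _)) (fun v hv z hz => ?_) (fun v hv z hz => ?_)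
  · refine (main.const_mul ((-1) ^ (i + j))).congr_values ?_ ?_
    · simp only [e₁, integral_neg, kerInt]; ring
    · simp only [e₂, integral_neg, kerInt]; ring
  · rw [e₁, norm_neg]
    have hv0 : v ≠ 0 := norm_pos_iff.1 (by linarith [hv.1])
    refine (h₁ φ v z hv0 hz).trans (le_add_of_le_of_nonneg ?_ ?_)
    · exact mul_le_mul_of_nonneg_right (mul_le_mul_of_nonneg_left (key v hv hσ₁ hP₁) (hq₁.1 φ))
        (hW₁0 z)
    · exact mul_nonneg (mul_nonneg (hq₂.1 φ) (by positivity)) (hW₂0 z)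
  · rw [e₂, norm_neg]
    have hv0 : v ≠ 0 := norm_pos_iff.1 (by linarith [hv.1])
    refine (h₂ φ v z hv0 hz).trans (le_add_of_nonneg_of_le ?_ ?_)
    · exact mul_nonneg (mul_nonneg (hq₁.1 φ) (by positivity)) (hW₁0 z)
    · exact mul_le_mul_of_nonneg_right (mul_le_mul_of_nonneg_left (key v hv hσ₂ hP₂) (hq₂.1 φ))
        (hW₂0 z)

theorem mul_kerInt_eq {ν : ℂ} (hν : ∀ n : ℤ, ν ≠ n) (hre : |ν.re| < 1) (p : ℤ)
    {A B : 𝓢(ℂ, ℂ) →L[ℂ] 𝓢(ℂ, ℂ)}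
    (hA : ∀ (φ : 𝓢(ℂ, ℂ)) (z : ℂ), HasWirtingerAt φ (A φ z) (B φ z) z) (k l : ℤ) (a b : ℕ)
    (hab : 0 ≤ a + b + k + l) (φ : 𝓢(ℂ, ℂ)) {u : ℂ} (hu : u ≠ 0) :
    u * kerInt ν p k l a b φ u =
      a * kerInt ν p (k + 1) l (a - 1) b φ u + kerInt ν p (k + 1) l a b (A φ) u := by
  have i0 := integrable_kerInt hν hre p (k + 1) l a b (by linarith) φ hu
  have i1 := (integrable_kerInt hν hre p (k + 1) l (a - 1) b (by omega) φ hu).const_mul (a : ℂ)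
  have i2 := integrable_kerInt hν hre p (k + 1) l a b (by linarith) (A φ) hu
  have i3 := (integrable_kerInt hν hre p k l a b hab φ hu).const_mul (-u)
  have j1 := (integrable_kerInt hν hre p (k + 1) l a (b - 1) (by omega) φ hu).const_mul (b : ℂ)
  have j2 := integrable_kerInt hν hre p (k + 1) l a b (by linarith) (B φ) hu
  have j3 := (integrable_kerInt hν hre p (k + 1) (l - 1) a b (by linarith) φ hu).const_mul
    (-conj u)
  have hd : ∀ z, z ≠ 0 → HasWirtingerAt
      (fun z => z ^ a * conj z ^ b * φ z * kerG ν p (k + 1) l (u * z))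
      (a * (z ^ (a - 1) * conj z ^ b * φ z * kerG ν p (k + 1) l (u * z)) +
        z ^ a * conj z ^ b * A φ z * kerG ν p (k + 1) l (u * z) +
        -u * (z ^ a * conj z ^ b * φ z * kerG ν p k l (u * z)))
      (b * (z ^ a * conj z ^ (b - 1) * φ z * kerG ν p (k + 1) l (u * z)) +
        z ^ a * conj z ^ b * B φ z * kerG ν p (k + 1) l (u * z) +
        -conj u * (z ^ a * conj z ^ b * φ z * kerG ν p (k + 1) (l - 1) (u * z))) z := by
    intro z hz
    have d1 : HasWirtingerAt (fun z : ℂ => z ^ a) (a * z ^ (a - 1)) 0 z :=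
      (hasDerivAt_pow a z).hasWirtingerAt
    have d2 : HasWirtingerAt (fun z : ℂ => conj z ^ b) 0 (b * conj z ^ (b - 1)) z :=
      HasDerivAt.hasWirtingerAt_conj (f := fun x => x ^ b) (hasDerivAt_pow b (conj z))
    have d3 := HasWirtingerAt.comp_mul_left u
      (hasWirtingerAt_kerG ν p (k + 1) l (mul_ne_zero hu hz))
    refine (((d1.mul d2).mul (hA φ z)).mul d3).congr_values ?_ ?_
    · rw [add_sub_cancel_right]; ring
    · ring
  have h0 := integral_wirtinger_eq_zero hd i0 ((i1.add i2).add i3) ((j1.add j2).add j3)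
  have i12 : Integrable fun z => a * (z ^ (a - 1) * conj z ^ b * φ z * kerG ν p (k + 1) l (u * z)) +
      z ^ a * conj z ^ b * A φ z * kerG ν p (k + 1) l (u * z) := i1.add i2
  rw [integral_add i12 i3, integral_add i1 i2, integral_const_mul,
    integral_const_mul] at h0
  simp only [kerInt]
  linear_combination -h0

theorem exists_norm_kerInt_le_iterate {ν : ℂ} (hν : ∀ n : ℤ, ν ≠ n) (hre : |ν.re| < 1) (p : ℤ)
    (n : ℕ) (k l : ℤ) (a b : ℕ) (hab : 0 ≤ a + b + k + l) :
    ∃ q, SeminormBdd q ∧ ∀ (φ : 𝓢(ℂ, ℂ)) (u : ℂ), 1 ≤ ‖u‖ →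
      ‖u‖ ^ n * ‖kerInt ν p k l a b φ u‖ ≤ q φ * ‖u‖ ^ ((|(k + l : ℝ)| + n) / 2 + 4) := by
  have hre' := abs_lt.1 hre
  suffices H : ∀ (n : ℕ) (k : ℤ) (a : ℕ), 0 ≤ a + b + k + l → ∀ P : ℝ, 0 ≤ P →
      ν.re + (k + l + n) / 2 + 3 ≤ P → ∃ q, SeminormBdd q ∧ ∀ (φ : 𝓢(ℂ, ℂ)) (u : ℂ), 1 ≤ ‖u‖ →
        ‖u‖ ^ n * ‖kerInt ν p k l a b φ u‖ ≤ q φ * ‖u‖ ^ P by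
    refine H n k a hab _ (by positivity) ?_
    linarith [le_abs_self (k + l : ℝ)]
  intro n
  induction n with
  | zero =>
    intro k a hab P hP0 hP
    obtain ⟨q, hq, h⟩ := exists_norm_kerInt_le hν hre p k l a b hab hP0 (by simpa using hP)
    exact ⟨q, hq, fun φ u hu => by simpa using h φ u hu⟩
  | succ n ih =>
    intro k a hab P hP0 hP
    obtain ⟨A, B, hA⟩ := exists_clm_dz
    have hP' : ν.re + ((k + 1 : ℤ) + l + n) / 2 + 3 ≤ P := by
      push_cast at hP ⊢; linarith
    obtain ⟨q₁, hq₁, h₁⟩ := ih (k + 1) (a - 1) (by omega) P hP0 hP'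
    obtain ⟨q₂, hq₂, h₂⟩ := ih (k + 1) a (by linarith) P hP0 hP'
    refine ⟨_, (hq₁.const_mul (Nat.cast_nonneg a)).add (hq₂.comp A), fun φ u hu => ?_⟩
    have hu0 : u ≠ 0 := norm_pos_iff.1 (by linarith)
    have e := congrArg norm (mul_kerInt_eq hν hre p hA k l a b hab φ hu0)
    rw [norm_mul] at e
    rw [pow_succ, mul_assoc, e, add_mul]
    refine (mul_le_mul_of_nonneg_left (norm_add_le _ _) (by positivity)).trans ?_
    rw [mul_add, norm_mul, Complex.norm_natCast]
    refine add_le_add ?_ (h₂ (A φ) u hu)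
    have := mul_le_mul_of_nonneg_left (h₁ φ u hu) (Nat.cast_nonneg (α := ℝ) a)
    linarith

theorem exists_norm_kerInt_le_inv_pow {ν : ℂ} (hν : ∀ n : ℤ, ν ≠ n) (hre : |ν.re| < 1) (p : ℤ)
    (N : ℕ) (k l : ℤ) (a b : ℕ) (hab : 0 ≤ a + b + k + l) :
    ∃ q, SeminormBdd q ∧ ∀ (φ : 𝓢(ℂ, ℂ)) (u : ℂ), 1 ≤ ‖u‖ →
      ‖kerInt ν p k l a b φ u‖ ≤ q φ * (‖u‖ ^ N)⁻¹ := by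
  obtain ⟨n, hn⟩ := exists_nat_ge (2 * N + 8 + |(k + l : ℝ)|)
  obtain ⟨q, hq, h⟩ := exists_norm_kerInt_le_iterate hν hre p n k l a b hab
  refine ⟨q, hq, fun φ u hu => ?_⟩
  have hpos : 0 < ‖u‖ := by linarith
  rw [← div_eq_mul_inv, le_div_iff₀ (by positivity)]
  have h1 := h φ u hu
  have h2 : ‖u‖ ^ ((|(k + l : ℝ)| + n) / 2 + 4) * ‖u‖ ^ N ≤ ‖u‖ ^ n := by
    rw [← Real.rpow_natCast ‖u‖ N, ← Real.rpow_natCast ‖u‖ n, ← Real.rpow_add hpos]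
    exact Real.rpow_le_rpow_of_exponent_le hu (by linarith)
  have h3 : 0 < ‖u‖ ^ n := by positivity
  refine le_of_mul_le_mul_left ?_ h3
  calc ‖u‖ ^ n * (‖kerInt ν p k l a b φ u‖ * ‖u‖ ^ N)
      = ‖u‖ ^ n * ‖kerInt ν p k l a b φ u‖ * ‖u‖ ^ N := by ring
    _ ≤ q φ * ‖u‖ ^ ((|(k + l : ℝ)| + n) / 2 + 4) * ‖u‖ ^ N := by gcongr
    _ = q φ * (‖u‖ ^ ((|(k + l : ℝ)| + n) / 2 + 4) * ‖u‖ ^ N) := by ring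
    _ ≤ q φ * ‖u‖ ^ n := mul_le_mul_of_nonneg_left h2 (hq.1 φ)
    _ = ‖u‖ ^ n * q φ := by ring

theorem exists_norm_iteratedFDeriv_kerInt_le {ν : ℂ} (hν : ∀ n : ℤ, ν ≠ n) (hre : |ν.re| < 1) (p : ℤ)
    (N n : ℕ) :
    ∃ q, SeminormBdd q ∧ ∀ (φ : 𝓢(ℂ, ℂ)) (u : ℂ), 1 ≤ ‖u‖ →
      ‖iteratedFDeriv ℝ n (kerInt ν p 0 0 0 0 φ) u‖ ≤ q φ * (‖u‖ ^ N)⁻¹ := by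
  obtain ⟨q, hq, h⟩ := exists_wordSum_le (ι := ℕ × ℕ)
    (d₁ := fun x => (x.1 + 1, x.2)) (d₂ := fun x => (x.1, x.2 + 1))
    (S := SeminormBdd) (fun q r hq hr => hq.add hr)
    (N := fun x (φ : 𝓢(ℂ, ℂ)) u => ‖(-1) ^ (x.1 + x.2) * kerInt ν p (-x.1) (-x.2) x.1 x.2 φ u‖)
    (U := {u | 1 ≤ ‖u‖}) (w := fun u => (‖u‖ ^ N)⁻¹) (fun x => by
      simpa using exists_norm_kerInt_le_inv_pow hν hre p N (-x.1) (-x.2) x.1 x.2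
        (by linarith)) n (0, 0)
  refine ⟨q, hq, fun φ u hu => ?_⟩
  have h1 := norm_iteratedFDeriv_le_wordSum (U := {u | u ≠ 0}) (ι := ℕ × ℕ)
    (F := fun x u => (-1) ^ (x.1 + x.2) * kerInt ν p (-x.1) (-x.2) x.1 x.2 φ u)
    (d₁ := fun x => (x.1 + 1, x.2)) (d₂ := fun x => (x.1, x.2 + 1)) isOpen_ne
    (fun x u hu => hasWirtingerAt_kerInt hν hre p x.1 x.2 φ hu) n (0, 0)
    (show u ∈ {u : ℂ | u ≠ 0} from norm_pos_iff.1 (by linarith))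
  have h2 := h1.trans (h φ u hu)
  simpa using h2

/-! ### The transform of a Schwartz function -/

theorem exists_cutoff : ∃ θ : ℂ → ℂ, (∀ n : ℕ, ContDiff ℝ n θ) ∧ (∀ x, ‖x‖ < 1 → θ x = 1) ∧
    ∀ x, 2 < ‖x‖ → θ x = 0 := by
  let b : ContDiffBump (0 : ℂ) := ⟨1, 2, one_pos, one_lt_two⟩
  refine ⟨fun x => ((b x : ℝ) : ℂ), fun n => Complex.ofRealCLM.contDiff.comp b.contDiff,
    fun x hx => ?_, fun x hx => ?_⟩
  · beta_reduce
    rw [b.one_of_mem_closedBall (by simpa using hx.le)]; simp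
  · beta_reduce
    rw [b.zero_of_le_dist (by simpa using hx.le)]; simp

theorem contDiff_besselEnt_mul (μ μ' : ℂ) (n : ℕ) :
    ContDiff ℝ n fun x => besselEnt μ x * besselEnt μ' (conj x) := by
  have h : ∀ μ, ContDiff ℝ n (besselEnt μ) := fun μ =>
    ((differentiable_besselEnt μ).contDiff (n := n)).restrict_scalars ℝ
  exact (h μ).mul ((h μ').comp Complex.conjCLE.contDiff)

theorem contDiffOn_charPow (ν : ℂ) (p : ℤ) (n : ℕ) :
    ContDiffOn ℝ n (charPow ν p 0 0) {x | x ≠ 0} := by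
  have h := contDiffOn_of_hasWirtingerAt_family (ι := ℂ × ℤ × ℤ) (U := {x : ℂ | x ≠ 0})
    (F := fun i x => i.1 * charPow ν p i.2.1 i.2.2 x)
    (d₁ := fun i => (i.1 * (ν + p + i.2.1), i.2.1 - 1, i.2.2))
    (d₂ := fun i => (i.1 * (ν - p + i.2.2), i.2.1, i.2.2 - 1)) isOpen_ne
    (fun i x hx => ((hasWirtingerAt_charPow ν p i.2.1 i.2.2 hx).const_mul i.1).congr_values
      (by ring) (by ring)) n (1, 0, 0)
  simpa using h

theorem hasWirtingerAt_kerG_signed (ν : ℂ) (p : ℤ) (i j : ℕ) {x : ℂ} (hx : x ≠ 0) :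
    HasWirtingerAt (fun x => (-1) ^ (i + j) * kerG ν p (-i) (-j) x)
      ((-1) ^ (i + 1 + j) * kerG ν p (-(i + 1 : ℕ)) (-j) x)
      ((-1) ^ (i + (j + 1)) * kerG ν p (-i) (-(j + 1 : ℕ)) x) x := by
  refine ((hasWirtingerAt_kerG ν p (-i) (-j) hx).const_mul _).congr_values ?_ ?_
  · rw [show (-(i + 1 : ℕ) : ℤ) = -i - 1 by push_cast; ring]; ring
  · rw [show (-(j + 1 : ℕ) : ℤ) = -j - 1 by push_cast; ring]; ring

theorem contDiffOn_kerG (ν : ℂ) (p : ℤ) (n : ℕ) :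
    ContDiffOn ℝ n (kerG ν p 0 0) {x | x ≠ 0} := by
  have h := contDiffOn_of_hasWirtingerAt_family (ι := ℕ × ℕ) (U := {x : ℂ | x ≠ 0})
    (F := fun i x => (-1) ^ (i.1 + i.2) * kerG ν p (-i.1) (-i.2) x)
    (d₁ := fun i => (i.1 + 1, i.2)) (d₂ := fun i => (i.1, i.2 + 1)) isOpen_ne
    (fun i x hx => hasWirtingerAt_kerG_signed ν p i.1 i.2 hx) n (0, 0)
  simpa using h

theorem exists_norm_iteratedFDeriv_kerG_le {ν : ℂ} (hν : ∀ n : ℤ, ν ≠ n) (hre : |ν.re| < 1)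
    (p : ℤ) (n : ℕ) :
    ∃ C, ∀ x : ℂ, 1 ≤ ‖x‖ → ‖iteratedFDeriv ℝ n (kerG ν p 0 0) x‖ ≤ C * ‖x‖ ^ 4 := by
  have hre' := abs_lt.1 hre
  obtain ⟨q, -, h⟩ := exists_wordSum_le (ι := ℕ × ℕ) (Φ := Unit) (S := fun _ => True)
    (d₁ := fun i => (i.1 + 1, i.2)) (d₂ := fun i => (i.1, i.2 + 1)) (fun _ _ _ _ => trivial)
    (N := fun i _ x => ‖(-1) ^ (i.1 + i.2) * kerG ν p (-i.1) (-i.2) x‖)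
    (U := {x | 1 ≤ ‖x‖}) (w := fun x => ‖x‖ ^ 4) (fun i => by
      obtain ⟨C, hC, h⟩ := exists_norm_kerG_le hν p (-i.1) (-i.2)
      refine ⟨fun _ => C, trivial, fun _ x hx => ?_⟩
      rw [norm_mul, norm_pow, norm_neg, norm_one, one_pow, one_mul]
      refine (h x hx).trans (mul_le_mul_of_nonneg_left ?_ hC)
      rw [← Real.rpow_natCast]
      refine Real.rpow_le_rpow_of_exponent_le hx ?_
      push_cast
      linarith [(by positivity : (0 : ℝ) ≤ (i.1 + i.2) / 2)]) n (0, 0)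
  refine ⟨q (), fun x hx => ?_⟩
  have h1 := norm_iteratedFDeriv_le_wordSum (ι := ℕ × ℕ) (U := {x : ℂ | x ≠ 0})
    (F := fun i x => (-1) ^ (i.1 + i.2) * kerG ν p (-i.1) (-i.2) x)
    (d₁ := fun i => (i.1 + 1, i.2)) (d₂ := fun i => (i.1, i.2 + 1)) isOpen_ne
    (fun i x hx => hasWirtingerAt_kerG_signed ν p i.1 i.2 hx) n (0, 0)
    (show x ∈ {x : ℂ | x ≠ 0} from norm_pos_iff.1 (by linarith))
  simpa using h1.trans (h () x hx)

theorem hasTemperateGrowth_of_bounds {f : ℂ → ℂ} (hf : ∀ n : ℕ, ContDiff ℝ n f)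
    (h : ∀ n, ∃ k : ℕ, ∃ C, ∀ x, 3 < ‖x‖ → ‖iteratedFDeriv ℝ n f x‖ ≤ C * ‖x‖ ^ k) :
    f.HasTemperateGrowth := by
  refine ⟨contDiff_infty.2 hf, fun n => ?_⟩
  obtain ⟨k, C, hC⟩ := h n
  obtain ⟨D, hD⟩ := (isCompact_closedBall (0 : ℂ) 3).exists_bound_of_continuousOn
    ((hf n).continuous_iteratedFDeriv le_rfl).continuousOn
  refine ⟨k, max (|C|) D, fun x => ?_⟩
  have h1 : 1 ≤ (1 + ‖x‖) ^ k := one_le_pow₀ (by linarith [norm_nonneg x])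
  have h0 : 0 ≤ max (|C|) D := (abs_nonneg C).trans (le_max_left _ _)
  rcases le_or_gt ‖x‖ 3 with hx | hx
  · refine (hD x (by simpa using hx)).trans ((le_max_right (|C|) D).trans ?_)
    exact le_mul_of_one_le_right h0 h1
  · refine (hC x hx).trans ?_
    gcongr
    · exact (le_abs_self C).trans (le_max_left _ _)
    · linarith

theorem exists_norm_iteratedFDeriv_mul_tempInt_le {s : ℂ} (hs : -2 < s.re) (k : ℤ) {f : ℂ → ℂ}
    (hf : f.HasTemperateGrowth) {χ : ℂ → ℂ} (hχ : ∀ n : ℕ, ContDiff ℝ n χ) (R : ℝ) (n : ℕ) :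
    ∃ q, SeminormBdd q ∧ ∀ φ : 𝓢(ℂ, ℂ), ∀ u : ℂ, ‖u‖ ≤ R →
      ‖iteratedFDeriv ℝ n (fun u => χ u * tempInt s k f 0 0 φ u) u‖ ≤ q φ := by
  have hB : ∀ i : ℕ, ∃ D, 0 ≤ D ∧ ∀ u : ℂ, ‖u‖ ≤ R → ‖iteratedFDeriv ℝ i χ u‖ ≤ D := fun i => by
    obtain ⟨D, hD⟩ := (isCompact_closedBall (0 : ℂ) R).exists_bound_of_continuousOn
      ((hχ i).continuous_iteratedFDeriv le_rfl).continuousOn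
    exact ⟨|D|, abs_nonneg D, fun u hu => (hD u (by simpa using hu)).trans (le_abs_self D)⟩
  choose D hD0 hD using hB
  choose q hq hqu using fun i => exists_norm_iteratedFDeriv_tempInt_le hs k hf 0 0 R i
  refine ⟨_, SeminormBdd.sum (Finset.range (n + 1)) fun i _ =>
    (hq (n - i)).const_mul (C := n.choose i * D i) (mul_nonneg (Nat.cast_nonneg _) (hD0 i)),
    fun φ u hu => ?_⟩
  refine (norm_iteratedFDeriv_mul_le (hχ n) (contDiff_tempInt hs k hf 0 0 φ n) u le_rfl).trans
    (Finset.sum_le_sum fun i _ => ?_)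
  have := hD i u hu
  have := hqu (n - i) φ u hu
  have := hD0 i
  gcongr

theorem norm_iteratedFDeriv_congr {f g : ℂ → ℂ} {U : Set ℂ} (hU : IsOpen U)
    (h : ∀ x ∈ U, f x = g x) {x : ℂ} (hx : x ∈ U) (n : ℕ) :
    ‖iteratedFDeriv ℝ n f x‖ = ‖iteratedFDeriv ℝ n g x‖ := by
  have : f =ᶠ[𝓝 x] g := by filter_upwards [hU.mem_nhds hx] with y hy using h y hy
  rw [(this.iteratedFDeriv ℝ n).eq_of_nhds]

/-- `tempInt` as a linear map. -/
noncomputable def tempIntL {s : ℂ} (hs : -2 < s.re) (k : ℤ) {f : ℂ → ℂ}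
    (hf : f.HasTemperateGrowth) : 𝓢(ℂ, ℂ) →ₗ[ℂ] (ℂ → ℂ) where
  toFun φ := tempInt s k f 0 0 φ
  map_add' φ ψ := by
    funext u
    rw [Pi.add_apply, tempInt, tempInt, tempInt, ← integral_add
      (integrable_tempInt hs k hf 0 0 φ u) (integrable_tempInt hs k hf 0 0 ψ u)]
    exact integral_congr_ae (Eventually.of_forall fun z => by simp; ring)
  map_smul' c φ := by
    funext u
    rw [Pi.smul_apply, tempInt, tempInt, RingHom.id_apply, smul_eq_mul, ← integral_const_mul]
    exact integral_congr_ae (Eventually.of_forall fun z => by simp; ring)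

theorem contDiff_of_cutoff {f g h : ℂ → ℂ} {n : ℕ} (hg : ContDiff ℝ n g)
    (hh : ContDiffOn ℝ n h {x | x ≠ 0}) (h1 : ∀ x, ‖x‖ < 1 → f x = g x)
    (h2 : ∀ x, x ≠ 0 → f x = h x) : ContDiff ℝ n f := by
  refine contDiff_iff_contDiffAt.2 fun x => ?_
  rcases eq_or_ne x 0 with rfl | hx
  · refine hg.contDiffAt.congr_of_eventuallyEq ?_
    filter_upwards [Metric.ball_mem_nhds (0 : ℂ) one_pos] with y hy
    exact h1 y (by simpa using hy)
  · refine (hh.contDiffAt (isOpen_ne.mem_nhds hx)).congr_of_eventuallyEq ?_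
    filter_upwards [isOpen_ne.mem_nhds hx] with y hy
    exact h2 y hy

/-- The transform with kernel `G_{0,0}` of a Schwartz function is the sum of a Schwartz function
and of `|u|^{2ν} (u/|u|)^{2p}` times a Schwartz function. -/
theorem exists_clm_kerInt {ν : ℂ} (hν : ∀ n : ℤ, ν ≠ n) (hre : |ν.re| < 1) (p : ℤ) :
    ∃ α β : 𝓢(ℂ, ℂ) →L[ℂ] 𝓢(ℂ, ℂ), ∀ (φ : 𝓢(ℂ, ℂ)) (u : ℂ), u ≠ 0 →
      ∫ z, φ z * kerG ν p 0 0 (u * z) = α φ u + polarPow (2 * ν) (2 * p) u * β φ u := by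
  obtain ⟨θ, hθ, hθ1, hθ0⟩ := exists_cutoff
  have hre' := abs_lt.1 hre
  have hs0 : -2 < (0 : ℂ).re := by simp
  have hs : -2 < (2 * ν).re := by simp; linarith
  have hA : ∀ n : ℕ, ContDiff ℝ n (kerA ν p 0 0) := fun n => contDiff_besselEnt_mul _ _ n
  have hBc : ∀ n : ℕ, ContDiff ℝ n (kerB ν p 0 0) := fun n =>
    contDiff_const.mul (contDiff_besselEnt_mul _ _ n)
  have hθ' : ∀ n : ℕ, ContDiff ℝ n fun x => 1 - θ x := fun n => contDiff_const.sub (hθ n)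
  set a : ℂ → ℂ := fun x => θ x * kerA ν p 0 0 x + (1 - θ x) * kerG ν p 0 0 x with ha_def
  set b : ℂ → ℂ := fun x => θ x * kerB ν p 0 0 x with hb_def
  set χ : ℂ → ℂ := fun x => (1 - θ x) * charPow ν p 0 0 x with hχ_def
  have hbig : IsOpen {x : ℂ | 2 < ‖x‖} := isOpen_lt continuous_const continuous_norm
  have ha : a.HasTemperateGrowth := by
    refine hasTemperateGrowth_of_bounds (fun n => contDiff_of_cutoff (hA n)
      (((hθ n).mul (hA n)).contDiffOn.add ((hθ' n).contDiffOn.mul (contDiffOn_kerG ν p n)))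
      (fun x hx => by simp [ha_def, hθ1 x hx]) fun x _ => rfl) fun n => ?_
    obtain ⟨C, hC⟩ := exists_norm_iteratedFDeriv_kerG_le hν hre p n
    refine ⟨4, C, fun x hx => ?_⟩
    rw [norm_iteratedFDeriv_congr hbig (g := kerG ν p 0 0)
      (fun y hy => by simp [ha_def, hθ0 y hy]) (show x ∈ {x : ℂ | 2 < ‖x‖} by simp; linarith)]
    exact hC x (by linarith)
  have hb : b.HasTemperateGrowth := by
    refine hasTemperateGrowth_of_bounds (fun n => (hθ n).mul (hBc n)) fun n => ⟨0, 0, fun x hx => ?_⟩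
    rw [norm_iteratedFDeriv_congr hbig (g := fun _ => 0)
      (fun y hy => by simp [hb_def, hθ0 y hy]) (show x ∈ {x : ℂ | 2 < ‖x‖} by simp; linarith)]
    simp
  have hχ : ∀ n : ℕ, ContDiff ℝ n χ := fun n =>
    contDiff_of_cutoff (g := fun _ => 0) contDiff_const
      ((hθ' n).contDiffOn.mul (contDiffOn_charPow ν p n))
      (fun x hx => by simp [hχ_def, hθ1 x hx]) fun x _ => rfl
  have key : ∀ (φ : 𝓢(ℂ, ℂ)) (u : ℂ), u ≠ 0 → ∫ z, φ z * kerG ν p 0 0 (u * z) =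
      tempInt 0 0 a 0 0 φ u - polarPow (2 * ν) (2 * p) u *
        tempInt (2 * ν) (2 * p) b 0 0 φ u := by
    intro φ u hu
    rw [tempInt, tempInt, ← integral_const_mul, ← integral_sub
      (integrable_tempInt hs0 0 ha 0 0 φ u) ((integrable_tempInt hs _ hb 0 0 φ u).const_mul _)]
    refine integral_congr_ae (ae_ne_zero.mono fun z hz => ?_)
    have e : kerG ν p 0 0 (u * z) = a (u * z) -
        polarPow (2 * ν) (2 * p) u * polarPow (2 * ν) (2 * p) z * b (u * z) := by
      simp only [ha_def, hb_def, kerG, charPow, ← polarPow_mul]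
      simp only [zpow_zero]
      ring
    simp only [e, polarPow_zero_zero]
    ring
  have c0 : ∀ u, charPow ν p 0 0 u = polarPow (2 * ν) (2 * p) u := fun u => by simp [charPow]
  obtain ⟨α, hα⟩ := exists_clm_of_bounds
    (tempIntL hs0 0 ha - (LinearMap.mulLeft ℂ χ).comp (tempIntL hs (2 * p) hb))
    (fun φ n => (contDiff_tempInt hs0 0 ha 0 0 φ n).sub
      ((hχ n).mul (contDiff_tempInt hs (2 * p) hb 0 0 φ n))) (fun k n => by
      obtain ⟨q₁, hq₁, h₁⟩ := exists_norm_iteratedFDeriv_tempInt_le hs0 0 ha 0 0 3 n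
      obtain ⟨q₂, hq₂, h₂⟩ := exists_norm_iteratedFDeriv_mul_tempInt_le hs (2 * p) hb hχ 3 n
      obtain ⟨q₃, hq₃, h₃⟩ := exists_norm_iteratedFDeriv_kerInt_le hν hre p k n
      refine ⟨_, ((hq₁.add hq₂).const_mul (C := 3 ^ k) (by positivity)).add hq₃, fun φ u => ?_⟩
      have p1 := (hq₁.add hq₂).1 φ
      have p3 := hq₃.1 φ
      change ‖u‖ ^ k * ‖iteratedFDeriv ℝ n (fun u => tempInt 0 0 a 0 0 φ u -
        χ u * tempInt (2 * ν) (2 * p) b 0 0 φ u) u‖ ≤ _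
      rcases le_or_gt ‖u‖ 3 with hu | hu
      · refine le_add_of_le_of_nonneg ?_ p3
        have e : iteratedFDeriv ℝ n (fun u => tempInt 0 0 a 0 0 φ u -
            χ u * tempInt (2 * ν) (2 * p) b 0 0 φ u) u = iteratedFDeriv ℝ n
            (tempInt 0 0 a 0 0 φ) u - iteratedFDeriv ℝ n
              (fun u => χ u * tempInt (2 * ν) (2 * p) b 0 0 φ u) u :=
          iteratedFDeriv_sub_apply (contDiff_tempInt hs0 0 ha 0 0 φ n).contDiffAt
            ((hχ n).mul (contDiff_tempInt hs (2 * p) hb 0 0 φ n)).contDiffAt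
        rw [e]
        gcongr
        exact (norm_sub_le _ _).trans (add_le_add (h₁ φ u hu) (h₂ φ u hu))
      · refine le_add_of_nonneg_of_le (mul_nonneg (by positivity) p1) ?_
        rw [norm_iteratedFDeriv_congr hbig (g := kerInt ν p 0 0 0 0 φ) (fun y hy => ?_)
          (show u ∈ {x : ℂ | 2 < ‖x‖} by simp; linarith)]
        · have h4 := h₃ φ u (by linarith)
          rw [← div_eq_mul_inv, le_div_iff₀ (by positivity)] at h4
          linarith
        · have hy0 : y ≠ 0 := norm_pos_iff.1 (lt_trans two_pos hy)
          have := key φ y hy0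
          simp only [hχ_def, hθ0 y hy, c0, kerInt, pow_zero, one_mul, sub_zero]
          rw [this])
  obtain ⟨β, hβ⟩ := exists_clm_of_bounds
    ((LinearMap.mulLeft ℂ θ).comp (tempIntL hs (2 * p) hb))
    (fun φ n => (hθ n).mul (contDiff_tempInt hs (2 * p) hb 0 0 φ n)) (fun k n => by
      obtain ⟨q₂, hq₂, h₂⟩ := exists_norm_iteratedFDeriv_mul_tempInt_le hs (2 * p) hb hθ 3 n
      refine ⟨_, hq₂.const_mul (C := 3 ^ k) (by positivity), fun φ u => ?_⟩
      have p1 := hq₂.1 φ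
      change ‖u‖ ^ k * ‖iteratedFDeriv ℝ n (fun u => θ u *
        tempInt (2 * ν) (2 * p) b 0 0 φ u) u‖ ≤ _
      rcases le_or_gt ‖u‖ 3 with hu | hu
      · gcongr
        exact h₂ φ u hu
      · rw [norm_iteratedFDeriv_congr hbig (g := fun _ => 0)
          (fun y hy => by simp [hθ0 y hy]) (show u ∈ {x : ℂ | 2 < ‖x‖} by simp; linarith)]
        simp
        positivity)
  refine ⟨α, -β, fun φ u hu => ?_⟩
  have e1 : α φ u = tempInt 0 0 a 0 0 φ u - χ u * tempInt (2 * ν) (2 * p) b 0 0 φ u := hα φ u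
  have e2 : β φ u = θ u * tempInt (2 * ν) (2 * p) b 0 0 φ u := hβ φ u
  rw [key φ u hu, e1, neg_apply, neg_apply, e2]
  simp only [hχ_def, c0]
  ring

/-! ### The Hankel transform of a test function -/

/-- The kernel `B_{ν,p}(√w)`, in terms of `G_{0,0}`. -/
noncomputable def besselKer (ν : ℂ) (p : ℤ) (w : ℂ) : ℂ :=
  polarPow (-ν) (-p) (4 * Real.pi ^ 2 * w) * kerG ν p 0 0 (4 * Real.pi ^ 2 * w) /
    Complex.sin (Real.pi * ν)

theorem four_pi_sq_ne_zero : (4 * Real.pi ^ 2 : ℂ) ≠ 0 := by simp [Real.pi_ne_zero]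

theorem norm_four_pi_sq : ‖(4 * Real.pi ^ 2 : ℂ)‖ = 4 * Real.pi ^ 2 := by
  rw [norm_mul, norm_pow, Complex.norm_real, Real.norm_of_nonneg Real.pi_pos.le]; simp

theorem besselJJ_eq_besselEnt (ν : ℂ) (p : ℤ) {z : ℂ} (hz : z ≠ 0) :
    besselJJ ν p z = polarPow ν p ((z / 2) ^ 2) * (besselEnt (ν + p) ((z / 2) ^ 2) *
      besselEnt (ν - p) (conj ((z / 2) ^ 2))) := by
  have h2 : z / 2 ≠ 0 := div_ne_zero hz two_ne_zero
  have hn : (‖z‖ : ℂ) ≠ 0 := by simpa using hz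
  have e : z / (‖z‖ : ℝ) = z / 2 / (‖z / 2‖ : ℝ) := by
    rw [norm_div, Complex.norm_ofNat]; push_cast; field_simp
  rw [besselJJ, besselE_eq_besselEnt, besselE_eq_besselEnt, e, pow_two (z / 2), polarPow_mul,
    ← polarPow_add _ _ _ _ h2, polarPow, ← two_mul, ← two_mul, ← pow_two (z / 2), map_pow,
    map_div₀, Complex.conj_ofNat]
  ring

theorem besselBSqrt_neg (ν : ℂ) (p : ℤ) (w : ℂ) :
    besselBSqrt (-ν) (-p) w = besselBSqrt ν p w := by
  rw [besselBSqrt, besselBSqrt, besselB, besselB, neg_neg, neg_neg, mul_neg, Complex.sin_neg,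
    div_neg, ← neg_div, neg_sub]

theorem besselBSqrt_eq_besselKer (ν : ℂ) (p : ℤ) {w : ℂ} (hw : w ≠ 0) :
    besselBSqrt ν p w = besselKer ν p w := by
  have hs : (w ^ (1 / 2 : ℂ)) ^ 2 = w := by rw [← Complex.cpow_nat_mul]; norm_num
  have hs0 : w ^ (1 / 2 : ℂ) ≠ 0 := fun h => hw (by rw [← hs, h]; simp)
  have hz : 4 * Real.pi * w ^ (1 / 2 : ℂ) ≠ 0 := by simp [Real.pi_ne_zero, hw]
  have e : (4 * Real.pi * w ^ (1 / 2 : ℂ) / 2) ^ 2 = 4 * Real.pi ^ 2 * w := by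
    linear_combination 4 * (Real.pi : ℂ) ^ 2 * hs
  have hx : 4 * Real.pi ^ 2 * w ≠ 0 := mul_ne_zero four_pi_sq_ne_zero hw
  have hadd : polarPow ν p (4 * Real.pi ^ 2 * w) = polarPow (-ν) (-p) (4 * Real.pi ^ 2 * w) *
      polarPow (2 * ν) (2 * p) (4 * Real.pi ^ 2 * w) := by
    rw [← polarPow_add _ _ _ _ hx]; congr 1 <;> ring
  rw [besselBSqrt, besselB, besselJJ_eq_besselEnt _ _ hz, besselJJ_eq_besselEnt _ _ hz, e,
    besselKer, kerG, kerA, kerB, charPow, hadd]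
  congr 1
  simp only [Int.cast_neg, Int.cast_zero, add_zero, zpow_zero, mul_one, one_mul]
  rw [show -(ν + p) = -ν + -(p : ℂ) by ring, show -(ν - p) = -ν - -(p : ℂ) by ring]
  ring

theorem measurable_besselKer (ν : ℂ) (p : ℤ) : Measurable (besselKer ν p) :=
  (((measurable_polarPow _ _).comp (measurable_const_mul _)).mul
    ((measurable_kerG ν p 0 0).comp (measurable_const_mul _))).div_const _

theorem exists_norm_besselKer_le {ν : ℂ} (hν : ∀ n : ℤ, ν ≠ n) (hre : |ν.re| < 1) (p : ℤ) {τ : ℝ}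
    (hτ : |ν.re| ≤ τ) :
    ∃ C, 0 ≤ C ∧ ∀ w : ℂ, w ≠ 0 → ‖besselKer ν p w‖ ≤ C * (‖w‖ ^ (-τ) + ‖w‖ ^ (5 : ℝ)) := by
  have h1 := abs_lt.1 hre
  have h2 := abs_le.1 hτ
  obtain ⟨C, hC, h⟩ := exists_norm_kerG_le_add hν p 0 0 (σ := ν.re - τ) (P := 5 + ν.re)
    (by linarith) (by push_cast; linarith) (by push_cast; linarith)
  have hs : 0 < ‖Complex.sin (Real.pi * ν)‖ := norm_pos_iff.2 (sin_pi_mul_ne_zero hν)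
  have hc : (0 : ℝ) < 4 * Real.pi ^ 2 := by positivity
  refine ⟨C * ((4 * Real.pi ^ 2) ^ (-τ) + (4 * Real.pi ^ 2) ^ (5 : ℝ)) /
    ‖Complex.sin (Real.pi * ν)‖, by positivity, fun w hw => ?_⟩
  have hx : 4 * Real.pi ^ 2 * w ≠ 0 := mul_ne_zero four_pi_sq_ne_zero hw
  have hx0 : 0 < ‖4 * Real.pi ^ 2 * w‖ := norm_pos_iff.2 hx
  rw [besselKer, norm_div, norm_mul, norm_polarPow _ _ hx, div_mul_eq_mul_div]
  refine div_le_div_of_nonneg_right ?_ hs.le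
  have e : ‖4 * Real.pi ^ 2 * w‖ ^ (-ν).re *
      (‖4 * Real.pi ^ 2 * w‖ ^ (ν.re - τ) + ‖4 * Real.pi ^ 2 * w‖ ^ (5 + ν.re)) =
      ‖4 * Real.pi ^ 2 * w‖ ^ (-τ) + ‖4 * Real.pi ^ 2 * w‖ ^ (5 : ℝ) := by
    rw [mul_add, ← Real.rpow_add hx0, ← Real.rpow_add hx0]
    congr 2
    · simp; ring
    · simp
  calc _ ≤ ‖4 * Real.pi ^ 2 * w‖ ^ (-ν).re * (C * (‖4 * Real.pi ^ 2 * w‖ ^ (ν.re - τ) +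
        ‖4 * Real.pi ^ 2 * w‖ ^ (5 + ν.re))) := by
        gcongr
        exact h _ hx
    _ = C * (‖4 * Real.pi ^ 2 * w‖ ^ (-τ) + ‖4 * Real.pi ^ 2 * w‖ ^ (5 : ℝ)) := by
        rw [← e]; ring
    _ ≤ _ := by
        rw [norm_mul, norm_four_pi_sq, Real.mul_rpow hc.le (norm_nonneg _),
          Real.mul_rpow hc.le (norm_nonneg _), mul_assoc C]
        refine mul_le_mul_of_nonneg_left ?_ hC
        have i1 : 0 ≤ (4 * Real.pi ^ 2) ^ (-τ) * ‖w‖ ^ (5 : ℝ) := by positivity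
        have i2 : 0 ≤ (4 * Real.pi ^ 2) ^ (5 : ℝ) * ‖w‖ ^ (-τ) := by positivity
        nlinarith

/-- Functions on the plane that are `O(|z|^{-τ})` at the origin and decay rapidly. -/
structure RapidDecay (τ : ℝ) (f : ℂ → ℂ) : Prop where
  measurable : Measurable f
  bound : ∀ K : ℕ, ∃ C, 0 ≤ C ∧ ∀ z : ℂ, z ≠ 0 → ‖f z‖ ≤ C * (‖z‖ ^ (-τ) * ((1 + ‖z‖) ^ K)⁻¹)

namespace RapidDecay

variable {τ : ℝ} {f g : ℂ → ℂ}

theorem add (hf : RapidDecay τ f) (hg : RapidDecay τ g) : RapidDecay τ fun z => f z + g z := by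
  refine ⟨hf.measurable.add hg.measurable, fun K => ?_⟩
  obtain ⟨C, hC, h⟩ := hf.bound K
  obtain ⟨D, hD, k⟩ := hg.bound K
  refine ⟨C + D, add_nonneg hC hD, fun z hz => ?_⟩
  rw [add_mul]
  exact (norm_add_le _ _).trans (add_le_add (h z hz) (k z hz))

theorem const_mul (hf : RapidDecay τ f) (c : ℂ) : RapidDecay τ fun z => c * f z := by
  refine ⟨hf.measurable.const_mul c, fun K => ?_⟩
  obtain ⟨C, hC, h⟩ := hf.bound K
  refine ⟨‖c‖ * C, by positivity, fun z hz => ?_⟩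
  rw [norm_mul, mul_assoc]
  exact mul_le_mul_of_nonneg_left (h z hz) (norm_nonneg _)

theorem integrable_mul_weight (hf : RapidDecay τ f) (hτ : τ < 1) {σ : ℝ} (hσ : -1 ≤ σ) :
    Integrable fun z => ‖f z‖ * ‖z‖ ^ σ := by
  obtain ⟨K, hK⟩ := exists_nat_weight (σ := -τ + σ) (by linarith)
  obtain ⟨C, hC, h⟩ := hf.bound K
  refine (hK.const_mul C).mono' (by
    have := hf.measurable
    fun_prop) (ae_ne_zero.mono fun z hz => ?_)
  have hz0 : 0 < ‖z‖ := norm_pos_iff.2 hz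
  rw [Real.norm_of_nonneg (by positivity), Real.rpow_add hz0]
  calc _ ≤ C * (‖z‖ ^ (-τ) * ((1 + ‖z‖) ^ K)⁻¹) * ‖z‖ ^ σ := by
        gcongr
        exact h z hz
    _ = _ := by ring

end RapidDecay

theorem rapidDecay_polarPow_mul {s : ℂ} {τ : ℝ} (hs : |s.re| ≤ τ) (k : ℤ) (φ : 𝓢(ℂ, ℂ)) :
    RapidDecay τ fun z => polarPow s k z * φ z := by
  refine ⟨(measurable_polarPow s k).mul φ.continuous.measurable, fun K => ?_⟩
  obtain ⟨m, hm⟩ := exists_nat_ge (2 * τ)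
  obtain ⟨q, hq, h⟩ := exists_norm_schwartz_le (K + m)
  refine ⟨q φ, hq.1 φ, fun z hz => ?_⟩
  have hz0 : 0 < ‖z‖ := norm_pos_iff.2 hz
  have hs' := abs_le.1 hs
  have h1 : ‖z‖ ^ s.re ≤ ‖z‖ ^ (-τ) * (1 + ‖z‖) ^ m := by
    rw [show s.re = -τ + (s.re + τ) by ring, Real.rpow_add hz0]
    gcongr
    calc ‖z‖ ^ (s.re + τ) ≤ (1 + ‖z‖) ^ (s.re + τ) :=
          Real.rpow_le_rpow hz0.le (by linarith) (by linarith)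
      _ ≤ (1 + ‖z‖) ^ (m : ℝ) := Real.rpow_le_rpow_of_exponent_le (by linarith) (by linarith)
      _ = _ := Real.rpow_natCast _ _
  rw [norm_mul, norm_polarPow _ _ hz]
  calc ‖z‖ ^ s.re * ‖φ z‖ ≤ ‖z‖ ^ (-τ) * (1 + ‖z‖) ^ m * (q φ * ((1 + ‖z‖) ^ (K + m))⁻¹) := by
        gcongr
        exact h φ z
    _ = _ := by
        have : (1 + ‖z‖) ≠ 0 := by positivity
        rw [pow_add]
        field_simp

/-- A test function, as a function on the plane. -/
noncomputable def sisFun (ν : ℂ) (p : ℤ) (φ : 𝓢(ℂ, ℂ) × 𝓢(ℂ, ℂ)) (z : ℂ) : ℂ :=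
  polarPow ν p z * φ.1 z + polarPow (-ν) (-p) z * φ.2 z

theorem sisMap_apply (ν : ℂ) (p : ℤ) (φ : 𝓢(ℂ, ℂ) × 𝓢(ℂ, ℂ)) (z : ℂˣ) :
    sisMap ν p φ z = sisFun ν p φ z := rfl

theorem rapidDecay_sisFun {ν : ℂ} {τ : ℝ} (hτ : |ν.re| ≤ τ) (p : ℤ)
    (φ : 𝓢(ℂ, ℂ) × 𝓢(ℂ, ℂ)) : RapidDecay τ (sisFun ν p φ) :=
  (rapidDecay_polarPow_mul hτ p φ.1).add (rapidDecay_polarPow_mul (by simpa using hτ) (-p) φ.2)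

theorem integrable_mul_besselKer {ν : ℂ} (hν : ∀ n : ℤ, ν ≠ n) (hre : |ν.re| < 1) (p : ℤ)
    {τ : ℝ} (hτ : τ < 1) {f : ℂ → ℂ} (hf : RapidDecay τ f) {u : ℂ} (hu : u ≠ 0) :
    Integrable fun z => f z * besselKer ν p (u * z) := by
  obtain ⟨C, hC, h⟩ := exists_norm_besselKer_le hν hre p le_rfl
  have i1 := (hf.integrable_mul_weight hτ (σ := -|ν.re|) (by linarith)).const_mul
    (C * ‖u‖ ^ (-|ν.re|))
  have i2 := (hf.integrable_mul_weight hτ (σ := 5) (by norm_num)).const_mul (C * ‖u‖ ^ (5 : ℝ))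
  refine (i1.add i2).mono' (hf.measurable.mul
    ((measurable_besselKer ν p).comp (measurable_const_mul u))).aestronglyMeasurable
    (ae_ne_zero.mono fun z hz => ?_)
  have hk := h (u * z) (mul_ne_zero hu hz)
  rw [norm_mul u, Real.mul_rpow (norm_nonneg _) (norm_nonneg _),
    Real.mul_rpow (norm_nonneg _) (norm_nonneg _)] at hk
  rw [norm_mul]
  refine (mul_le_mul_of_nonneg_left hk (norm_nonneg _)).trans (le_of_eq ?_)
  simp only [Pi.add_apply]
  ring

theorem integrable_dzdzbar {g : ℂ → ℂ} (hg : Integrable g) :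
    Integrable (fun z : ℂˣ => g z) dzdzbar := by
  have h1 : Integrable g (Measure.map ((↑) : ℂˣ → ℂ)
      (Measure.comap ((↑) : ℂˣ → ℂ) volume)) := by
    rw [measurableEmbedding_val.map_comap]
    exact hg.restrict
  exact ((measurableEmbedding_val.integrable_map_iff).1 h1).smul_measure (by simp)

theorem integrable_hankelIntegrand {ν : ℂ} (hν : ∀ n : ℤ, ν ≠ n) (hre : |ν.re| < 1) (p : ℤ)
    (φ : 𝓢(ℂ, ℂ) × 𝓢(ℂ, ℂ)) (u : ℂˣ) :
    Integrable (hankelIntegrand ν p (sisMap ν p φ) u) dzdzbar := by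
  have h := integrable_dzdzbar (integrable_mul_besselKer hν hre p hre
    (rapidDecay_sisFun le_rfl p φ) u.ne_zero)
  refine h.congr (Eventually.of_forall fun z => ?_)
  simp only [hankelIntegrand, sisMap_apply]
  rw [besselBSqrt_eq_besselKer _ _ (mul_ne_zero u.ne_zero z.ne_zero)]

/-- The Hankel transform of a function on the plane. -/
noncomputable def planeHankel (ν : ℂ) (p : ℤ) (f : ℂ → ℂ) (u : ℂ) : ℂ :=
  4 * Real.pi ^ 2 * ∫ z, f z * besselKer ν p (u * z)

theorem hankel_eq_planeHankel (ν : ℂ) (p : ℤ) (f : ℂ → ℂ) (u : ℂˣ) :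
    hankel ν p (fun z => f z) u = planeHankel ν p f u := by
  have e : ∫ z : ℂˣ, hankelIntegrand ν p (fun z => f z) u z ∂dzdzbar =
      ∫ z : ℂˣ, (fun z : ℂ => f z * besselBSqrt ν p (u * z)) z ∂dzdzbar := rfl
  rw [hankel, e, integral_dzdzbar (fun z : ℂ => f z * besselBSqrt ν p (u * z)), planeHankel]
  have e2 : ∫ z : ℂ, f z * besselBSqrt ν p (u * z) = ∫ z : ℂ, f z * besselKer ν p (u * z) :=
    integral_congr_ae (ae_ne_zero.mono fun z hz => by
      simp only; rw [besselBSqrt_eq_besselKer _ _ (mul_ne_zero u.ne_zero hz)])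
  rw [e2]
  ring

theorem exists_clm_planeHankel_polarPow {ν : ℂ} (hν : ∀ n : ℤ, ν ≠ n) (hre : |ν.re| < 1)
    (p : ℤ) : ∃ A B : 𝓢(ℂ, ℂ) →L[ℂ] 𝓢(ℂ, ℂ), ∀ (φ : 𝓢(ℂ, ℂ)) (u : ℂ), u ≠ 0 →
      planeHankel ν p (fun z => polarPow ν p z * φ z) u =
        polarPow ν p u * A φ u + polarPow (-ν) (-p) u * B φ u := by
  obtain ⟨α, β, h⟩ := exists_clm_kerInt hν hre p
  set c : ℂ := 4 * Real.pi ^ 2 with hc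
  have hc0 : c ≠ 0 := four_pi_sq_ne_zero
  set L : ℂ ≃L[ℝ] ℂ := (ContinuousLinearEquiv.smulLeft (Units.mk0 c hc0) : ℂ ≃L[ℂ] ℂ).restrictScalars ℝ
  set D : 𝓢(ℂ, ℂ) →L[ℂ] 𝓢(ℂ, ℂ) := SchwartzMap.compCLMOfContinuousLinearEquiv ℂ L with hD
  have hDa : ∀ (φ : 𝓢(ℂ, ℂ)) u, D φ u = φ (c * u) := fun φ u => rfl
  set S := Complex.sin (Real.pi * ν)
  refine ⟨(c / S * polarPow ν p c) • D.comp β, (c / S * polarPow (-ν) (-p) c) • D.comp α,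
    fun φ u hu => ?_⟩
  have hcu : c * u ≠ 0 := mul_ne_zero hc0 hu
  have e : ∫ z, polarPow ν p z * φ z * besselKer ν p (u * z) =
      polarPow (-ν) (-p) (c * u) / S * ∫ z, φ z * kerG ν p 0 0 (c * u * z) := by
    rw [← integral_const_mul]
    refine integral_congr_ae (ae_ne_zero.mono fun z hz => ?_)
    have h1 := polarPow_neg ν p hz
    have h2 := polarPow_ne_zero ν p hz
    change _ * (_ / S) = _
    rw [← hc, ← mul_assoc c u z, polarPow_mul _ _ (c * u) z, h1]
    field_simp
  have e2 : polarPow (-ν) (-p) (c * u) * polarPow (2 * ν) (2 * p) (c * u) =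
      polarPow ν p c * polarPow ν p u := by
    rw [← polarPow_add _ _ _ _ hcu, ← polarPow_mul]; congr 1 <;> ring
  rw [planeHankel, e, h φ (c * u) hcu, ← hc]
  simp only [smul_apply, ContinuousLinearMap.comp_apply, smul_eq_mul, hDa]
  linear_combination (c / S * β φ (c * u)) * e2 +
    (c / S * α φ (c * u)) * polarPow_mul (-ν) (-p) c u

theorem besselKer_neg (ν : ℂ) (p : ℤ) {w : ℂ} (hw : w ≠ 0) :
    besselKer (-ν) (-p) w = besselKer ν p w := by
  rw [← besselBSqrt_eq_besselKer _ _ hw, ← besselBSqrt_eq_besselKer _ _ hw, besselBSqrt_neg]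

theorem planeHankel_neg (ν : ℂ) (p : ℤ) (f : ℂ → ℂ) {u : ℂ} (hu : u ≠ 0) :
    planeHankel (-ν) (-p) f u = planeHankel ν p f u := by
  rw [planeHankel, planeHankel]
  congr 1
  exact integral_congr_ae (ae_ne_zero.mono fun z hz => by
    simp only; rw [besselKer_neg _ _ (mul_ne_zero hu hz)])

/-- The Hankel transform lifts to a continuous linear map on pairs of Schwartz functions. -/
theorem exists_clm_planeHankel {ν : ℂ} (hν : ∀ n : ℤ, ν ≠ n) (hre : |ν.re| < 1) (p : ℤ) :
    ∃ T : (𝓢(ℂ, ℂ) × 𝓢(ℂ, ℂ)) →L[ℂ] (𝓢(ℂ, ℂ) × 𝓢(ℂ, ℂ)), ∀ φ (u : ℂ), u ≠ 0 →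
      planeHankel ν p (sisFun ν p φ) u = sisFun ν p (T φ) u := by
  have hν' : ∀ n : ℤ, -ν ≠ n := fun n hn => hν (-n) (by push_cast; rw [← hn, neg_neg])
  obtain ⟨A, B, h⟩ := exists_clm_planeHankel_polarPow hν hre p
  obtain ⟨A', B', h'⟩ := exists_clm_planeHankel_polarPow hν' (by simpa using hre) (-p)
  refine ⟨((A.comp (ContinuousLinearMap.fst ℂ _ _)) +
    B'.comp (ContinuousLinearMap.snd ℂ _ _)).prod ((B.comp (ContinuousLinearMap.fst ℂ _ _)) +
    A'.comp (ContinuousLinearMap.snd ℂ _ _)), fun φ u hu => ?_⟩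
  have i1 := integrable_mul_besselKer hν hre p hre (rapidDecay_polarPow_mul le_rfl p φ.1) hu
  have i2 := integrable_mul_besselKer hν hre p hre
    (rapidDecay_polarPow_mul (s := -ν) (by simp) (-p) φ.2) hu
  have e : planeHankel ν p (sisFun ν p φ) u =
      planeHankel ν p (fun z => polarPow ν p z * φ.1 z) u +
        planeHankel (-ν) (-p) (fun z => polarPow (-ν) (-p) z * φ.2 z) u := by
    rw [planeHankel_neg _ _ _ hu, planeHankel, planeHankel, planeHankel, ← mul_add,
      ← integral_add i1 i2]
    congr 1
    refine integral_congr_ae (Eventually.of_forall fun z => ?_)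
    simp only [sisFun]
    ring
  rw [e, h φ.1 u hu, h' φ.2 u hu, neg_neg, neg_neg]
  simp [sisFun]
  ring

/-! ### Radial integrals -/

theorem measurable_macdonaldKernel (μ : ℂ) :
    Measurable fun q : ℝ × ℝ => macdonaldKernel μ q.1 q.2 := by
  unfold macdonaldKernel
  fun_prop

theorem integrable_cpow_mul_macdonaldKernel {w μ : ℂ} (hw : 0 < w.re) (hwμ : 0 < (w + μ).re) :
    Integrable (fun q : ℝ × ℝ => (q.1 : ℂ) ^ (w - 1) * macdonaldKernel μ q.1 q.2)
      ((volume.restrict (Ioi 0)).prod (volume.restrict (Ioi 0))) := by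
  have hm : Measurable fun q : ℝ × ℝ => (q.1 : ℂ) ^ (w - 1) * macdonaldKernel μ q.1 q.2 := by
    refine Measurable.mul ?_ (measurable_macdonaldKernel μ)
    fun_prop
  have hn : ∀ t y : ℝ, 0 < t → 0 < y → ‖(t : ℂ) ^ (w - 1) * macdonaldKernel μ t y‖ =
      Real.exp (-y) * y ^ (μ.re - 1) * (t ^ (w.re - 1) * Real.exp (-(1 / y * t))) := by
    intro t y ht hy
    rw [norm_mul, norm_macdonaldKernel μ t hy, Complex.norm_cpow_eq_rpow_re_of_pos ht,
      Complex.sub_re, Complex.one_re, show t / y = 1 / y * t by ring]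
    ring
  have hG : ∀ y : ℝ, 0 < y →
      IntegrableOn (fun t : ℝ => t ^ (w.re - 1) * Real.exp (-(1 / y * t))) (Ioi 0) := by
    intro y hy
    by_contra hni
    have h1 := Real.integral_rpow_mul_exp_neg_mul_Ioi hw (one_div_pos.2 hy)
    rw [integral_undef hni] at h1
    have : 0 < (1 / (1 / y)) ^ w.re * Real.Gamma w.re :=
      mul_pos (by positivity) (Real.Gamma_pos_of_pos hw)
    linarith
  rw [integrable_prod_iff' hm.aestronglyMeasurable]
  constructor
  · filter_upwards [ae_restrict_mem measurableSet_Ioi] with y hy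
    refine ((hG y hy).const_mul (Real.exp (-y) * y ^ (μ.re - 1))).mono'
      (hm.comp measurable_prodMk_right).aestronglyMeasurable ?_
    filter_upwards [ae_restrict_mem measurableSet_Ioi] with t ht
    exact (hn t y ht hy).le
  · have h1 := (Real.GammaIntegral_convergent hwμ).mul_const (Real.Gamma w.re)
    refine h1.congr ?_
    filter_upwards [ae_restrict_mem measurableSet_Ioi] with y hy
    have hy0 : 0 < y := hy
    rw [setIntegral_congr_fun measurableSet_Ioi fun t ht => hn t y ht hy, integral_const_mul,
      Real.integral_rpow_mul_exp_neg_mul_Ioi hw (one_div_pos.2 hy0), one_div_one_div,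
      Complex.add_re, show w.re + μ.re - 1 = μ.re - 1 + w.re by ring, Real.rpow_add hy0]
    ring

/-- The Mellin transform of the Macdonald function. -/
theorem integral_cpow_mul_macdonald {w μ : ℂ} (hw : 0 < w.re) (hwμ : 0 < (w + μ).re) :
    ∫ t in Ioi (0 : ℝ), (t : ℂ) ^ (w - 1) * macdonald μ t =
      Complex.Gamma w * Complex.Gamma (w + μ) := by
  have h1 : ∀ t : ℝ, (t : ℂ) ^ (w - 1) * macdonald μ t =
      ∫ y in Ioi (0 : ℝ), (t : ℂ) ^ (w - 1) * macdonaldKernel μ t y := fun t => by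
    rw [integral_const_mul, macdonald]
  simp only [h1]
  rw [integral_integral_swap (integrable_cpow_mul_macdonaldKernel hw hwμ),
    Complex.Gamma_eq_integral hwμ, Complex.GammaIntegral, ← integral_const_mul]
  refine setIntegral_congr_fun measurableSet_Ioi fun y hy => ?_
  have hy0 : 0 < y := hy
  have hyc : (y : ℂ) ≠ 0 := by exact_mod_cast hy0.ne'
  have h2 : ∀ t : ℝ, (t : ℂ) ^ (w - 1) * macdonaldKernel μ t y =
      (Real.exp (-y) : ℂ) * (y : ℂ) ^ (μ - 1) *
        ((t : ℂ) ^ (w - 1) * Complex.exp (-(((1 / y : ℝ) : ℂ) * t))) := by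
    intro t
    rw [macdonaldKernel, show -y - t / y = -y + -(1 / y * t) by ring, Real.exp_add]
    push_cast
    ring
  simp only [h2]
  rw [integral_const_mul, Complex.integral_cpow_mul_exp_neg_mul_Ioi hw (one_div_pos.2 hy0)]
  push_cast
  rw [one_div_one_div, show w + μ - 1 = μ - 1 + w by ring, Complex.cpow_add _ _ hyc]
  ring

theorem polarPow_circle_mul (s : ℂ) (k : ℤ) (ω : Circle) (z : ℂ) :
    polarPow s k (ω * z) = (ω : ℂ) ^ k * polarPow s k z := by
  rw [polarPow_mul]
  congr 1
  rw [polarPow, Circle.norm_coe]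
  simp

theorem integral_comp_circle_mul (f : ℂ → ℂ) (ω : Circle) :
    ∫ z : ℂ, f (ω * z) = ∫ z, f z :=
  (rotation ω).measurePreserving.integral_comp (rotation ω).toHomeomorph.measurableEmbedding f

theorem integral_polarPow_mul_eq_zero (s : ℂ) {k : ℤ} (hk : k ≠ 0) (h : ℝ → ℂ) :
    ∫ z : ℂ, polarPow s k z * h ‖z‖ = 0 := by
  have hk' : (k : ℝ) ≠ 0 := by exact_mod_cast hk
  set ω : Circle := Circle.exp (Real.pi / k)
  have hω : (ω : ℂ) ^ k = -1 := by
    rw [Circle.coe_exp, ← Complex.exp_int_mul, ← Complex.exp_pi_mul_I]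
    congr 1
    push_cast
    have : (k : ℂ) ≠ 0 := by exact_mod_cast hk
    field_simp
  have h1 := integral_comp_circle_mul (fun z => polarPow s k z * h ‖z‖) ω
  simp only [polarPow_circle_mul, hω, norm_mul, Circle.norm_coe, one_mul] at h1
  have h2 : ∫ z : ℂ, -1 * polarPow s k z * h ‖z‖ = -∫ z : ℂ, polarPow s k z * h ‖z‖ := by
    rw [← integral_neg]; congr 1; funext z; ring
  rw [h2] at h1
  linear_combination (-1 / 2 : ℂ) * h1

theorem integral_norm_eq (g : ℝ → ℂ) :
    ∫ z : ℂ, g ‖z‖ = 2 * Real.pi * ∫ r in Ioi (0 : ℝ), r * g r := by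
  rw [integral_fun_norm_addHaar]
  have : (volume : Measure ℂ).real (Metric.ball 0 1) = Real.pi := by
    simp [Measure.real, Complex.volume_ball]
  rw [this]
  simp only [Complex.finrank_real_complex, nsmul_eq_mul, Complex.real_smul]
  norm_num
  ring

theorem integral_polarPow_zero_mul (s : ℂ) (h : ℝ → ℂ) :
    ∫ z : ℂ, polarPow s 0 z * h (‖z‖ ^ 2) =
      Real.pi * ∫ t in Ioi (0 : ℝ), (t : ℂ) ^ (s / 2) * h t := by
  have h1 : ∀ z : ℂ, polarPow s 0 z * h (‖z‖ ^ 2) =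
      (fun r : ℝ => (r : ℂ) ^ s * h (r ^ 2)) ‖z‖ := fun z => by simp [polarPow]
  rw [integral_congr_ae (Eventually.of_forall h1),
    integral_norm_eq (fun r : ℝ => (r : ℂ) ^ s * h (r ^ 2)), ←
    integral_comp_rpow_Ioi_of_pos (g := fun t : ℝ => (t : ℂ) ^ (s / 2) * h t) (p := 2) two_pos,
    mul_comm (2 : ℂ),
    mul_assoc, ← integral_const_mul]
  congr 1
  refine setIntegral_congr_fun measurableSet_Ioi fun r hr => ?_
  have hr0 : 0 < r := hr
  have e : ((r ^ 2 : ℝ) : ℂ) ^ (s / 2) = (r : ℂ) ^ s := by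
    rw [Complex.cpow_def_of_ne_zero (by exact_mod_cast (pow_pos hr0 2).ne'),
      Complex.cpow_def_of_ne_zero (by exact_mod_cast hr0.ne'),
      ← Complex.ofReal_log (by positivity), ← Complex.ofReal_log hr0.le, Real.log_pow]
    congr 1
    push_cast
    ring
  simp only [Real.rpow_two, e, Complex.real_smul]
  norm_num
  ring

theorem exists_norm_macdonald_sq_le_mul {μ : ℂ} {a : ℝ} (ha : 0 ≤ a) (haμ : 0 < a + μ.re) :
    ∃ C, 0 ≤ C ∧ ∀ r : ℝ, 0 < r →
      ‖macdonald μ (r ^ 2)‖ ≤ C * (r ^ (-(2 * a)) * Real.exp (-r)) := by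
  obtain ⟨C₁, hC₁, h₁⟩ := exists_integral_exp_mul_rpow_le ha haμ
  obtain ⟨C₂, hC₂, h₂⟩ := exists_norm_macdonald_sq_le μ
  obtain ⟨C₃, hC₃, h₃⟩ := exists_rpow_le_exp (a := |μ.re| + 2 * a) (by positivity)
  refine ⟨C₁ * Real.exp 1 + C₂ * C₃, by positivity, fun r hr => ?_⟩
  have p1 : 0 ≤ r ^ (-(2 * a)) * Real.exp (-r) := by positivity
  rw [add_mul]
  rcases le_total r 1 with h | h
  · refine le_add_of_le_of_nonneg ?_ (by positivity)
    refine (norm_macdonald_le μ _).trans ((h₁ _ (by positivity)).trans ?_)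
    have e : (r ^ 2) ^ (-a) = r ^ (-(2 * a)) := by
      rw [← Real.rpow_natCast, ← Real.rpow_mul hr.le]; congr 1; push_cast; ring
    have e2 : 1 ≤ Real.exp 1 * Real.exp (-r) := by
      rw [← Real.exp_add]; exact Real.one_le_exp (by linarith)
    rw [e]
    calc C₁ * r ^ (-(2 * a)) ≤ C₁ * r ^ (-(2 * a)) * (Real.exp 1 * Real.exp (-r)) :=
          le_mul_of_one_le_right (by positivity) e2
      _ = _ := by ring
  · refine le_add_of_nonneg_of_le (by positivity) ((h₂ r h).trans ?_)
    have e1 : r ^ μ.re ≤ C₃ * Real.exp r * r ^ (-(2 * a)) := by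
      calc r ^ μ.re ≤ r ^ (|μ.re|) := Real.rpow_le_rpow_of_exponent_le h (le_abs_self _)
        _ = r ^ (|μ.re| + 2 * a) * r ^ (-(2 * a)) := by
            rw [← Real.rpow_add hr]; congr 1; ring
        _ ≤ _ := by
            gcongr
            exact h₃ r hr
    have e2 : Real.exp r * Real.exp (-2 * r) = Real.exp (-r) := by
      rw [← Real.exp_add]; congr 1; ring
    calc C₂ * r ^ μ.re * Real.exp (-2 * r)
        ≤ C₂ * (C₃ * Real.exp r * r ^ (-(2 * a))) * Real.exp (-2 * r) := by gcongr
      _ = _ := by rw [← e2]; ring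

/-! ### A family of functions that is preserved by the Hankel transform -/

/-- The function `e^{imθ} r^{-ν+|m+p|} M_λ(r²)`, where `M_λ(t) = 2 t^{λ/2} K_λ(2√t)` and
`λ = ν + (|m-p| - |m+p|) / 2`. -/
noncomputable def besselTest (ν : ℂ) (p m : ℤ) (z : ℂ) : ℂ :=
  polarPow (-ν + (m + p).natAbs) m z *
    macdonald (ν + (m - p).natAbs - (max m.natAbs p.natAbs : ℕ)) (‖z‖ ^ 2)

theorem natAbs_add_add_natAbs_sub (m p : ℤ) :
    (m + p).natAbs + (m - p).natAbs = 2 * max m.natAbs p.natAbs := by omega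

theorem measurable_macdonald (μ : ℂ) : Measurable (macdonald μ) := by
  have h := (measurable_macdonaldKernel μ).stronglyMeasurable.integral_prod_right'
    (ν := volume.restrict (Ioi (0 : ℝ)))
  exact h.measurable

theorem measurable_besselTest (ν : ℂ) (p m : ℤ) : Measurable (besselTest ν p m) :=
  (measurable_polarPow _ _).mul ((measurable_macdonald _).comp (by fun_prop))

theorem exists_norm_besselTest_le {ν : ℂ} (p m : ℤ) {τ : ℝ} (hτ : |ν.re| < τ) :
    ∃ C, 0 ≤ C ∧ ∀ z : ℂ, z ≠ 0 →
      ‖besselTest ν p m z‖ ≤ C * (‖z‖ ^ (-τ) * Real.exp (-‖z‖)) := by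
  have h1 := abs_lt.1 hτ
  have hN : ((m + p).natAbs : ℝ) + (m - p).natAbs = 2 * (max m.natAbs p.natAbs : ℕ) := by
    exact_mod_cast natAbs_add_add_natAbs_sub m p
  set A : ℕ := (m + p).natAbs with hA
  set D : ℕ := (m - p).natAbs
  set N : ℕ := max m.natAbs p.natAbs
  have hA0 : (0 : ℝ) ≤ A := Nat.cast_nonneg _
  have hD0 : (0 : ℝ) ≤ D := Nat.cast_nonneg _
  obtain ⟨C, hC, h⟩ := exists_norm_macdonald_sq_le_mul (μ := ν + D - N) (a := (τ - ν.re + A) / 2)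
    (by linarith) (by simp; linarith)
  refine ⟨C, hC, fun z hz => ?_⟩
  have hz0 : 0 < ‖z‖ := norm_pos_iff.2 hz
  have e : ‖z‖ ^ (-ν + A : ℂ).re * ‖z‖ ^ (-(2 * ((τ - ν.re + A) / 2))) = ‖z‖ ^ (-τ) := by
    rw [← Real.rpow_add hz0]; congr 1; simp; ring
  rw [besselTest, norm_mul, norm_polarPow _ _ hz, ← e]
  refine (mul_le_mul_of_nonneg_left (h ‖z‖ hz0) (by positivity)).trans (le_of_eq ?_)
  ring

theorem exists_exp_neg_le (K : ℕ) {c : ℝ} (hc : 0 < c) :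
    ∃ C, 0 ≤ C ∧ ∀ r : ℝ, 0 ≤ r → Real.exp (-(c * r)) ≤ C * ((1 + r) ^ K)⁻¹ := by
  obtain ⟨C, hC, h⟩ := exists_rpow_le_exp (a := K) (Nat.cast_nonneg K)
  refine ⟨C * Real.exp c / c ^ K, by positivity, fun r hr => ?_⟩
  have h1 := h (c * (1 + r)) (by positivity)
  rw [Real.rpow_natCast, mul_pow, mul_add, mul_one, Real.exp_add] at h1
  have h2 : Real.exp (c * r) * Real.exp (-(c * r)) = 1 := by rw [← Real.exp_add]; simp
  rw [← div_eq_mul_inv, le_div_iff₀ (by positivity), le_div_iff₀ (by positivity)]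
  calc Real.exp (-(c * r)) * (1 + r) ^ K * c ^ K
      = Real.exp (-(c * r)) * (c ^ K * (1 + r) ^ K) := by ring
    _ ≤ Real.exp (-(c * r)) * (C * (Real.exp c * Real.exp (c * r))) := by gcongr
    _ = C * Real.exp c := by linear_combination (C * Real.exp c) * h2

theorem rapidDecay_besselTest {ν : ℂ} (p m : ℤ) {τ : ℝ} (hτ : |ν.re| < τ) :
    RapidDecay τ (besselTest ν p m) := by
  refine ⟨measurable_besselTest ν p m, fun K => ?_⟩
  obtain ⟨C, hC, h⟩ := exists_norm_besselTest_le p m hτ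
  obtain ⟨D, hD, k⟩ := exists_exp_neg_le K one_pos
  refine ⟨C * D, by positivity, fun z hz => (h z hz).trans ?_⟩
  have := k ‖z‖ (norm_nonneg z)
  rw [one_mul] at this
  calc _ ≤ C * (‖z‖ ^ (-τ) * (D * ((1 + ‖z‖) ^ K)⁻¹)) := by gcongr
    _ = _ := by ring

theorem RapidDecay.comp_mul {τ : ℝ} {f : ℂ → ℂ} (hf : RapidDecay τ f) {s : ℝ} (hs : 0 < s) :
    RapidDecay τ fun z => f (s * z) := by
  refine ⟨hf.measurable.comp (measurable_const_mul _), fun K => ?_⟩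
  obtain ⟨C, hC, h⟩ := hf.bound K
  refine ⟨C * (s ^ (-τ) * (min 1 s ^ K)⁻¹), by positivity, fun z hz => ?_⟩
  have hsz : (s : ℂ) * z ≠ 0 := mul_ne_zero (by exact_mod_cast hs.ne') hz
  refine (h _ hsz).trans ?_
  rw [norm_mul, Complex.norm_real, Real.norm_of_nonneg hs.le, Real.mul_rpow hs.le (norm_nonneg z)]
  have hmin : 0 < min 1 s := lt_min one_pos hs
  have e : min 1 s * (1 + ‖z‖) ≤ 1 + s * ‖z‖ := by
    have := mul_le_mul_of_nonneg_right (min_le_right 1 s) (norm_nonneg z)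
    linarith [min_le_left 1 s]
  have e2 : ((1 + s * ‖z‖) ^ K)⁻¹ ≤ (min 1 s ^ K)⁻¹ * ((1 + ‖z‖) ^ K)⁻¹ := by
    rw [← mul_inv, ← mul_pow]
    gcongr
  calc C * (s ^ (-τ) * ‖z‖ ^ (-τ) * ((1 + s * ‖z‖) ^ K)⁻¹)
      ≤ C * (s ^ (-τ) * ‖z‖ ^ (-τ) * ((min 1 s ^ K)⁻¹ * ((1 + ‖z‖) ^ K)⁻¹)) := by gcongr
    _ = _ := by ring

theorem besselTest_neg (ν : ℂ) (p m : ℤ) {z : ℂ} (hz : z ≠ 0) :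
    besselTest (-ν) (-p) m z = besselTest ν p m z := by
  have hz0 : 0 < ‖z‖ := norm_pos_iff.2 hz
  have hN : ((m + p).natAbs : ℂ) + (m - p).natAbs = 2 * (max m.natAbs p.natAbs : ℕ) := by
    exact_mod_cast natAbs_add_add_natAbs_sub m p
  rw [besselTest, besselTest, show m + -p = m - p by ring, show m - -p = m + p by ring,
    Int.natAbs_neg]
  set A : ℕ := (m + p).natAbs
  set D : ℕ := (m - p).natAbs
  set N : ℕ := max m.natAbs p.natAbs
  have e : -ν + A - N = -(ν + D - N) := by linear_combination hN
  have hsq : ((‖z‖ ^ 2 : ℝ) : ℂ) ^ (-(ν + D - N)) = polarPow (-(2 * (ν + D - N))) 0 z := by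
    rw [polarPow, zpow_zero, mul_one,
      Complex.cpow_def_of_ne_zero (by exact_mod_cast (pow_pos hz0 2).ne'),
      Complex.cpow_def_of_ne_zero (by exact_mod_cast hz0.ne'),
      ← Complex.ofReal_log (by positivity), ← Complex.ofReal_log hz0.le, Real.log_pow]
    congr 1
    push_cast
    ring
  rw [e, macdonald_neg _ (pow_pos hz0 2), hsq, ← mul_assoc, ← polarPow_add _ _ _ _ hz, add_zero]
  congr 2
  linear_combination -hN

/-! ### The Hankel transform of the test functions -/

theorem exists_norm_besselEnt_term_le_mul (μ : ℂ) {δ : ℝ} (hδ : 0 < δ) :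
    ∃ C, 0 ≤ C ∧ ∀ (n : ℕ) (x : ℂ), ‖(-x) ^ n / (n.factorial * Complex.Gamma (μ + n + 1))‖ ≤
      C * ((δ * ‖x‖) ^ n / n.factorial) := by
  obtain ⟨C, hC, h⟩ := exists_inv_Gamma_add_nat_mul_pow_le μ (inv_nonneg.2 hδ.le)
  refine ⟨C, hC, fun n x => ?_⟩
  rw [div_eq_mul_inv, mul_inv, norm_mul, norm_mul, norm_pow, norm_neg, norm_inv,
    Complex.norm_natCast]
  have e : (δ⁻¹) ^ n * δ ^ n = 1 := by rw [← mul_pow, inv_mul_cancel₀ hδ.ne', one_pow]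
  calc ‖x‖ ^ n * ((n.factorial : ℝ)⁻¹ * ‖(Complex.Gamma (μ + n + 1))⁻¹‖)
      = (‖(Complex.Gamma (μ + n + 1))⁻¹‖ * δ⁻¹ ^ n) * ((δ * ‖x‖) ^ n / n.factorial) := by
        rw [mul_pow]
        linear_combination (-(‖x‖ ^ n * (n.factorial : ℝ)⁻¹ *
          ‖(Complex.Gamma (μ + n + 1))⁻¹‖)) * e
    _ ≤ _ := by gcongr; exact h n

/-- The weight in the integral of a test function against the regular part of the kernel. -/
noncomputable def testWeight (ν : ℂ) (p m : ℤ) (u z : ℂ) : ℂ :=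
  besselTest ν p m z * polarPow (-ν) (-p) (u * z)

theorem integrable_testWeight_mul_exp {ν : ℂ} (hre : |ν.re| < 1) (p m : ℤ) {u : ℂ} (hu : u ≠ 0) :
    Integrable fun z => ‖testWeight ν p m u z‖ * Real.exp (‖z‖ / 4 + ‖z‖ / 4) := by
  obtain ⟨τ, hτ, hτ1⟩ := exists_between hre
  have h1 := abs_lt.1 hτ
  obtain ⟨C, hC, h⟩ := exists_norm_besselTest_le p m hτ
  obtain ⟨K, hK⟩ := exists_nat_weight (σ := -τ - ν.re) (by linarith)
  obtain ⟨D, hD, k⟩ := exists_exp_neg_le K (c := 1 / 2) (by norm_num)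
  have hm : Measurable (testWeight ν p m u) :=
    (measurable_besselTest ν p m).mul ((measurable_polarPow _ _).comp (measurable_const_mul u))
  refine (hK.const_mul (C * ‖u‖ ^ (-ν.re) * D)).mono' (by fun_prop)
    (ae_ne_zero.mono fun z hz => ?_)
  have hz0 : 0 < ‖z‖ := norm_pos_iff.2 hz
  rw [Real.norm_of_nonneg (by positivity), testWeight, norm_mul,
    norm_polarPow _ _ (mul_ne_zero hu hz), norm_mul, Complex.neg_re,
    Real.mul_rpow (norm_nonneg _) (norm_nonneg _)]
  have e1 : ‖z‖ ^ (-τ - ν.re) = ‖z‖ ^ (-τ) * ‖z‖ ^ (-ν.re) := by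
    rw [← Real.rpow_add hz0]; congr 1
  have e2 : Real.exp (-‖z‖) * Real.exp (‖z‖ / 4 + ‖z‖ / 4) = Real.exp (-(1 / 2 * ‖z‖)) := by
    rw [← Real.exp_add]; congr 1; ring
  calc ‖besselTest ν p m z‖ * (‖u‖ ^ (-ν.re) * ‖z‖ ^ (-ν.re)) * Real.exp (‖z‖ / 4 + ‖z‖ / 4)
      ≤ C * (‖z‖ ^ (-τ) * Real.exp (-‖z‖)) * (‖u‖ ^ (-ν.re) * ‖z‖ ^ (-ν.re)) *
        Real.exp (‖z‖ / 4 + ‖z‖ / 4) := by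
        gcongr
        exact h z hz
    _ = C * ‖u‖ ^ (-ν.re) * ‖z‖ ^ (-τ - ν.re) * Real.exp (-(1 / 2 * ‖z‖)) := by
        rw [e1, ← e2]; ring
    _ ≤ C * ‖u‖ ^ (-ν.re) * ‖z‖ ^ (-τ - ν.re) * (D * ((1 + ‖z‖) ^ K)⁻¹) := by
        gcongr
        exact k _ (norm_nonneg z)
    _ = _ := by ring

/-- The terms of the expansion of the regular part of the kernel. -/
noncomputable def besselTerm (ν : ℂ) (p : ℤ) (q : ℕ × ℕ) (x : ℂ) : ℂ :=
  (-x) ^ q.1 / (q.1.factorial * Complex.Gamma (-(ν + p) + q.1 + 1)) *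
    ((-conj x) ^ q.2 / (q.2.factorial * Complex.Gamma (-(ν - p) + q.2 + 1)))

theorem hasSum_besselTerm (ν : ℂ) (p : ℤ) (x : ℂ) :
    HasSum (fun q => besselTerm ν p q x)
      (besselEnt (-(ν + p)) x * besselEnt (-(ν - p)) (conj x)) := by
  have h1 := hasSum_besselEnt (-(ν + p)) x
  have h2 := hasSum_besselEnt (-(ν - p)) (conj x)
  have h3 := summable_mul_of_summable_norm (summable_norm_besselEnt (-(ν + p)) x)
    (summable_norm_besselEnt (-(ν - p)) (conj x))
  have h4 := HasSum.mul h1 h2 h3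
  unfold besselTerm
  exact h4

theorem hasSum_integral_testWeight {ν : ℂ} (hre : |ν.re| < 1) (p m : ℤ) {u : ℂ} (hu : u ≠ 0) :
    HasSum (fun q => ∫ z, testWeight ν p m u z * besselTerm ν p q (u * z))
      (∫ z, testWeight ν p m u z *
        (besselEnt (-(ν + p)) (u * z) * besselEnt (-(ν - p)) (conj (u * z)))) ∧
    Integrable fun z => testWeight ν p m u z *
        (besselEnt (-(ν + p)) (u * z) * besselEnt (-(ν - p)) (conj (u * z))) := by
  have hu0 : 0 < ‖u‖ := norm_pos_iff.2 hu
  obtain ⟨C₁, hC₁, h₁⟩ := exists_norm_besselEnt_term_le_mul (-(ν + p)) (δ := (4 * ‖u‖)⁻¹)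
    (by positivity)
  obtain ⟨C₂, hC₂, h₂⟩ := exists_norm_besselEnt_term_le_mul (-(ν - p)) (δ := (4 * ‖u‖)⁻¹)
    (by positivity)
  have hδ : ∀ z : ℂ, (4 * ‖u‖)⁻¹ * ‖u * z‖ = ‖z‖ / 4 := fun z => by
    rw [norm_mul]; field_simp
  set b : ℕ × ℕ → ℂ → ℝ := fun q z => ‖testWeight ν p m u z‖ * (C₁ * C₂) *
    ((‖z‖ / 4) ^ q.1 / q.1.factorial * ((‖z‖ / 4) ^ q.2 / q.2.factorial)) with hb
  have hexp : ∀ r : ℝ, HasSum (fun n : ℕ => r ^ n / n.factorial) (Real.exp r) := fun r => by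
    rw [Real.exp_eq_exp_ℝ]; exact NormedSpace.expSeries_div_hasSum_exp r
  have hsum : ∀ z, HasSum (fun q => b q z)
      (‖testWeight ν p m u z‖ * (C₁ * C₂) * (Real.exp (‖z‖ / 4) * Real.exp (‖z‖ / 4))) := by
    intro z
    have h1 := hexp (‖z‖ / 4)
    have h2 : Summable fun q : ℕ × ℕ => (‖z‖ / 4) ^ q.1 / q.1.factorial *
        ((‖z‖ / 4) ^ q.2 / q.2.factorial) :=
      Summable.mul_of_nonneg h1.summable h1.summable (fun n => by positivity)
        (fun n => by positivity)
    have h3 := HasSum.mul h1 h1 h2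
    exact h3.mul_left _
  have hbound : ∀ q z, ‖testWeight ν p m u z * besselTerm ν p q (u * z)‖ ≤ b q z := by
    intro q z
    have e1 := h₁ q.1 (u * z)
    have e2 := h₂ q.2 (conj (u * z))
    rw [hδ] at e1
    rw [Complex.norm_conj, hδ] at e2
    rw [besselTerm, norm_mul, norm_mul (_ / _)]
    calc _ ≤ ‖testWeight ν p m u z‖ * (C₁ * ((‖z‖ / 4) ^ q.1 / q.1.factorial) *
          (C₂ * ((‖z‖ / 4) ^ q.2 / q.2.factorial))) := by gcongr
      _ = _ := by rw [hb]; ring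
  have hW : Measurable (testWeight ν p m u) :=
    (measurable_besselTest ν p m).mul ((measurable_polarPow _ _).comp (measurable_const_mul u))
  have hmul : Measurable fun z : ℂ => u * z := measurable_const_mul u
  have hconj : Measurable fun z : ℂ => conj (u * z) :=
    Complex.continuous_conj.measurable.comp hmul
  have hint : Integrable fun z => ∑' q, b q z := by
    refine ((integrable_testWeight_mul_exp hre p m hu).const_mul (C₁ * C₂)).congr
      (Eventually.of_forall fun z => ?_)
    simp only [(hsum z).tsum_eq, Real.exp_add]
    ring
  have hlim : ∀ z, HasSum (fun q => testWeight ν p m u z * besselTerm ν p q (u * z))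
      (testWeight ν p m u z *
        (besselEnt (-(ν + p)) (u * z) * besselEnt (-(ν - p)) (conj (u * z)))) := fun z =>
    (hasSum_besselTerm ν p (u * z)).mul_left _
  refine ⟨hasSum_integral_of_dominated_convergence b (fun q => ?_)
    (fun q => Eventually.of_forall (hbound q)) (Eventually.of_forall fun z => (hsum z).summable)
    hint (Eventually.of_forall hlim), hint.mono' ?_ (Eventually.of_forall fun z => ?_)⟩
  · refine (hW.mul (Measurable.mul ?_ ?_)).aestronglyMeasurable
    · exact (hmul.neg.pow_const _).div_const _
    · exact (hconj.neg.pow_const _).div_const _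
  · exact (hW.mul (((continuous_besselEnt _).measurable.comp hmul).mul
      ((continuous_besselEnt _).measurable.comp hconj))).aestronglyMeasurable
  · rw [← (hlim z).tsum_eq]
    exact tsum_of_norm_bounded (hsum z).summable.hasSum fun q => hbound q z

theorem pow_mul_conj_pow_eq (j k : ℕ) {z : ℂ} (hz : z ≠ 0) :
    z ^ j * conj z ^ k = polarPow (j + k) (j - k) z := by
  have hn : ((‖z‖ : ℝ) : ℂ) ≠ 0 := by simpa using hz
  have hc : conj z ≠ 0 := (map_ne_zero _).2 hz
  have h1 : conj z = ((‖z‖ : ℝ) : ℂ) ^ 2 / z := by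
    rw [eq_div_iff hz, Complex.conj_mul']
  rw [polarPow, show (j + k : ℂ) = ((j + k : ℕ) : ℂ) by push_cast; rfl, Complex.cpow_natCast,
    zpow_sub₀ (div_ne_zero hz hn), zpow_natCast, zpow_natCast, h1, div_pow, div_pow, div_pow,
    pow_add]
  field_simp
  ring

theorem integral_testWeight_mul_besselTerm (ν : ℂ) (p m : ℤ) (u : ℂ) (q : ℕ × ℕ) :
    ∫ z, testWeight ν p m u z * besselTerm ν p q (u * z) =
      polarPow (-ν) (-p) u * besselTerm ν p q u *
        ∫ z : ℂ, polarPow (-ν + (m + p).natAbs + -ν + (q.1 + q.2)) (m + -p + (q.1 - q.2)) z *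
          macdonald (ν + (m - p).natAbs - (max m.natAbs p.natAbs : ℕ)) (‖z‖ ^ 2) := by
  rw [← integral_const_mul]
  refine integral_congr_ae (ae_ne_zero.mono fun z hz => ?_)
  have e : besselTerm ν p q (u * z) = besselTerm ν p q u * (z ^ q.1 * conj z ^ q.2) := by
    rw [besselTerm, besselTerm, map_mul, neg_mul_eq_neg_mul, neg_mul_eq_neg_mul, mul_pow, mul_pow]
    ring
  simp only [testWeight, besselTest]
  rw [e, pow_mul_conj_pow_eq _ _ hz, polarPow_mul, polarPow_add _ _ _ _ hz,
    polarPow_add _ _ _ _ hz]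
  ring

theorem sin_add_int_mul_pi (x : ℂ) (n : ℤ) :
    Complex.sin (x + n * Real.pi) = (-1) ^ n * Complex.sin x := by
  have h := Complex.sin_antiperiodic.add_zsmul_eq (x := x) n
  rw [zsmul_eq_mul] at h
  rw [h, zsmul_eq_mul, Int.cast_negOnePow]

theorem integral_testWeight_mul_besselTerm_eq_zero (ν : ℂ) (p m : ℤ) (u : ℂ) {q : ℕ × ℕ}
    (hq : m + -p + ((q.1 : ℤ) - q.2) ≠ 0) :
    ∫ z, testWeight ν p m u z * besselTerm ν p q (u * z) = 0 := by
  rw [integral_testWeight_mul_besselTerm, integral_polarPow_mul_eq_zero _ hq fun r =>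
    macdonald (ν + (m - p).natAbs - (max m.natAbs p.natAbs : ℕ)) (r ^ 2), mul_zero]

theorem integral_testWeight_mul_besselTerm_eq {ν : ℂ} (hν : ∀ n : ℤ, ν ≠ n) (hre : |ν.re| < 1)
    (p m : ℤ) {u : ℂ} (hu : u ≠ 0) (i : ℕ) :
    ∫ z, testWeight ν p m u z * besselTerm ν p (i + (p - m).toNat, i + (m - p).toNat) (u * z) =
      Real.pi * (-1) ^ (m - p).natAbs * polarPow (-ν + (m - p).natAbs) (-m) u *
        ((-(-((‖u‖ : ℂ) ^ 2))) ^ i / (i.factorial *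
          Complex.Gamma (-(ν + (m + p).natAbs - (max m.natAbs p.natAbs : ℕ)) + i + 1))) := by
  have hre' := abs_lt.1 hre
  have hN : ((m + p).natAbs : ℂ) + (m - p).natAbs = 2 * (max m.natAbs p.natAbs : ℕ) := by
    exact_mod_cast natAbs_add_add_natAbs_sub m p
  obtain ⟨j, hj⟩ : ∃ j, j = i + (p - m).toNat := ⟨_, rfl⟩
  obtain ⟨k, hk⟩ : ∃ k, k = i + (m - p).toNat := ⟨_, rfl⟩
  have hjk : (j : ℤ) - k = p - m := by omega
  have hjk' : j + k = 2 * i + (m - p).natAbs := by omega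
  have hfac : (j.factorial : ℂ) * k.factorial = i.factorial * (i + (m - p).natAbs).factorial := by
    rcases le_total p m with h | h
    · rw [show j = i by omega, show k = i + (m - p).natAbs by omega]
    · rw [show j = i + (m - p).natAbs by omega, show k = i by omega, mul_comm]
  have hG : ((j : ℤ) - p = i + max m.natAbs p.natAbs ∧
      (k : ℤ) + p = i + (m - p).natAbs - max m.natAbs p.natAbs) ∨
      ((j : ℤ) - p = i + (m - p).natAbs - max m.natAbs p.natAbs ∧
      (k : ℤ) + p = i + max m.natAbs p.natAbs) := by omega
  rw [integral_testWeight_mul_besselTerm, ← hj, ← hk]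
  set A : ℕ := (m + p).natAbs
  set D : ℕ := (m - p).natAbs
  set N : ℕ := max m.natAbs p.natAbs
  have hkD : ((j : ℂ) + k) = 2 * i + D := by exact_mod_cast hjk'
  set w : ℂ := -ν + N + i + 1 with hw
  have hwre : 0 < w.re := by
    simp only [hw, Complex.add_re, Complex.neg_re, Complex.natCast_re, Complex.one_re]
    have : (0 : ℝ) ≤ N + i := by positivity
    linarith
  have hwl : w + (ν + D - N) = ((i + D : ℕ) : ℂ) + 1 := by rw [hw]; push_cast; ring
  have hwl' : 0 < (w + (ν + D - N)).re := by
    rw [hwl]; simp only [Complex.add_re, Complex.natCast_re, Complex.one_re]; positivity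
  have hw0 : Complex.Gamma w ≠ 0 := Complex.Gamma_ne_zero_of_re_pos hwre
  have hGG : Complex.Gamma (-(ν + p) + j + 1) * Complex.Gamma (-(ν - p) + k + 1) =
      Complex.Gamma w * Complex.Gamma (-(ν + A - N) + i + 1) := by
    have e3 : -(ν + A - N) + i + 1 = -ν + D - N + i + 1 := by linear_combination -hN
    rw [e3]
    rcases hG with ⟨h1, h2⟩ | ⟨h1, h2⟩
    · have h1' : (j : ℂ) - p = i + N := by exact_mod_cast h1
      have h2' : (k : ℂ) + p = i + D - N := by exact_mod_cast h2
      congr 2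
      · rw [hw]; linear_combination h1'
      · linear_combination h2'
    · have h1' : (j : ℂ) - p = i + D - N := by exact_mod_cast h1
      have h2' : (k : ℂ) + p = i + N := by exact_mod_cast h2
      rw [mul_comm]
      congr 2
      · rw [hw]; linear_combination h2'
      · linear_combination h1'
  have hGG0 : Complex.Gamma (-(ν + A - N) + i + 1) ≠ 0 := by
    refine Complex.Gamma_ne_zero fun n hn => hν (i + 1 + n - A + N) ?_
    push_cast
    linear_combination -hn
  have hint : ∫ z : ℂ, polarPow (-ν + A + -ν + (j + k)) (m + -p + (j - k)) z *
      macdonald (ν + D - N) (‖z‖ ^ 2) = Real.pi * (Complex.Gamma w * (i + D).factorial) := by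
    rw [show m + -p + ((j : ℤ) - k) = 0 by omega, integral_polarPow_zero_mul,
      ← Complex.Gamma_nat_eq_factorial, ← hwl, ← integral_cpow_mul_macdonald hwre hwl']
    congr 3
    funext t
    congr 2
    rw [hw, hkD]
    linear_combination hN / 2
  have hpol : polarPow (-ν) (-p) u * (u ^ j * conj u ^ k) =
      polarPow (-ν + D) (-m) u * ((‖u‖ : ℂ) ^ 2) ^ i := by
    rw [pow_mul_conj_pow_eq _ _ hu, ← polarPow_add _ _ _ _ hu, ← Complex.mul_conj' u, mul_pow,
      pow_mul_conj_pow_eq _ _ hu, ← polarPow_add _ _ _ _ hu]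
    congr 1
    · linear_combination hkD
    · omega
  have hsign : (-1 : ℂ) ^ j * (-1) ^ k = (-1) ^ D := by
    rw [← pow_add, hjk', pow_add, pow_mul]; norm_num
  rw [hint, neg_neg, besselTerm, neg_pow u, neg_pow (conj u)]
  have hf1 : (i.factorial : ℂ) ≠ 0 := by exact_mod_cast i.factorial_ne_zero
  have hf2 : ((i + D).factorial : ℂ) ≠ 0 := by exact_mod_cast (i + D).factorial_ne_zero
  have hden : (j.factorial : ℂ) * Complex.Gamma (-(ν + p) + j + 1) *
      (k.factorial * Complex.Gamma (-(ν - p) + k + 1)) = i.factorial * (i + D).factorial *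
      (Complex.Gamma w * Complex.Gamma (-(ν + A - N) + i + 1)) := by
    rw [← hGG, ← hfac]; ring
  rw [div_mul_div_comm, hden,
    show polarPow (-ν) (-p) u * ((-1) ^ j * u ^ j * ((-1) ^ k * conj u ^ k) /
      (i.factorial * (i + D).factorial * (Complex.Gamma w *
        Complex.Gamma (-(ν + A - N) + i + 1)))) = ((-1) ^ j * (-1) ^ k) *
      (polarPow (-ν) (-p) u * (u ^ j * conj u ^ k)) / (i.factorial * (i + D).factorial *
        (Complex.Gamma w * Complex.Gamma (-(ν + A - N) + i + 1))) by ring, hsign, hpol]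
  field_simp

/-- The integral of a test function against the regular part of the kernel. -/
theorem integral_testWeight_eq {ν : ℂ} (hν : ∀ n : ℤ, ν ≠ n) (hre : |ν.re| < 1) (p m : ℤ) {u : ℂ}
    (hu : u ≠ 0) :
    ∫ z, testWeight ν p m u z *
        (besselEnt (-(ν + p)) (u * z) * besselEnt (-(ν - p)) (conj (u * z))) =
      Real.pi * (-1) ^ (m - p).natAbs * polarPow (-ν + (m - p).natAbs) (-m) u *
        besselEnt (-(ν + (m + p).natAbs - (max m.natAbs p.natAbs : ℕ))) (-((‖u‖ : ℂ) ^ 2)) := by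
  have h1 := (hasSum_integral_testWeight hre p m hu).1
  set g : ℕ → ℕ × ℕ := fun i => (i + (p - m).toNat, i + (m - p).toNat)
  have hg : Function.Injective g := fun i i' h => by
    have := congrArg Prod.fst h
    simpa [g] using this
  rw [← hg.hasSum_iff fun q hq => integral_testWeight_mul_besselTerm_eq_zero ν p m u fun h0 =>
    hq ⟨q.1 - (p - m).toNat, Prod.ext (by simp only [g]; omega) (by simp only [g]; omega)⟩] at h1
  refine h1.unique ?_
  refine ((hasSum_besselEnt (-(ν + (m + p).natAbs - (max m.natAbs p.natAbs : ℕ)))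
    (-((‖u‖ : ℂ) ^ 2))).mul_left (Real.pi * (-1) ^ (m - p).natAbs *
      polarPow (-ν + (m - p).natAbs) (-m) u)).congr_fun fun i => ?_
  exact integral_testWeight_mul_besselTerm_eq hν hre p m hu i

theorem integral_besselTest_mul_besselKer {ν : ℂ} (hν : ∀ n : ℤ, ν ≠ n) (hre : |ν.re| < 1)
    (p m : ℤ) {v : ℂ} (hv : v ≠ 0) :
    ∫ z, besselTest ν p m z * besselKer ν p (v * z) =
      (-1) ^ max m.natAbs p.natAbs * besselTest ν p (-m) (4 * Real.pi ^ 2 * v) := by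
  have hν' : ∀ n : ℤ, -ν ≠ n := fun n hn => hν (-n) (by push_cast; rw [← hn, neg_neg])
  have hre' : |(-ν).re| < 1 := by simpa using hre
  obtain ⟨u, hu_def⟩ : ∃ u : ℂ, u = 4 * Real.pi ^ 2 * v := ⟨_, rfl⟩
  have hu : u ≠ 0 := hu_def ▸ mul_ne_zero four_pi_sq_ne_zero hv
  have hu0 : 0 < ‖u‖ := norm_pos_iff.2 hu
  have i1 := (hasSum_integral_testWeight hre p m hu).2
  have i2 := (hasSum_integral_testWeight hre' (-p) m hu).2
  have e1 := integral_testWeight_eq hν hre p m hu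
  have e2 := integral_testWeight_eq hν' hre' (-p) m hu
  have hN : ((m + p).natAbs : ℂ) + (m - p).natAbs = 2 * (max m.natAbs p.natAbs : ℕ) := by
    exact_mod_cast natAbs_add_add_natAbs_sub m p
  have hNat := natAbs_add_add_natAbs_sub m p
  rw [show m - -p = m + p by ring, show m + -p = m - p by ring, Int.natAbs_neg] at e2
  have hT : besselTest ν p (-m) u = polarPow (-ν + (m - p).natAbs) (-m) u *
      macdonald (ν + (m + p).natAbs - (max m.natAbs p.natAbs : ℕ)) (‖u‖ ^ 2) := by
    rw [besselTest, show (-m + p).natAbs = (m - p).natAbs by omega,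
      show (-m - p).natAbs = (m + p).natAbs by omega, Int.natAbs_neg]
  rw [← hu_def, hT]
  set A : ℕ := (m + p).natAbs
  set D : ℕ := (m - p).natAbs
  set N : ℕ := max m.natAbs p.natAbs
  have hl : ∀ n : ℤ, ν + A - N ≠ n := fun n hn => hν (n - A + N) (by
    push_cast; linear_combination hn)
  set S := Complex.sin (Real.pi * ν) with hS
  have hS0 : S ≠ 0 := sin_pi_mul_ne_zero hν
  have hsin : Complex.sin (Real.pi * (ν + A - N)) = (-1) ^ (A + N) * S := by
    rw [show Real.pi * (ν + A - N) = Real.pi * ν + ((A - N : ℤ) : ℂ) * Real.pi by push_cast; ring,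
      sin_add_int_mul_pi, hS]
    congr 1
    rw [show (A : ℤ) - N = ((A + N : ℕ) : ℤ) + 2 * (-N) by push_cast; ring,
      zpow_add₀ (by norm_num), zpow_mul, zpow_natCast]
    norm_num
  have hser := macdonald_eq_series hl (pow_pos hu0 2)
  rw [macdonaldSeries, hsin] at hser
  have hcp : polarPow (-ν + D) (-m) u * ((‖u‖ ^ 2 : ℝ) : ℂ) ^ (ν + A - N) =
      polarPow (- -ν + A) (-m) u := by
    have : ((‖u‖ ^ 2 : ℝ) : ℂ) ^ (ν + A - N) = polarPow (2 * (ν + A - N)) 0 u := by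
      rw [polarPow, zpow_zero, mul_one,
        Complex.cpow_def_of_ne_zero (by exact_mod_cast (pow_pos hu0 2).ne'),
        Complex.cpow_def_of_ne_zero (by exact_mod_cast hu0.ne'),
        ← Complex.ofReal_log (by positivity), ← Complex.ofReal_log hu0.le, Real.log_pow]
      congr 1
      push_cast
      ring
    rw [this, ← polarPow_add _ _ _ _ hu, add_zero]
    congr 1
    linear_combination hN
  have hsplit : ∫ z, besselTest ν p m z * besselKer ν p (v * z) =
      S⁻¹ * ((∫ z, testWeight ν p m u z *
        (besselEnt (-(ν + p)) (u * z) * besselEnt (-(ν - p)) (conj (u * z)))) -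
      ∫ z, testWeight (-ν) (-p) m u z * (besselEnt (-(-ν + (-p : ℤ))) (u * z) *
        besselEnt (-(-ν - (-p : ℤ))) (conj (u * z)))) := by
    rw [← integral_sub i1 i2, ← integral_const_mul]
    refine integral_congr_ae (ae_ne_zero.mono fun z hz => ?_)
    have huz : u * z ≠ 0 := mul_ne_zero hu hz
    have hadd : polarPow (- -ν) (- -p) (u * z) = polarPow (-ν) (-p) (u * z) *
        polarPow (2 * ν) (2 * p) (u * z) := by
      rw [← polarPow_add _ _ _ _ huz]; congr 1 <;> ring
    simp only [testWeight]
    rw [besselTest_neg ν p m hz, hadd, besselKer, ← mul_assoc _ v z, ← hu_def, kerG, kerA, kerB,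
      charPow, ← hS]
    simp only [Int.cast_neg, Int.cast_zero, add_zero, zpow_zero, mul_one, one_mul]
    rw [show -(-ν + -(p : ℂ)) = ν + p by ring, show -(-ν - -(p : ℂ)) = ν - p by ring]
    ring
  have hD : (-1 : ℂ) ^ D = (-1) ^ A := by
    rw [← mul_right_inj' (pow_ne_zero A (by norm_num : (-1 : ℂ) ≠ 0)), ← pow_add, hNat, ← pow_add,
      pow_mul, ← two_mul, pow_mul]
    norm_num
  have hsq : ∀ n : ℕ, (-1 : ℂ) ^ n * (-1) ^ n = 1 := fun n => by
    rw [← mul_pow]; norm_num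
  have hμ : -(-ν + D - N) = ν + A - N := by linear_combination -hN
  rw [hsplit, e1, e2, hser, hμ, ← hcp, hD, pow_add]
  have a0 : (-1 : ℂ) ^ A ≠ 0 := pow_ne_zero _ (by norm_num)
  have n0 : (-1 : ℂ) ^ N ≠ 0 := pow_ne_zero _ (by norm_num)
  have ea : ((-1 : ℂ) ^ A)⁻¹ = (-1) ^ A := inv_eq_of_mul_eq_one_left (hsq A)
  have en : ((-1 : ℂ) ^ N)⁻¹ = (-1) ^ N := inv_eq_of_mul_eq_one_left (hsq N)
  rw [div_eq_mul_inv, mul_inv, mul_inv, ea, en]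
  push_cast
  linear_combination (-(S⁻¹ * Real.pi * (-1) ^ A * polarPow (-ν + D) (-m) u *
    (besselEnt (-(ν + A - N)) (-((‖u‖ : ℂ) ^ 2)) - ((‖u‖ : ℂ) ^ 2) ^ (ν + A - N) *
      besselEnt (ν + A - N) (-((‖u‖ : ℂ) ^ 2))))) * hsq N

theorem planeHankel_comp_mul (ν : ℂ) (p : ℤ) (f : ℂ → ℂ) {s : ℝ} (hs : 0 < s) (u : ℂ) :
    planeHankel ν p (fun z => f (s * z)) u = ((s ^ 2 : ℝ) : ℂ)⁻¹ * planeHankel ν p f (u / s) := by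
  have hs0 : (s : ℂ) ≠ 0 := by exact_mod_cast hs.ne'
  have h : ∫ z : ℂ, f (s • z) * besselKer ν p (u / s * s • z) =
      (s ^ Module.finrank ℝ ℂ)⁻¹ • ∫ z : ℂ, f z * besselKer ν p (u / s * z) :=
    Measure.integral_comp_smul_of_nonneg volume (fun z => f z * besselKer ν p (u / s * z)) s
      (hR := hs.le)
  rw [Complex.finrank_real_complex] at h
  have e : ∀ z : ℂ, f (s • z) * besselKer ν p (u / s * s • z) =
      f (s * z) * besselKer ν p (u * z) := fun z => by
    rw [Complex.real_smul, show u / s * (s * z) = u * z by field_simp]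
  simp only [e] at h
  rw [planeHankel, planeHankel, h, Complex.real_smul]
  push_cast
  ring

theorem planeHankel_congr_const_mul (ν : ℂ) (p : ℤ) {f g : ℂ → ℂ} {c : ℂ} (u : ℂ)
    (h : ∀ z, z ≠ 0 → f z = c * g z) : planeHankel ν p f u = c * planeHankel ν p g u := by
  unfold planeHankel
  rw [mul_left_comm, ← integral_const_mul c]
  congr 1
  refine integral_congr_ae (ae_ne_zero.mono fun z hz => ?_)
  simp only
  rw [h z hz, mul_assoc]

theorem planeHankel_besselTest {ν : ℂ} (hν : ∀ n : ℤ, ν ≠ n) (hre : |ν.re| < 1) (p m : ℤ) {s : ℝ}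
    (hs : 0 < s) {u : ℂ} (hu : u ≠ 0) :
    planeHankel ν p (fun z => besselTest ν p m (s * z)) u = (-1) ^ max m.natAbs p.natAbs *
      (((4 * Real.pi ^ 2 / s ^ 2 : ℝ) : ℂ) *
        besselTest ν p (-m) (((4 * Real.pi ^ 2 / s : ℝ) : ℂ) * u)) := by
  have hs0 : (s : ℂ) ≠ 0 := by exact_mod_cast hs.ne'
  rw [planeHankel_comp_mul _ _ _ hs, planeHankel,
    integral_besselTest_mul_besselKer hν hre p m (div_ne_zero hu hs0)]
  push_cast
  rw [show 4 * (Real.pi : ℂ) ^ 2 * (u / s) = 4 * Real.pi ^ 2 / s * u by ring]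
  ring

/-- The test functions are fixed by the square of the Hankel transform. -/
theorem planeHankel_planeHankel_besselTest {ν : ℂ} (hν : ∀ n : ℤ, ν ≠ n) (hre : |ν.re| < 1)
    (p m : ℤ) {s : ℝ} (hs : 0 < s) {u : ℂ} (hu : u ≠ 0) :
    planeHankel ν p (planeHankel ν p fun z => besselTest ν p m (s * z)) u =
      besselTest ν p m (s * u) := by
  have hc : 0 < 4 * Real.pi ^ 2 / s := by positivity
  have e : planeHankel ν p (planeHankel ν p fun z => besselTest ν p m (s * z)) u =
      (-1) ^ max m.natAbs p.natAbs * ((4 * Real.pi ^ 2 / s ^ 2 : ℝ) : ℂ) *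
        planeHankel ν p (fun z => besselTest ν p (-m) (((4 * Real.pi ^ 2 / s : ℝ) : ℂ) * z)) u := by
    refine planeHankel_congr_const_mul ν p u fun z hz => ?_
    rw [planeHankel_besselTest hν hre p m hs hz]
    ring
  rw [e, planeHankel_besselTest hν hre p (-m) hc hu, neg_neg, Int.natAbs_neg]
  have hsq : (-1 : ℂ) ^ max m.natAbs p.natAbs * (-1) ^ max m.natAbs p.natAbs = 1 := by
    rw [← mul_pow]; norm_num
  have e1 : 4 * Real.pi ^ 2 / (4 * Real.pi ^ 2 / s) = s := by field_simp
  have e2 : 4 * Real.pi ^ 2 / s ^ 2 * (4 * Real.pi ^ 2 / (4 * Real.pi ^ 2 / s) ^ 2) = 1 := by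
    field_simp
  have e2' : ((4 * Real.pi ^ 2 / s ^ 2 : ℝ) : ℂ) *
      ((4 * Real.pi ^ 2 / (4 * Real.pi ^ 2 / s) ^ 2 : ℝ) : ℂ) = 1 := by
    rw [← Complex.ofReal_mul, e2, Complex.ofReal_one]
  rw [e1]
  linear_combination (((4 * Real.pi ^ 2 / s ^ 2 : ℝ) : ℂ) *
    ((4 * Real.pi ^ 2 / (4 * Real.pi ^ 2 / s) ^ 2 : ℝ) : ℂ) * besselTest ν p m (s * u)) * hsq +
    besselTest ν p m (s * u) * e2'

/-! ### The Hankel transform is an involution -/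

theorem integrable_prod_mul_besselKer {ν : ℂ} (hν : ∀ n : ℤ, ν ≠ n) (hre : |ν.re| < 1) (p : ℤ)
    {τ : ℝ} (hτ : τ < 1) {f g : ℂ → ℂ} (hf : RapidDecay τ f) (hg : RapidDecay τ g) :
    Integrable (fun q : ℂ × ℂ => f q.1 * g q.2 * besselKer ν p (q.1 * q.2))
      (volume.prod volume) := by
  obtain ⟨C, hC, h⟩ := exists_norm_besselKer_le hν hre p le_rfl
  have hσ : -1 ≤ -|ν.re| := by linarith
  have i1 := (hf.integrable_mul_weight hτ hσ).mul_prod (hg.integrable_mul_weight hτ hσ)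
  have i2 := (hf.integrable_mul_weight hτ (σ := 5) (by norm_num)).mul_prod
    (hg.integrable_mul_weight hτ (σ := 5) (by norm_num))
  refine ((i1.add i2).const_mul C).mono' ?_ ?_
  · exact (((hf.measurable.comp measurable_fst).mul (hg.measurable.comp measurable_snd)).mul
      ((measurable_besselKer ν p).comp (measurable_fst.mul measurable_snd))).aestronglyMeasurable
  · filter_upwards [Measure.quasiMeasurePreserving_fst.ae ae_ne_zero,
      Measure.quasiMeasurePreserving_snd.ae ae_ne_zero] with q h1 h2
    have hk := h (q.1 * q.2) (mul_ne_zero h1 h2)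
    rw [norm_mul q.1, Real.mul_rpow (norm_nonneg _) (norm_nonneg _),
      Real.mul_rpow (norm_nonneg _) (norm_nonneg _)] at hk
    rw [norm_mul, norm_mul]
    refine (mul_le_mul_of_nonneg_left hk (by positivity)).trans (le_of_eq ?_)
    simp only [Pi.add_apply]
    ring

theorem integral_planeHankel_mul {ν : ℂ} (hν : ∀ n : ℤ, ν ≠ n) (hre : |ν.re| < 1) (p : ℤ)
    {τ : ℝ} (hτ : τ < 1) {f g : ℂ → ℂ} (hf : RapidDecay τ f) (hg : RapidDecay τ g) :
    ∫ u, planeHankel ν p f u * g u = ∫ z, f z * planeHankel ν p g z := by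
  have h := integral_integral_swap (μ := (volume : Measure ℂ)) (ν := (volume : Measure ℂ))
    (f := fun z u => f z * g u * besselKer ν p (z * u))
    (integrable_prod_mul_besselKer hν hre p hτ hf hg)
  have e1 : ∀ u, planeHankel ν p f u * g u =
      4 * Real.pi ^ 2 * ∫ z, f z * g u * besselKer ν p (z * u) := fun u => by
    rw [planeHankel, mul_assoc, ← integral_mul_const]
    congr 2
    funext z
    rw [mul_comm u z]
    ring
  have e2 : ∀ z, f z * planeHankel ν p g z =
      4 * Real.pi ^ 2 * ∫ u, f z * g u * besselKer ν p (z * u) := fun z => by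
    rw [planeHankel, mul_left_comm, ← integral_const_mul]
    congr 2
    funext u
    ring
  simp only [e1, e2, integral_const_mul]
  rw [← h]

/-- A power `|z|^{-w} (z/|z|)^m` as a superposition of dilates of a test function. -/
theorem integral_cpow_mul_besselTest (ν : ℂ) (p m : ℤ) {w : ℂ} (hw : |ν.re| < w.re) {z : ℂ}
    (hz : z ≠ 0) :
    ∫ s in Ioi (0 : ℝ), (s : ℂ) ^ (w - 1) * besselTest ν p m (s * z) =
      Complex.Gamma ((w - ν + (m + p).natAbs) / 2) *
        Complex.Gamma ((w + ν + (m - p).natAbs) / 2) / 2 * polarPow (-w) m z := by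
  set A : ℕ := (m + p).natAbs with hA
  set D' : ℕ := (m - p).natAbs with hD
  have hN : (A : ℂ) + D' = 2 * (max m.natAbs p.natAbs : ℕ) := by
    exact_mod_cast natAbs_add_add_natAbs_sub m p
  set N : ℕ := max m.natAbs p.natAbs with hN'
  have hw' := abs_lt.1 hw
  have hz0 : 0 < ‖z‖ := norm_pos_iff.2 hz
  have h1 : 0 < ((w - ν + A) / 2).re := by
    simp only [Complex.div_ofNat_re, Complex.add_re, Complex.sub_re, Complex.natCast_re]
    have : (0 : ℝ) ≤ A := by positivity
    linarith
  have e2 : (w - ν + A) / 2 + (ν + D' - N) = (w + ν + D') / 2 := by linear_combination hN / 2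
  have h2 : 0 < ((w - ν + A) / 2 + (ν + D' - N)).re := by
    rw [e2]
    simp only [Complex.div_ofNat_re, Complex.add_re, Complex.natCast_re]
    have : (0 : ℝ) ≤ D' := by positivity
    linarith
  have hm : mellin (fun s : ℝ => macdonald (ν + D' - N) ((‖z‖ * s) ^ (2 : ℝ))) (w - ν + A) =
      (‖z‖ : ℂ) ^ (-(w - ν + A)) * ((1 / 2) * (Complex.Gamma ((w - ν + A) / 2) *
        Complex.Gamma ((w + ν + D') / 2))) := by
    rw [mellin_comp_mul_left (fun s : ℝ => macdonald (ν + D' - N) (s ^ (2 : ℝ))) _ hz0,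
      mellin_comp_rpow, ← e2, ← integral_cpow_mul_macdonald h1 h2]
    simp [mellin]
  have e : ∀ s ∈ Ioi (0 : ℝ), (s : ℂ) ^ (w - 1) * besselTest ν p m (s * z) =
      polarPow (-ν + A) m z * ((s : ℂ) ^ (w - ν + A - 1) •
        macdonald (ν + D' - N) ((‖z‖ * s) ^ (2 : ℝ))) := fun s hs => by
    have hs : 0 < s := hs
    have hs0 : (s : ℂ) ≠ 0 := by exact_mod_cast hs.ne'
    have hp : polarPow (-ν + A) m (s : ℂ) = (s : ℂ) ^ (-ν + A) := by
      simp [polarPow, abs_of_pos hs, hs0]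
    rw [besselTest, ← hA, ← hD, ← hN', polarPow_mul, hp, norm_mul, Complex.norm_real,
      Real.norm_of_nonneg hs.le, Real.rpow_two, mul_comm s, smul_eq_mul,
      show w - ν + A - 1 = (w - 1) + (-ν + A) by ring, Complex.cpow_add (w - 1) _ hs0]
    ring
  have hpp : polarPow (-w) m z = polarPow (-ν + A) m z * (‖z‖ : ℂ) ^ (-(w - ν + A)) := by
    have : (‖z‖ : ℂ) ^ (-(w - ν + A)) = polarPow (-(w - ν + A)) 0 z := by simp [polarPow]
    rw [this, ← polarPow_add _ _ _ _ hz]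
    congr 1 <;> ring
  rw [setIntegral_congr_fun measurableSet_Ioi e, integral_const_mul]
  rw [mellin] at hm
  rw [hm, hpp]
  ring

theorem integral_mul_polarPow_eq_zero {ν : ℂ} (p m : ℤ) {τ : ℝ} (hτ : |ν.re| < τ) (hτ' : τ < 1)
    {D : ℂ → ℂ} (hD : RapidDecay τ D)
    (h : ∀ s : ℝ, 0 < s → ∫ z, D z * besselTest ν p m (s * z) = 0) {w : ℂ} (hw : w.re = 1) :
    ∫ z, D z * polarPow (-w) m z = 0 := by
  obtain ⟨C, hC, hT⟩ := exists_norm_besselTest_le p m hτ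
  have hν := abs_lt.1 hτ
  have hm : Measurable fun q : ℂ × ℝ => D q.1 * ((q.2 : ℂ) ^ (w - 1) *
      besselTest ν p m (q.2 * q.1)) :=
    (hD.measurable.comp measurable_fst).mul (Measurable.mul (by fun_prop)
      ((measurable_besselTest ν p m).comp (by fun_prop)))
  have hG : ∀ z : ℂ, z ≠ 0 → IntegrableOn (fun s : ℝ => s ^ (1 - τ - 1) * Real.exp (-(‖z‖ * s)))
      (Ioi 0) := fun z hz => by
    have := integrableOn_rpow_mul_exp_neg_mul_rpow (s := 1 - τ - 1) (p := 1) (by linarith) one_pos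
      (norm_pos_iff.2 hz)
    simpa using this
  have hb : ∀ z : ℂ, z ≠ 0 → ∀ s ∈ Ioi (0 : ℝ),
      ‖D z * ((s : ℂ) ^ (w - 1) * besselTest ν p m (s * z))‖ ≤
        C * (‖D z‖ * ‖z‖ ^ (-τ)) * (s ^ (1 - τ - 1) * Real.exp (-(‖z‖ * s))) := fun z hz s hs => by
    have hs : 0 < s := hs
    have hk := hT (s * z) (mul_ne_zero (by exact_mod_cast hs.ne') hz)
    rw [norm_mul (s : ℂ), Complex.norm_real, Real.norm_of_nonneg hs.le,
      Real.mul_rpow hs.le (norm_nonneg _)] at hk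
    rw [norm_mul, norm_mul, Complex.norm_cpow_eq_rpow_re_of_pos hs, Complex.sub_re, hw,
      Complex.one_re, sub_self, Real.rpow_zero, one_mul, show 1 - τ - 1 = -τ by ring,
      mul_comm ‖z‖ s]
    refine (mul_le_mul_of_nonneg_left hk (norm_nonneg _)).trans (le_of_eq ?_)
    ring
  have hi : ∀ z : ℂ, z ≠ 0 → IntegrableOn (fun s : ℝ => D z * ((s : ℂ) ^ (w - 1) *
      besselTest ν p m (s * z))) (Ioi 0) := fun z hz =>
    ((hG z hz).const_mul _).mono' (hm.comp measurable_prodMk_left).aestronglyMeasurable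
      ((ae_restrict_mem measurableSet_Ioi).mono (hb z hz))
  have hint : Integrable (fun q : ℂ × ℝ => D q.1 * ((q.2 : ℂ) ^ (w - 1) *
      besselTest ν p m (q.2 * q.1))) (volume.prod (volume.restrict (Ioi 0))) := by
    rw [integrable_prod_iff hm.aestronglyMeasurable]
    refine ⟨ae_ne_zero.mono hi, ?_⟩
    refine ((hD.integrable_mul_weight hτ' (σ := -1) le_rfl).const_mul
      (C * Real.Gamma (1 - τ))).mono'
      (hm.norm.stronglyMeasurable.integral_prod_right').aestronglyMeasurable
      (ae_ne_zero.mono fun z hz => ?_)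
    have hz0 : 0 < ‖z‖ := norm_pos_iff.2 hz
    rw [Real.norm_of_nonneg (integral_nonneg fun _ => norm_nonneg _)]
    refine (setIntegral_mono_on (hi z hz).norm ((hG z hz).const_mul _) measurableSet_Ioi
      (hb z hz)).trans (le_of_eq ?_)
    rw [integral_const_mul, Real.integral_rpow_mul_exp_neg_mul_Ioi (by linarith) hz0,
      one_div, Real.inv_rpow hz0.le, ← Real.rpow_neg hz0.le]
    have : ‖z‖ ^ (-τ) * ‖z‖ ^ (-(1 - τ)) = ‖z‖ ^ (-1 : ℝ) := by
      rw [← Real.rpow_add hz0]; congr 1; ring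
    linear_combination (C * Real.Gamma (1 - τ) * ‖D z‖) * this
  have hsw := integral_integral_swap (μ := (volume : Measure ℂ))
    (ν := volume.restrict (Ioi (0 : ℝ)))
    (f := fun z s => D z * ((s : ℂ) ^ (w - 1) * besselTest ν p m (s * z))) hint
  have e0 : ∫ s in Ioi (0 : ℝ), ∫ z, D z * ((s : ℂ) ^ (w - 1) * besselTest ν p m (s * z)) = 0 := by
    refine (setIntegral_congr_fun (g := fun _ => (0 : ℂ)) measurableSet_Ioi fun s hs => ?_).trans
      (by simp)
    simp only [mul_left_comm (D _), integral_const_mul, h s hs, mul_zero]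
  set c : ℂ := Complex.Gamma ((w - ν + (m + p).natAbs) / 2) *
    Complex.Gamma ((w + ν + (m - p).natAbs) / 2) / 2 with hc
  have hc0 : c ≠ 0 := by
    refine div_ne_zero (mul_ne_zero (Complex.Gamma_ne_zero_of_re_pos ?_)
      (Complex.Gamma_ne_zero_of_re_pos ?_)) two_ne_zero <;>
    simp only [Complex.div_ofNat_re, Complex.add_re, Complex.sub_re, Complex.natCast_re, hw]
    · have : (0 : ℝ) ≤ (m + p).natAbs := by positivity
      linarith
    · have : (0 : ℝ) ≤ (m - p).natAbs := by positivity
      linarith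
  have e1 : ∫ z, ∫ s in Ioi (0 : ℝ), D z * ((s : ℂ) ^ (w - 1) * besselTest ν p m (s * z)) =
      c * ∫ z, D z * polarPow (-w) m z := by
    rw [← integral_const_mul]
    refine integral_congr_ae (ae_ne_zero.mono fun z hz => ?_)
    simp only
    rw [integral_const_mul, integral_cpow_mul_besselTest ν p m (by rw [hw]; linarith) hz, ← hc]
    ring
  rw [e1, e0] at hsw
  exact (mul_eq_zero.1 hsw).resolve_left hc0

open scoped BoundedContinuousFunction

section Density

variable {E : Type*} [TopologicalSpace E] [PolishSpace E] [MeasurableSpace E] [BorelSpace E]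
  {μ : Measure E}

/-- A finite measure on a Polish space is determined by its integrals against a multiplicative
family of bounded functions, stable under conjugation, that separates points. -/
theorem ext_of_forall_mem_submonoid_integral_eq {P P' : Measure E} [IsFiniteMeasure P]
    [IsFiniteMeasure P'] (S : Submonoid (E →ᵇ ℂ)) (hstar : ∀ g ∈ S, star g ∈ S)
    (hsep : ∀ x y, x ≠ y → ∃ g ∈ S, g x ≠ g y) (h : ∀ g ∈ S, ∫ x, g x ∂P = ∫ x, g x ∂P') :
    P = P' := by
  refine ext_of_forall_mem_subalgebra_integral_eq_of_polish (𝕜 := ℂ)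
    (A := StarAlgebra.adjoin ℂ (S : Set (E →ᵇ ℂ))) ?_ fun g hg => ?_
  · intro x y hxy
    obtain ⟨g, hg, hne⟩ := hsep x y hxy
    exact ⟨g, ⟨_, ⟨g, StarAlgebra.subset_adjoin ℂ _ hg, rfl⟩, rfl⟩, hne⟩
  · have hS : (S : Set (E →ᵇ ℂ)) ∪ star (S : Set (E →ᵇ ℂ)) = S := by
      refine union_eq_left.2 fun g hg => ?_
      simpa using hstar _ hg
    have hg' : g ∈ Subalgebra.toSubmodule (Algebra.adjoin ℂ (S : Set (E →ᵇ ℂ))) := by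
      rw [← hS, ← StarAlgebra.adjoin_toSubalgebra]
      exact hg
    rw [Algebra.adjoin_eq_span, Submonoid.closure_eq] at hg'
    clear hg
    induction hg' using Submodule.span_induction with
    | mem g hg => exact h g hg
    | zero => simp
    | add f g _ _ hf hg =>
      simp only [BoundedContinuousFunction.coe_add, Pi.add_apply]
      rw [integral_add (f.integrable P) (g.integrable P),
        integral_add (f.integrable P') (g.integrable P'), hf, hg]
    | smul c g _ hg =>
      simp only [BoundedContinuousFunction.coe_smul]
      rw [integral_smul, integral_smul, hg]

theorem ae_eq_zero_of_forall_integral_mul_eq_zero_real {a : E → ℝ}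
    (ham : Measurable a) (ha : Integrable a μ) (S : Submonoid (E →ᵇ ℂ)) (hstar : ∀ g ∈ S, star g ∈ S)
    (hsep : ∀ x y, x ≠ y → ∃ g ∈ S, g x ≠ g y) (h : ∀ g ∈ S, ∫ x, (a x : ℂ) * g x ∂μ = 0) :
    a =ᵐ[μ] 0 := by
  have h1 : Measurable fun x => ENNReal.ofReal (a x) := ham.ennreal_ofReal
  have h2 : Measurable fun x => ENNReal.ofReal (-a x) := ham.neg.ennreal_ofReal
  have f1 : IsFiniteMeasure (μ.withDensity fun x => ENNReal.ofReal (a x)) :=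
    isFiniteMeasure_withDensity_ofReal ha.2
  have f2 : IsFiniteMeasure (μ.withDensity fun x => ENNReal.ofReal (-a x)) :=
    isFiniteMeasure_withDensity_ofReal ha.neg.2
  have key := ext_of_forall_mem_submonoid_integral_eq S hstar hsep
    (P := μ.withDensity fun x => ENNReal.ofReal (a x))
    (P' := μ.withDensity fun x => ENNReal.ofReal (-a x)) fun g hg => by
      rw [integral_withDensity_eq_integral_toReal_smul h1 (by simp),
        integral_withDensity_eq_integral_toReal_smul h2 (by simp), ← sub_eq_zero,
        ← integral_sub, ← h g hg]
      · congr 1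
        funext x
        rw [← sub_smul, ENNReal.toReal_ofReal', ENNReal.toReal_ofReal',
          show max (a x) 0 - max (-a x) 0 = a x by
            rcases le_total (a x) 0 with h | h <;> simp [h]]
        rfl
      · exact (integrable_withDensity_iff_integrable_smul' h1 (by simp)).1 (g.integrable _)
      · exact (integrable_withDensity_iff_integrable_smul' h2 (by simp)).1 (g.integrable _)
  rw [withDensity_eq_iff h1.aemeasurable h2.aemeasurable ha.lintegral_lt_top.ne] at key
  refine key.mono fun x hx => ?_
  simp only at hx
  rcases le_total (a x) 0 with h | h
  · rw [ENNReal.ofReal_of_nonpos h, eq_comm, ENNReal.ofReal_eq_zero] at hx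
    exact le_antisymm h (neg_nonpos.1 hx)
  · rw [ENNReal.ofReal_of_nonpos (neg_nonpos.2 h), ENNReal.ofReal_eq_zero] at hx
    exact le_antisymm hx h

theorem ae_eq_zero_of_forall_integral_mul_eq_zero {f : E → ℂ} (hfm : Measurable f)
    (hf : Integrable f μ) (S : Submonoid (E →ᵇ ℂ)) (hstar : ∀ g ∈ S, star g ∈ S)
    (hsep : ∀ x y, x ≠ y → ∃ g ∈ S, g x ≠ g y) (h : ∀ g ∈ S, ∫ x, f x * g x ∂μ = 0) :
    f =ᵐ[μ] 0 := by
  have hi : ∀ g : E →ᵇ ℂ, Integrable (fun x => f x * g x) μ := fun g =>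
    hf.mul_bdd g.continuous.aestronglyMeasurable (Eventually.of_forall g.norm_coe_le_norm)
  have hi' : ∀ g : E →ᵇ ℂ, Integrable (fun x => conj (f x) * g x) μ := fun g =>
    ((Complex.conjCLE : ℂ →L[ℝ] ℂ).integrable_comp hf).mul_bdd g.continuous.aestronglyMeasurable (Eventually.of_forall g.norm_coe_le_norm)
  have hc : ∀ g ∈ S, ∫ x, conj (f x) * g x ∂μ = 0 := fun g hg => by
    have := congrArg conj (h _ (hstar g hg))
    rw [← integral_conj, map_zero] at this
    simpa using this
  have hre := ae_eq_zero_of_forall_integral_mul_eq_zero_real (Complex.measurable_re.comp hfm) hf.re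
    S hstar hsep fun g hg => by
      have e : ∀ x, (((f x).re : ℝ) : ℂ) * g x = 2⁻¹ * (f x * g x + conj (f x) * g x) := fun x => by
        rw [Complex.re_eq_add_conj]; ring
      simp only [Function.comp_apply, e]
      rw [integral_const_mul, integral_add (hi g) (hi' g), h g hg, hc g hg]
      simp
  have him := ae_eq_zero_of_forall_integral_mul_eq_zero_real (Complex.measurable_im.comp hfm) hf.im
    S hstar hsep fun g hg => by
      have e : ∀ x, (((f x).im : ℝ) : ℂ) * g x =
          (2 * Complex.I)⁻¹ * (f x * g x - conj (f x) * g x) := fun x => by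
        rw [Complex.im_eq_sub_conj]; ring
      simp only [Function.comp_apply, e]
      rw [integral_const_mul, integral_sub (hi g) (hi' g), h g hg, hc g hg]
      simp
  filter_upwards [hre, him] with x h1 h2
  exact Complex.ext h1 h2

end Density

/-- The characters of `ℂˣ`, as bounded functions on the punctured plane. -/
noncomputable def unitaryCharacters : Submonoid ({z : ℂ // z ≠ 0} →ᵇ ℂ) where
  carrier := {g | ∃ (y : ℝ) (m : ℤ), ∀ x : {z : ℂ // z ≠ 0}, g x = polarPow (y * Complex.I) m x}
  mul_mem' := by
    rintro g h ⟨y, m, hg⟩ ⟨y', m', hh⟩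
    refine ⟨y + y', m + m', fun x => ?_⟩
    rw [BoundedContinuousFunction.mul_apply, hg, hh, ← polarPow_add _ _ _ _ x.2]
    push_cast
    ring_nf
  one_mem' := ⟨0, 0, fun x => by simp [polarPow]⟩

theorem continuousOn_polarPow (s : ℂ) (k : ℤ) : ContinuousOn (polarPow s k) {z | z ≠ 0} := by
  intro z hz
  have hz' : (‖z‖ : ℂ) ≠ 0 := by exact_mod_cast (norm_pos_iff.2 hz).ne'
  unfold polarPow
  refine ContinuousAt.continuousWithinAt (ContinuousAt.mul ?_ ?_)
  · refine ContinuousAt.cpow (by fun_prop) continuousAt_const ?_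
    exact Or.inl (by simpa using norm_pos_iff.2 hz)
  · exact ContinuousAt.zpow₀ (ContinuousAt.div continuousAt_id (by fun_prop) hz') _
      (Or.inl (div_ne_zero hz hz'))

theorem norm_polarPow_mul_I (y : ℝ) (m : ℤ) {z : ℂ} (hz : z ≠ 0) :
    ‖polarPow (y * Complex.I) m z‖ = 1 := by
  rw [norm_polarPow _ _ hz]
  simp

theorem exists_mem_unitaryCharacters (y : ℝ) (m : ℤ) :
    ∃ g ∈ unitaryCharacters, ∀ x, g x = polarPow (y * Complex.I) m x := by
  refine ⟨BoundedContinuousFunction.ofNormedAddCommGroup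
    (fun x : {z : ℂ // z ≠ 0} => polarPow (y * Complex.I) m x)
    ((continuousOn_polarPow _ m).comp_continuous continuous_subtype_val fun x => x.2) 1
    fun x => (norm_polarPow_mul_I y m x.2).le, ⟨y, m, fun x => rfl⟩, fun x => rfl⟩

theorem star_mem_unitaryCharacters {g : {z : ℂ // z ≠ 0} →ᵇ ℂ} (hg : g ∈ unitaryCharacters) :
    star g ∈ unitaryCharacters := by
  obtain ⟨y, m, h⟩ := hg
  refine ⟨-y, -m, fun x => ?_⟩
  rw [BoundedContinuousFunction.star_apply, h]
  have h1 := norm_polarPow_mul_I y m x.2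
  rw [Complex.ofReal_neg, neg_mul, polarPow_neg _ _ x.2, Complex.inv_def, Complex.normSq_eq_norm_sq,
    h1]
  simp

theorem exists_unitaryCharacters_ne {x y : {z : ℂ // z ≠ 0}} (h : x ≠ y) :
    ∃ g ∈ unitaryCharacters, g x ≠ g y := by
  have hx0 : 0 < ‖(x : ℂ)‖ := norm_pos_iff.2 x.2
  have hy0 : 0 < ‖(y : ℂ)‖ := norm_pos_iff.2 y.2
  have hx : (‖(x : ℂ)‖ : ℂ) ≠ 0 := by exact_mod_cast hx0.ne'
  have hy : (‖(y : ℂ)‖ : ℂ) ≠ 0 := by exact_mod_cast hy0.ne'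
  by_cases hn : ‖(x : ℂ)‖ = ‖(y : ℂ)‖
  · obtain ⟨g, hg, e⟩ := exists_mem_unitaryCharacters 0 1
    refine ⟨g, hg, fun hxy => h (Subtype.ext ?_)⟩
    rw [e, e] at hxy
    simp only [polarPow, Complex.ofReal_zero, zero_mul, Complex.cpow_zero, one_mul, zpow_one,
      hn] at hxy
    exact (div_left_inj' hy).1 hxy
  · set d : ℝ := Real.log ‖(x : ℂ)‖ - Real.log ‖(y : ℂ)‖ with hd
    have hd0 : d ≠ 0 := fun h0 => hn (Real.log_injOn_pos hx0 hy0 (sub_eq_zero.1 h0))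
    obtain ⟨g, hg, e⟩ := exists_mem_unitaryCharacters (Real.pi / d) 0
    refine ⟨g, hg, fun hxy => ?_⟩
    rw [e, e] at hxy
    simp only [polarPow, zpow_zero, mul_one] at hxy
    rw [Complex.cpow_def_of_ne_zero hx, Complex.cpow_def_of_ne_zero hy,
      ← Complex.ofReal_log hx0.le, ← Complex.ofReal_log hy0.le] at hxy
    have h2 : Complex.exp (Real.pi * Complex.I) = 1 := by
      have : (Real.pi * Complex.I : ℂ) = (Real.log ‖(x : ℂ)‖ : ℂ) * ((Real.pi / d : ℝ) * Complex.I) -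
          (Real.log ‖(y : ℂ)‖ : ℂ) * ((Real.pi / d : ℝ) * Complex.I) := by
        have hd' : (d : ℂ) ≠ 0 := by exact_mod_cast hd0
        rw [← sub_mul, ← Complex.ofReal_sub, ← hd]
        push_cast
        field_simp
      rw [this, Complex.exp_sub, hxy, div_self (Complex.exp_ne_zero _)]
    rw [Complex.exp_pi_mul_I] at h2
    norm_num at h2

/-- An integrable function on the punctured plane all of whose Mellin coefficients vanish. -/
theorem ae_eq_zero_of_forall_integral_mul_polarPow {f : ℂ → ℂ} (hfm : Measurable f)
    (hf : Integrable f) (h : ∀ (y : ℝ) (m : ℤ), ∫ z, f z * polarPow (y * Complex.I) m z = 0) :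
    ∀ᵐ z, f z = 0 := by
  have hms : MeasurableSet {z : ℂ | z ≠ 0} := (measurableSet_singleton 0).compl
  have hpol : PolishSpace {z : ℂ // z ≠ 0} := (isOpen_ne (x := (0 : ℂ))).polishSpace
  have hr : (volume : Measure ℂ).restrict {z : ℂ | z ≠ 0} = volume :=
    Measure.restrict_eq_self_of_ae_mem ae_ne_zero
  have key := ae_eq_zero_of_forall_integral_mul_eq_zero
    (μ := Measure.comap ((↑) : {z : ℂ // z ≠ 0} → ℂ) volume) (f := fun x => f x)
    (hfm.comp measurable_subtype_coe) (by
      have := (integrableOn_iff_comap_subtypeVal hms (f := f) (μ := volume)).1 hf.integrableOn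
      exact this) unitaryCharacters
    (fun g hg => star_mem_unitaryCharacters hg) (fun x y hxy => exists_unitaryCharacters_ne hxy) ?_
  · have h2 := (ae_restrict_iff_subtype hms (μ := volume) (p := fun z => f z = 0)).2 key
    rwa [hr] at h2
  · rintro g ⟨y, m, hg⟩
    simp only [hg]
    have := integral_subtype_comap hms (μ := volume) fun z => f z * polarPow (y * Complex.I) m z
    rw [hr, h y m] at this
    exact this

theorem RapidDecay.integrable_mul {τ : ℝ} (hτ : τ < 1) {f g : ℂ → ℂ} (hf : RapidDecay τ f)
    (hg : RapidDecay τ g) : Integrable fun z => f z * g z := by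
  obtain ⟨C, hC, h⟩ := hg.bound 0
  refine ((hf.integrable_mul_weight hτ (σ := -τ) (by linarith)).const_mul C).mono'
    (hf.measurable.mul hg.measurable).aestronglyMeasurable (ae_ne_zero.mono fun z hz => ?_)
  rw [norm_mul]
  refine (mul_le_mul_of_nonneg_left (h z hz) (norm_nonneg _)).trans (le_of_eq ?_)
  rw [pow_zero]
  ring

theorem continuousOn_sisFun (ν : ℂ) (p : ℤ) (φ : 𝓢(ℂ, ℂ) × 𝓢(ℂ, ℂ)) :
    ContinuousOn (sisFun ν p φ) {z | z ≠ 0} :=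
  ((continuousOn_polarPow _ _).mul φ.1.continuous.continuousOn).add
    ((continuousOn_polarPow _ _).mul φ.2.continuous.continuousOn)

/-- A rapidly decaying function orthogonal to all dilates of all test functions vanishes. -/
theorem RapidDecay.ae_eq_zero {ν : ℂ} (p : ℤ) {τ : ℝ} (hτ : |ν.re| < τ) (hτ' : τ < 1)
    {D : ℂ → ℂ} (hD : RapidDecay τ D)
    (h : ∀ (m : ℤ) (s : ℝ), 0 < s → ∫ z, D z * besselTest ν p m (s * z) = 0) :
    ∀ᵐ z, D z = 0 := by
  have hm := hD.measurable.mul (measurable_polarPow (-1) 0)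
  have hi : Integrable fun z => D z * polarPow (-1) 0 z :=
    (hD.integrable_mul_weight hτ' (σ := -1) le_rfl).mono' hm.aestronglyMeasurable
      (ae_ne_zero.mono fun z hz => by rw [norm_mul, norm_polarPow _ _ hz]; simp)
  have key := ae_eq_zero_of_forall_integral_mul_polarPow hm hi fun y m => by
    rw [← integral_mul_polarPow_eq_zero p m hτ hτ' hD (h m)
      (w := 1 - y * Complex.I) (by simp)]
    refine integral_congr_ae (ae_ne_zero.mono fun z hz => ?_)
    simp only [Pi.mul_apply]
    rw [mul_assoc, ← polarPow_add _ _ _ _ hz]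
    congr 2 <;> ring
  filter_upwards [key, ae_ne_zero] with z h1 h2
  exact (mul_eq_zero.1 h1).resolve_right (polarPow_ne_zero _ _ h2)

theorem integral_planeHankel_planeHankel_mul_besselTest {ν : ℂ} (hν : ∀ n : ℤ, ν ≠ n)
    (hre : |ν.re| < 1) (p m : ℤ) {τ : ℝ} (hτ : |ν.re| < τ) (hτ' : τ < 1) {s : ℝ} (hs : 0 < s)
    {f g : ℂ → ℂ} (hf : RapidDecay τ f) (hg : RapidDecay τ g)
    (hfg : ∀ u, u ≠ 0 → planeHankel ν p f u = g u) :
    ∫ u, planeHankel ν p g u * besselTest ν p m (s * u) =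
      ∫ z, f z * besselTest ν p m (s * z) := by
  set t : ℂ → ℂ := fun z => besselTest ν p m (s * z) with ht
  have htd : RapidDecay τ t := (rapidDecay_besselTest p m hτ).comp_mul hs
  obtain ⟨t', ht'd, ht'⟩ : ∃ t', RapidDecay τ t' ∧ ∀ z, z ≠ 0 → planeHankel ν p t z = t' z :=
    ⟨_, (((rapidDecay_besselTest p (-m) hτ).comp_mul
      (s := 4 * Real.pi ^ 2 / s) (by positivity)).const_mul _).const_mul _,
      fun z hz => planeHankel_besselTest hν hre p m hs hz⟩
  have e : ∀ z, z ≠ 0 → planeHankel ν p t' z = t z := fun z hz => by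
    rw [← one_mul (planeHankel ν p t' z)]
    refine (planeHankel_congr_const_mul ν p z fun x hx => ?_).symm.trans
      (planeHankel_planeHankel_besselTest hν hre p m hs hz)
    rw [one_mul]
    exact ht' x hx
  calc ∫ u, planeHankel ν p g u * t u = ∫ z, g z * planeHankel ν p t z :=
        integral_planeHankel_mul hν hre p hτ' hg htd
    _ = ∫ z, planeHankel ν p f z * t' z :=
        integral_congr_ae (ae_ne_zero.mono fun z hz => by simp only; rw [ht' z hz, hfg z hz])
    _ = ∫ z, f z * planeHankel ν p t' z := integral_planeHankel_mul hν hre p hτ' hf ht'd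
    _ = ∫ z, f z * t z :=
        integral_congr_ae (ae_ne_zero.mono fun z hz => by simp only; rw [e z hz])

/-- The Hankel transform is an involution. -/
theorem sisFun_apply_apply {ν : ℂ} (hν : ∀ n : ℤ, ν ≠ n) (hre : |ν.re| < 1) (p : ℤ)
    {T : 𝓢(ℂ, ℂ) × 𝓢(ℂ, ℂ) → 𝓢(ℂ, ℂ) × 𝓢(ℂ, ℂ)}
    (hT : ∀ φ (u : ℂ), u ≠ 0 → planeHankel ν p (sisFun ν p φ) u = sisFun ν p (T φ) u)
    (φ : 𝓢(ℂ, ℂ) × 𝓢(ℂ, ℂ)) {z : ℂ} (hz : z ≠ 0) : sisFun ν p (T (T φ)) z = sisFun ν p φ z := by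
  obtain ⟨τ, hτ, hτ'⟩ := exists_between hre
  have hd := fun φ => rapidDecay_sisFun hτ.le p φ
  have key := RapidDecay.ae_eq_zero p hτ hτ' ((hd (T (T φ))).add ((hd φ).const_mul (-1)))
    fun m s hs => by
      have htd := (rapidDecay_besselTest p m hτ).comp_mul hs
      have e : ∫ z, sisFun ν p (T (T φ)) z * besselTest ν p m (s * z) =
          ∫ z, sisFun ν p φ z * besselTest ν p m (s * z) := by
        rw [← integral_planeHankel_planeHankel_mul_besselTest hν hre p m hτ hτ' hs (hd φ)
          (hd (T φ)) (hT φ)]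
        exact integral_congr_ae (ae_ne_zero.mono fun z hz => by simp only; rw [hT _ z hz])
      rw [← sub_eq_zero, ← integral_sub ((hd _).integrable_mul hτ' htd)
        ((hd _).integrable_mul hτ' htd)] at e
      rw [← e]
      congr 1
      funext z
      ring
  have hae : sisFun ν p (T (T φ)) =ᵐ[volume.restrict {z | z ≠ 0}] sisFun ν p φ :=
    ae_restrict_of_ae (key.mono fun z h => by linear_combination h)
  exact Measure.eqOn_open_of_ae_eq hae isOpen_ne (continuousOn_sisFun ν p _)
    (continuousOn_sisFun ν p _) hz

/-! ### Duality -/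

/-- The transpose of a continuous involution, as an automorphism of the strong dual. -/
theorem exists_strongDual_transpose {E : Type*} [AddCommGroup E] [Module ℂ E] [TopologicalSpace E]
    (L : E →L[ℂ] E) (hL : ∀ x, L (L x) = x) :
    ∃ H : StrongDual ℂ E ≃L[ℂ] StrongDual ℂ E, ∀ f x, H f x = f (L x) := by
  set P : StrongDual ℂ E →L[ℂ] StrongDual ℂ E := ContinuousLinearMap.precomp ℂ L
  have hP : ∀ f, P (P f) = f := fun f => ContinuousLinearMap.ext fun x => congrArg f (hL x)
  exact ⟨ContinuousLinearEquiv.equivOfInverse P P hP hP, fun f x => rfl⟩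

/-- The transpose of a continuous involution, as an automorphism of the weak dual. -/
theorem exists_weakDual_transpose {E : Type*} [AddCommGroup E] [Module ℂ E] [TopologicalSpace E]
    (L : E →L[ℂ] E) (hL : ∀ x, L (L x) = x) :
    ∃ H : WeakDual ℂ E ≃L[ℂ] WeakDual ℂ E, ∀ f x, H f x = f (L x) := by
  set P : WeakDual ℂ E →L[ℂ] WeakDual ℂ E :=
    { toFun := fun f => StrongDual.toWeakDual ((WeakDual.toStrongDual f).comp L)
      map_add' := fun f g => rfl
      map_smul' := fun c f => rfl
      cont := WeakDual.continuous_of_continuous_eval fun y => WeakDual.eval_continuous (L y) }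
  have hP : ∀ f, P (P f) = f := fun f => DFunLike.ext _ _ fun x => congrArg f (hL x)
  exact ⟨ContinuousLinearEquiv.equivOfInverse P P hP hP, fun f x => rfl⟩

theorem hankel_sisMap {ν : ℂ} {p : ℤ} {T : 𝓢(ℂ, ℂ) × 𝓢(ℂ, ℂ) → 𝓢(ℂ, ℂ) × 𝓢(ℂ, ℂ)}
    (hT : ∀ φ (u : ℂ), u ≠ 0 → planeHankel ν p (sisFun ν p φ) u = sisFun ν p (T φ) u)
    (φ : 𝓢(ℂ, ℂ) × 𝓢(ℂ, ℂ)) : hankel ν p (sisMap ν p φ) = sisMap ν p (T φ) := by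
  funext u
  rw [sisMap_apply, ← hT φ u u.ne_zero]
  exact hankel_eq_planeHankel ν p (sisFun ν p φ) u

/-- The Hankel transform as a continuous involution of the space of test functions. -/
theorem exists_hankelCLM {ν : ℂ} (hν : ∀ n : ℤ, ν ≠ n) (hre : |ν.re| < 1) (p : ℤ) :
    ∃ L : Ssis ν p →L[ℂ] Ssis ν p, (∀ φ, L (L φ) = φ) ∧
      ∀ φ : Ssis ν p, (L φ : ℂˣ → ℂ) = hankel ν p φ := by
  obtain ⟨T, hT⟩ := exists_clm_planeHankel hν hre p
  have hsurj : Function.Surjective (Ssis.ofSchwartz ν p) := (sisMap ν p).surjective_rangeRestrict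
  have hH : ∀ φ, hankel ν p (Ssis.ofSchwartz ν p φ) = (Ssis.ofSchwartz ν p (T φ) : ℂˣ → ℂ) :=
    hankel_sisMap hT
  have hmem : ∀ φ : Ssis ν p, ∃ ψ : Ssis ν p, (ψ : ℂˣ → ℂ) = hankel ν p φ := fun φ => by
    obtain ⟨χ, rfl⟩ := hsurj φ
    exact ⟨_, (hH χ).symm⟩
  choose G hG using hmem
  have hGT : ∀ φ, G (Ssis.ofSchwartz ν p φ) = Ssis.ofSchwartz ν p (T φ) := fun φ =>
    Subtype.ext ((hG _).trans (hH φ))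
  refine ⟨⟨⟨⟨G, fun φ ψ => ?_⟩, fun c φ => ?_⟩, ?_⟩, fun φ => ?_, hG⟩
  · obtain ⟨φ, rfl⟩ := hsurj φ
    obtain ⟨ψ, rfl⟩ := hsurj ψ
    rw [← map_add, hGT, hGT, hGT, map_add, map_add]
  · obtain ⟨φ, rfl⟩ := hsurj φ
    change G (c • _) = c • G _
    rw [← map_smul, hGT, hGT, map_smul, map_smul]
  · refine continuous_coinduced_dom.2 ?_
    have : G ∘ Ssis.ofSchwartz ν p = Ssis.ofSchwartz ν p ∘ T := funext hGT
    change Continuous (G ∘ Ssis.ofSchwartz ν p)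
    rw [this]
    exact continuous_coinduced_rng.comp T.continuous
  · obtain ⟨φ, rfl⟩ := hsurj φ
    change G (G _) = _
    rw [hGT, hGT]
    exact Subtype.ext (funext fun z => sisFun_apply_apply hν hre p hT φ z.ne_zero)

end SisHankel

theorem mainTheorem8 (ν : ℂ) (hν : ∀ n : ℤ, ν ≠ n) (hre : |ν.re| < 1) (p : ℤ) :
    (∀ (φ : SisHankel.Ssis ν p) (u : ℂˣ),
      MeasureTheory.Integrable (SisHankel.hankelIntegrand ν p φ u) SisHankel.dzdzbar) ∧
    ∃ hmem : ∀ φ : SisHankel.Ssis ν p, SisHankel.hankel ν p φ ∈ SisHankel.sisSubmodule ν p,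
      (∃ H : SisHankel.Tsis ν p ≃L[ℂ] SisHankel.Tsis ν p,
        ∀ (f : SisHankel.Tsis ν p) (φ : SisHankel.Ssis ν p),
          H f φ = f (SisHankel.Ssis.mk (SisHankel.hankel ν p φ) (hmem φ)) ∧
          H f (SisHankel.Ssis.mk (SisHankel.hankel ν p φ) (hmem φ)) = f φ) ∧
      (∃ H : SisHankel.TsisWeak ν p ≃L[ℂ] SisHankel.TsisWeak ν p,
        ∀ (f : SisHankel.TsisWeak ν p) (φ : SisHankel.Ssis ν p),
          H f φ = f (SisHankel.Ssis.mk (SisHankel.hankel ν p φ) (hmem φ)) ∧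
          H f (SisHankel.Ssis.mk (SisHankel.hankel ν p φ) (hmem φ)) = f φ) := by
  obtain ⟨L, hLL, hL⟩ := SisHankel.exists_hankelCLM hν hre p
  refine ⟨fun φ u => ?_, fun φ => hL φ ▸ (L φ).2, ?_⟩
  · obtain ⟨_, χ, rfl⟩ := φ
    exact SisHankel.integrable_hankelIntegrand hν hre p χ u
  · have hmk : ∀ (φ : SisHankel.Ssis ν p)
        (h : SisHankel.hankel ν p φ ∈ SisHankel.sisSubmodule ν p),
        SisHankel.Ssis.mk (SisHankel.hankel ν p φ) h = L φ := fun φ h =>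
      Subtype.ext (hL φ).symm
    obtain ⟨H, hH⟩ := SisHankel.exists_strongDual_transpose L hLL
    obtain ⟨H', hH'⟩ := SisHankel.exists_weakDual_transpose L hLL
    refine ⟨⟨H, fun f φ => ?_⟩, ⟨H', fun f φ => ?_⟩⟩
    · rw [hmk, hH, hH, hLL]
      exact ⟨rfl, rfl⟩
    · rw [hmk, hH', hH', hLL]
      exact ⟨rfl, rfl⟩
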